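/- Fix $\mathbb K\in\{\mathbb R,\mathbb C\}$ and a universe of small sets. **Conventions.** A *Banach category* is a category enriched in Banach spaces and linear contractions (projective tensor product): hom-sets are Banach spaces, composition is bilinear with $\|gf\|\le\|g\|\,\|f\|$, and $\|\mathrm{id}_a\|\le 1$. A functor is *contractive* if it is linear and norm-nonincreasing on hom-spaces. $\mathbf{Ban}$ is the Banach category of small Banach spaces and bounded linear maps. Let $K$ be a small Banach category and let $W\colon K^{op}\to\mathbf{Ban}$ and $D\colon K\to\mathcal A$ be contractive functors. A colimit of $D$ weighted by $W$ is an object $c$ with a natural family of linear contractions $W k\to\mathcal A(Dk,c)$ such that, for every $b$, composition identifies $\mathcal A(c,b)$ isometrically with the Banach space of uniformly bounded natural families $W k\to\mathcal A(Dk,b)$, with the supremum norm. A *Banach 2-space* is a Banach category that has all small weighted colimits. A contractive functor is *cocontinuous* if it preserves them; a contractive bifunctor is *bicocontinuous* if it is cocontinuous in each variable. In particular a Banach 2-space has tensors $E\otimes a$, where $E\in\mathbf{Ban}$ (so $\mathcal A(E\otimes a,b)\cong\mathbf{Ban}(E,\mathcal A(a,b))$ isometrically), and small coproducts $\sum_x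 a_x$ (so $\mathcal A(\sum_x a_x,b)$ is isometrically the space of bounded families $(a_x\to b)_x$ with the supremum norm). An *isometric isomorphism* of functors is a natural isomorphism that, like its inverse, has components of norm $\le 1$. For a small set $X$, $\ell(X,\mathcal A)=\mathbf{BanCat}(X,\mathcal A)$ is the Banach category of functors from the discrete category $X$ to $\mathcal A$, with uniformly bounded natural transformations as morphisms, normed by the supremum; $\ell(X)=\ell(X,\mathbf{Ban})$. A bicocontinuous bifunctor $i\colon\mathcal A\otimes\mathcal B\to\mathcal P$ of Banach 2-spaces *exhibits $\mathcal P$ as the bitensor product* $\mathcal A\boxtimes\mathcal B$ if, for every Banach 2-space $\mathcal C$: * every bicocontinuous $\varphi\colon\mathcal A\otimes\mathcal B\to\mathcal C$ admits a cocontinuous $T\colon\mathcal P\to\mathcal C$ and an isometric isomorphism $Ti\cong\varphi$; * for any two such factorizations $Si\cong\varphi$ and $Ti\cong\varphi$ there is a unique isometric isomorphism $S\cong T$ compatible with them; * for cocontinuous $S,T\colon\mathcal P\to\mathcal C$ and $M\ge 0$, every natural transformation $Si\Rightarrow Ti$ with components of norm $\le M$ is the restriction along $i$ of a unique natural transformation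 $S\Rightarrow T$ with components of norm $\le M$. **Theorem.** Let $X$ be a small set and $\mathcal A$ a Banach 2-space. Then $\ell(X)$ is a Banach 2-space, and the bifunctor $$\ell(X)\otimes\mathcal A\to\ell(X,\mathcal A),\qquad (\xi,a)\mapsto \xi\otimes a=(x\mapsto\xi_x\otimes a),$$ exhibits $\ell(X,\mathcal A)$ as the bitensor product $\ell(X)\boxtimes\mathcal A$ (in particular $\ell(X,\mathcal A)$ is a Banach 2-space and the bifunctor is bicocontinuous). Moreover: 1. *(Naturality in $\mathcal A$.)* For every cocontinuous $T\colon\mathcal A\to\mathcal B$ between Banach 2-spaces, $T_*\colon\ell(X,\mathcal A)\to\ell(X,\mathcal B)$, $(T_*\xi)_x=T\xi_x$, is cocontinuous, and there is a unique isometric isomorphism $T_*(\xi\otimes a)\cong\xi\otimes Ta$, natural in $(\xi,a)$ and compatible with the universal maps $\xi_x\to\mathcal A(a,\xi_x\otimes a)$ and $\xi_x\to\mathcal B(Ta,\xi_x\otimes Ta)$. 2. *(Naturality in $X$.)* For every map $p\colon X\to Y$ of small sets, $p_!\colon\ell(X,\mathcal A)\to\ell(Y,\mathcal A)$, $(p_!\xi)_y=\sum_{p(x)=y}\xi_x$,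 is cocontinuous, and there is a unique isometric isomorphism $p_!(\xi\otimes a)\cong p_!\xi\otimes a$, natural in $(\xi,a)$ and compatible with the coproduct injections and the universal maps of the tensors. 3. *(Vector integrals.)* Let $\mu$ be a $\mathbf{Ban}$-valued cosheaf on the Boolean algebra of subsets of $X$, that is, a functor $\mu\colon 2^X\to\mathbf{Ban}$ with values of norm $\le 1$ on morphisms such that for every countable partition $\mathcal E$ of a subset $E$ the maps $\mu(F)\to\mu(E)$, $F\in\mathcal E$, form a coproduct. For every Banach 2-space $\mathcal A$ let $$\int_X\xi\,d\mu=\sum_{x\in X}\mu(\{x\})\otimes\xi_x\qquad(\xi\in\ell(X,\mathcal A)).$$ Then $\int_X d\mu\colon\ell(X,\mathcal A)\to\mathcal A$ is cocontinuous; there is a unique isometric isomorphism $\int_X(\xi\otimes a)\,d\mu\cong\bigl(\int_X\xi\,d\mu\bigr)\otimes a$, natural in $(\xi,a)\in\ell(X)\otimes\mathcal A$ and compatible with the universal maps of the tensors and coproducts; and for every cocontinuous $T\colon\mathcal A\to\mathcal B$ between Banach 2-spaces there is a unique isometric isomorphism $T\bigl(\int_X\xi\,d\mu\bigr)\cong\int_X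 T_*\xi\,d\mu$, natural in $\xi\in\ell(X,\mathcal A)$ and compatible with these universal maps. -/

import Mathlib

open CategoryTheory Opposite
open scoped ENNReal

universe u v w v₁ v₂ v₃

noncomputable section

namespace BanachTwo

/-! ### Banach categories and contractive functors -/

/-- The part of the structure of a category enriched in Banach spaces and linear contractions
that does not mention the scalars: each hom-set is a complete normed group, and composition is
biadditive and contractive. -/
class PreBanachCategory (A : Type v) [Category.{u} A] where
  normed : ∀ a b : A, NormedAddCommGroup (a ⟶ b)
  complete : ∀ a b : A, CompleteSpace (a ⟶ b)
  add_comp : ∀ {a b c : A} (f g : a ⟶ b) (h : b ⟶ c), (f + g) ≫ h = f ≫ h + g ≫ h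
  comp_add : ∀ {a b c : A} (f : a ⟶ b) (g h : b ⟶ c), f ≫ (g + h) = f ≫ g + f ≫ h
  norm_comp_le : ∀ {a b c : A} (f : a ⟶ b) (g : b ⟶ c), ‖f ≫ g‖ ≤ ‖f‖ * ‖g‖
  norm_id_le : ∀ a : A, ‖𝟙 a‖ ≤ 1

attribute [reducible, instance] PreBanachCategory.normed

attribute [instance] PreBanachCategory.complete

/-- A Banach category: a category enriched in the monoidal category of Banach spaces over `𝕜`
and linear contractions, with the projective tensor product. -/
class BanachCategory (𝕜 : Type) [RCLike 𝕜] (A : Type v) [Category.{u} A]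
    [PreBanachCategory A] where
  normedSpace : ∀ a b : A, NormedSpace 𝕜 (a ⟶ b)
  smul_comp : ∀ {a b c : A} (r : 𝕜) (f : a ⟶ b) (g : b ⟶ c), (r • f) ≫ g = r • (f ≫ g)
  comp_smul : ∀ {a b c : A} (r : 𝕜) (f : a ⟶ b) (g : b ⟶ c), f ≫ (r • g) = r • (f ≫ g)

attribute [reducible, instance] BanachCategory.normedSpace

/-- Contractive (that is, enriched) functors between Banach categories. -/
structure IsContractive (𝕜 : Type) [RCLike 𝕜] {A : Type v₁} [Category.{u} A]
    [PreBanachCategory A] [BanachCategory 𝕜 A] {B : Type v₂} [Category.{u} B]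
    [PreBanachCategory B] [BanachCategory 𝕜 B] (T : A ⥤ B) : Prop where
  map_add : ∀ {a b : A} (f g : a ⟶ b), T.map (f + g) = T.map f + T.map g
  map_smul : ∀ {a b : A} (r : 𝕜) (f : a ⟶ b), T.map (r • f) = r • T.map f
  norm_map_le : ∀ {a b : A} (f : a ⟶ b), ‖T.map f‖ ≤ ‖f‖

/-- Contractive functors on the dual of a Banach category. -/
structure IsContractiveOp (𝕜 : Type) [RCLike 𝕜] {A : Type v₁} [Category.{u} A]
    [PreBanachCategory A] [BanachCategory 𝕜 A] {B : Type v₂} [Category.{u} B]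
    [PreBanachCategory B] [BanachCategory 𝕜 B] (T : Aᵒᵖ ⥤ B) : Prop where
  map_add : ∀ {a b : A} (f g : a ⟶ b), T.map (f + g).op = T.map f.op + T.map g.op
  map_smul : ∀ {a b : A} (r : 𝕜) (f : a ⟶ b), T.map (r • f).op = r • T.map f.op
  norm_map_le : ∀ {a b : A} (f : a ⟶ b), ‖T.map f.op‖ ≤ ‖f‖

section hom

variable {𝕜 : Type} [RCLike 𝕜] {A : Type v₁} [Category.{u} A]
    [PreBanachCategory A] [BanachCategory 𝕜 A] {B : Type v₂} [Category.{u} B]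
    [PreBanachCategory B] [BanachCategory 𝕜 B]

/-- Postcomposition, as a bounded linear map. -/
def postcomp (𝕜 : Type) [RCLike 𝕜] [BanachCategory 𝕜 A] (a : A) {b c : A} (g : b ⟶ c) :
    (a ⟶ b) →L[𝕜] (a ⟶ c) :=
  LinearMap.mkContinuous
    { toFun := fun f => f ≫ g
      map_add' := fun f f' => PreBanachCategory.add_comp f f' g
      map_smul' := fun r f => BanachCategory.smul_comp r f g } ‖g‖
    (fun f => by
      have := PreBanachCategory.norm_comp_le f g
      simpa [mul_comm] using this)

@[simp] theorem postcomp_apply (a : A) {b c : A} (g : b ⟶ c) (f : a ⟶ b) :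
    postcomp 𝕜 a g f = f ≫ g := rfl

/-- Precomposition, as a bounded linear map. -/
def precomp (𝕜 : Type) [RCLike 𝕜] [BanachCategory 𝕜 A] {a b : A} (f : a ⟶ b) (c : A) :
    (b ⟶ c) →L[𝕜] (a ⟶ c) :=
  LinearMap.mkContinuous
    { toFun := fun g => f ≫ g
      map_add' := fun g g' => PreBanachCategory.comp_add f g g'
      map_smul' := fun r g => BanachCategory.comp_smul r f g } ‖f‖
    (fun g => PreBanachCategory.norm_comp_le f g)

@[simp] theorem precomp_apply {a b : A} (f : a ⟶ b) (c : A) (g : b ⟶ c) :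
    precomp 𝕜 f c g = f ≫ g := rfl

theorem norm_precomp_le {a b : A} (f : a ⟶ b) (c : A) : ‖precomp 𝕜 f c‖ ≤ ‖f‖ :=
  LinearMap.mkContinuous_norm_le _ (norm_nonneg f) _

/-- The action of a contractive functor on a hom-space, as a bounded linear map. -/
def IsContractive.mapCLM {T : A ⥤ B} (hT : IsContractive 𝕜 T) (a b : A) :
    (a ⟶ b) →L[𝕜] (T.obj a ⟶ T.obj b) :=
  LinearMap.mkContinuous
    { toFun := fun f => T.map f
      map_add' := hT.map_add
      map_smul' := fun r f => hT.map_smul r f } 1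
    (fun f => by simpa using hT.norm_map_le f)

@[simp] theorem IsContractive.mapCLM_apply {T : A ⥤ B} (hT : IsContractive 𝕜 T) {a b : A}
    (f : a ⟶ b) : hT.mapCLM a b f = T.map f := rfl

theorem zero_comp {a b c : A} (f : b ⟶ c) : (0 : a ⟶ b) ≫ f = 0 := by
  have h := PreBanachCategory.add_comp (0 : a ⟶ b) 0 f
  simpa using h

theorem comp_zero {a b c : A} (f : a ⟶ b) : f ≫ (0 : b ⟶ c) = 0 := by
  have h := PreBanachCategory.comp_add f (0 : b ⟶ c) 0
  simpa using h

end hom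

/-! ### The Banach category of Banach spaces -/

/-- Banach spaces over `𝕜`. -/
structure BanSp (𝕜 : Type) [RCLike 𝕜] : Type (u + 1) where
  carrier : Type u
  [normed : NormedAddCommGroup carrier]
  [space : NormedSpace 𝕜 carrier]
  [complete : CompleteSpace carrier]

namespace BanSp

variable {𝕜 : Type} [RCLike 𝕜]

instance : CoeSort (BanSp.{u} 𝕜) (Type u) := ⟨BanSp.carrier⟩

attribute [instance] BanSp.normed BanSp.space

attribute [instance] BanSp.complete

/-- The category of Banach spaces and bounded linear maps. -/
instance : Category.{u} (BanSp.{u} 𝕜) where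
  Hom E F := E →L[𝕜] F
  id E := ContinuousLinearMap.id 𝕜 E
  comp f g := ContinuousLinearMap.comp g f

/-- The bounded linear map underlying a morphism of Banach spaces. -/
abbrev toCLM {E F : BanSp.{u} 𝕜} (f : E ⟶ F) : E →L[𝕜] F := f

/-- A bounded linear map as a morphism of Banach spaces. -/
abbrev ofCLM {E F : BanSp.{u} 𝕜} (f : E →L[𝕜] F) : E ⟶ F := f

instance : PreBanachCategory (BanSp.{u} 𝕜) where
  normed E F := inferInstanceAs (NormedAddCommGroup (E →L[𝕜] F))
  complete E F := inferInstanceAs (CompleteSpace (E →L[𝕜] F))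
  add_comp f g h := ContinuousLinearMap.comp_add (toCLM h) (toCLM f) (toCLM g)
  comp_add f g h := ContinuousLinearMap.add_comp (toCLM g) (toCLM h) (toCLM f)
  norm_comp_le f g := by
    rw [mul_comm]
    exact ContinuousLinearMap.opNorm_comp_le (toCLM g) (toCLM f)
  norm_id_le E := ContinuousLinearMap.norm_id_le

instance : BanachCategory 𝕜 (BanSp.{u} 𝕜) where
  normedSpace E F := inferInstanceAs (NormedSpace 𝕜 (E →L[𝕜] F))
  smul_comp r f g := ContinuousLinearMap.comp_smul (toCLM g) r (toCLM f)
  comp_smul r f g := ContinuousLinearMap.smul_comp r (toCLM g) (toCLM f)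

end BanSp

/-! ### Weighted colimits, cocomplete Banach categories, cocontinuous functors -/

section colimits

variable {𝕜 : Type} [RCLike 𝕜]

/-- A `W`-weighted cocone under `D` with vertex `c`: a natural family of bounded linear maps
`W k → A(D k, c)`. -/
structure WeightedCocone {K : Type u} [Category.{u} K] {A : Type v} [Category.{u} A]
    [PreBanachCategory A] [BanachCategory 𝕜 A]
    (W : Kᵒᵖ ⥤ BanSp.{u} 𝕜) (D : K ⥤ A) (c : A) where
  leg : ∀ k : K, W.obj (op k) →L[𝕜] (D.obj k ⟶ c)
  natural : ∀ {k l : K} (f : k ⟶ l) (x : W.obj (op l)),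
    leg k (BanSp.toCLM (W.map f.op) x) = D.map f ≫ leg l x

/-- The cocone `s` exhibits `c` as the colimit of `D` weighted by `W`: composition with `s` is,
for every `b`, an isometric isomorphism from `A(c, b)` onto the Banach space of uniformly bounded
natural families `W k → A(D k, b)`, with the supremum norm. -/
structure IsWeightedColimit {K : Type u} [Category.{u} K] {A : Type v} [Category.{u} A]
    [PreBanachCategory A] [BanachCategory 𝕜 A]
    {W : Kᵒᵖ ⥤ BanSp.{u} 𝕜} {D : K ⥤ A} {c : A} (s : WeightedCocone W D c) : Prop where
  norm_leg_le : ∀ k, ‖s.leg k‖ ≤ 1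
  exists_desc : ∀ (b : A) (t : WeightedCocone W D b) (M : ℝ), 0 ≤ M → (∀ k, ‖t.leg k‖ ≤ M) →
    ∃ f : c ⟶ b, ‖f‖ ≤ M ∧ ∀ (k : K) (x : W.obj (op k)), s.leg k x ≫ f = t.leg k x
  hom_ext : ∀ (b : A) (f g : c ⟶ b),
    (∀ (k : K) (x : W.obj (op k)), s.leg k x ≫ f = s.leg k x ≫ g) → f = g

/-- The image of a weighted cocone under a contractive functor. -/
def WeightedCocone.map {K : Type u} [Category.{u} K] {A : Type v₁} [Category.{u} A]
    [PreBanachCategory A] [BanachCategory 𝕜 A] {B : Type v₂} [Category.{u} B]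
    [PreBanachCategory B] [BanachCategory 𝕜 B]
    {W : Kᵒᵖ ⥤ BanSp.{u} 𝕜} {D : K ⥤ A} {c : A} (s : WeightedCocone W D c)
    (T : A ⥤ B) (hT : IsContractive 𝕜 T) : WeightedCocone W (D ⋙ T) (T.obj c) where
  leg k := (hT.mapCLM (D.obj k) c).comp (s.leg k)
  natural f x := by simp [s.natural f x]

/-- A Banach 2-space: a Banach category with all small weighted colimits. -/
class IsBanachTwoSpace (𝕜 : Type) [RCLike 𝕜] (A : Type v) [Category.{u} A]
    [PreBanachCategory A] [BanachCategory 𝕜 A] : Prop where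
  exists_colimit : ∀ (K : Type u) [Category.{u} K] [PreBanachCategory K] [BanachCategory 𝕜 K]
    (W : Kᵒᵖ ⥤ BanSp.{u} 𝕜) (D : K ⥤ A), IsContractiveOp 𝕜 W → IsContractive 𝕜 D →
    ∃ (c : A) (s : WeightedCocone W D c), IsWeightedColimit s

/-- Cocontinuous functors: contractive functors that preserve all small weighted colimits. -/
structure IsCocontinuous (𝕜 : Type) [RCLike 𝕜] {A : Type v₁} [Category.{u} A]
    [PreBanachCategory A] [BanachCategory 𝕜 A] {B : Type v₂} [Category.{u} B]
    [PreBanachCategory B] [BanachCategory 𝕜 B] (T : A ⥤ B) : Prop where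
  contractive : IsContractive 𝕜 T
  preserves : ∀ (K : Type u) [Category.{u} K] [PreBanachCategory K] [BanachCategory 𝕜 K]
    (W : Kᵒᵖ ⥤ BanSp.{u} 𝕜) (D : K ⥤ A), IsContractiveOp 𝕜 W → IsContractive 𝕜 D →
    ∀ (c : A) (s : WeightedCocone W D c), IsWeightedColimit s →
      IsWeightedColimit (s.map T contractive)

end colimits

/-! ### Bifunctors and the bitensor product -/

section bitensor

variable {A : Type v₁} [Category.{u} A] {B : Type v₂} [Category.{u} B]
    {C : Type v₃} [Category.{u} C] [PreBanachCategory C]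

/-- Isometric natural isomorphisms: both directions are contractive. -/
def IsIsometricIso {S T : A ⥤ C} (σ : S ≅ T) : Prop :=
  ∀ a, ‖σ.hom.app a‖ ≤ 1 ∧ ‖σ.inv.app a‖ ≤ 1

/-- Isometric natural isomorphisms of bifunctors. -/
def IsIsometricIso₂ {S T : A ⥤ B ⥤ C} (σ : S ≅ T) : Prop :=
  ∀ a b, ‖(σ.hom.app a).app b‖ ≤ 1 ∧ ‖(σ.inv.app a).app b‖ ≤ 1

/-- A contractive bifunctor `A ⊗ B → C` (given by its compatible partial functors) that is
cocontinuous in each variable. -/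
structure IsBicocontinuous (𝕜 : Type) [RCLike 𝕜] [PreBanachCategory A] [BanachCategory 𝕜 A]
    [PreBanachCategory B] [BanachCategory 𝕜 B] [BanachCategory 𝕜 C] (φ : A ⥤ B ⥤ C) :
    Prop where
  right : ∀ a, IsCocontinuous 𝕜 (φ.obj a)
  left : ∀ b, IsCocontinuous 𝕜 (φ.flip.obj b)

/-- Postcomposition of a bifunctor with a functor: `(a, b) ↦ T (i (a, b))`. -/
abbrev bifunctorComp {P : Type v₃} [Category.{u} P] {D : Type w} [Category.{u} D]
    (i : A ⥤ B ⥤ P) (T : P ⥤ D) : A ⥤ B ⥤ D :=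
  i ⋙ (Functor.whiskeringRight B P D).obj T

end bitensor

/-- The bifunctor `i : A ⊗ B → P` exhibits `P` as the bitensor product of the Banach 2-spaces
`A` and `B`: it is bicocontinuous and universal as such. Every bicocontinuous bifunctor to a
Banach 2-space `C` factors up to isometric isomorphism through `i` via a cocontinuous functor, and
this factorization is unique up to a unique isometric isomorphism that is compatible with the
given ones; moreover, bounded natural transformations between cocontinuous functors on `P` are
the same, with the same bounds, as those between their restrictions along `i`. -/
structure IsBitensor (𝕜 : Type) [RCLike 𝕜]
    {A : Type v₁} [Category.{u} A] [PreBanachCategory A] [BanachCategory 𝕜 A]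
    {B : Type v₂} [Category.{u} B] [PreBanachCategory B] [BanachCategory 𝕜 B]
    {P : Type v₃} [Category.{u} P] [PreBanachCategory P] [BanachCategory 𝕜 P]
    (i : A ⥤ B ⥤ P) : Prop where
  cocomplete : IsBanachTwoSpace 𝕜 P
  bicocontinuous : IsBicocontinuous 𝕜 i
  exists_factor : ∀ (C : Type w) [Category.{u} C] [PreBanachCategory C] [BanachCategory 𝕜 C]
    [IsBanachTwoSpace 𝕜 C] (φ : A ⥤ B ⥤ C), IsBicocontinuous 𝕜 φ →
    ∃ T : P ⥤ C, IsCocontinuous 𝕜 T ∧ ∃ σ : bifunctorComp i T ≅ φ, IsIsometricIso₂ σ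
  unique_factor : ∀ (C : Type w) [Category.{u} C] [PreBanachCategory C] [BanachCategory 𝕜 C]
    [IsBanachTwoSpace 𝕜 C] (φ : A ⥤ B ⥤ C), IsBicocontinuous 𝕜 φ →
    ∀ S T : P ⥤ C, IsCocontinuous 𝕜 S → IsCocontinuous 𝕜 T →
    ∀ (σ : bifunctorComp i S ≅ φ) (τ : bifunctorComp i T ≅ φ),
      IsIsometricIso₂ σ → IsIsometricIso₂ τ →
      ∃! θ : S ≅ T, IsIsometricIso θ ∧
        ∀ a b, θ.hom.app ((i.obj a).obj b) ≫ (τ.hom.app a).app b = (σ.hom.app a).app b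
  extend_transformation : ∀ (C : Type w) [Category.{u} C] [PreBanachCategory C]
    [BanachCategory 𝕜 C] [IsBanachTwoSpace 𝕜 C] (S T : P ⥤ C), IsCocontinuous 𝕜 S →
    IsCocontinuous 𝕜 T → ∀ (β : bifunctorComp i S ⟶ bifunctorComp i T) (M : ℝ), 0 ≤ M →
    (∀ a b, ‖(β.app a).app b‖ ≤ M) →
    ∃! θ : S ⟶ T, (∀ p, ‖θ.app p‖ ≤ M) ∧
      ∀ a b, θ.app ((i.obj a).obj b) = (β.app a).app b

/-! ### Banach spaces form a Banach 2-space -/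

section ban

variable {𝕜 : Type} [RCLike 𝕜] {K : Type u} [Category.{u} K]

/-- The dual Banach space. -/
def BanSp.dual (E : BanSp.{u} 𝕜) : BanSp.{u} 𝕜 := ⟨E →L[𝕜] 𝕜⟩

/-- The scalar bilinear form given by a morphism to a dual space. -/
def BanSp.form {E F : BanSp.{u} 𝕜} (β : E ⟶ BanSp.dual F) : E →L[𝕜] F →L[𝕜] 𝕜 := β

theorem BanSp.form_add {E F : BanSp.{u} 𝕜} (β γ : E ⟶ BanSp.dual F) (x : E) (y : F) :
    BanSp.form (β + γ) x y = BanSp.form β x y + BanSp.form γ x y := rfl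

theorem BanSp.form_smul {E F : BanSp.{u} 𝕜} (r : 𝕜) (β : E ⟶ BanSp.dual F) (x : E) (y : F) :
    BanSp.form (r • β) x y = r • BanSp.form β x y := rfl

theorem BanSp.form_zero {E F : BanSp.{u} 𝕜} (x : E) (y : F) :
    BanSp.form (0 : E ⟶ BanSp.dual F) x y = 0 := rfl

theorem BanSp.norm_form {E F : BanSp.{u} 𝕜} (β : E ⟶ BanSp.dual F) : ‖BanSp.form β‖ = ‖β‖ := rfl

/-- Uniformly bounded natural families of scalar bilinear forms on `W k × D k`. -/
def BanSp.forms (W : Kᵒᵖ ⥤ BanSp.{u} 𝕜) (D : K ⥤ BanSp.{u} 𝕜) :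
    Submodule 𝕜 (lp (fun k : K => W.obj (op k) ⟶ BanSp.dual (D.obj k)) ∞) where
  carrier := {β | ∀ (k l : K) (f : k ⟶ l) (x : W.obj (op l)) (y : D.obj k),
    BanSp.form (β k) (BanSp.toCLM (W.map f.op) x) y =
      BanSp.form (β l) x (BanSp.toCLM (D.map f) y)}
  add_mem' := by
    intro β γ hβ hγ k l f x y
    simp [BanSp.form_add, hβ k l f x y, hγ k l f x y]
  zero_mem' := by intro k l f x y; simp [BanSp.form_zero]
  smul_mem' := by
    intro r β hβ k l f x y
    simp [BanSp.form_smul, hβ k l f x y]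

theorem BanSp.form_bound (W : Kᵒᵖ ⥤ BanSp.{u} 𝕜) (D : K ⥤ BanSp.{u} 𝕜) (k : K)
    (x : W.obj (op k)) (y : D.obj k) (β : BanSp.forms W D) :
    ‖BanSp.form (β.1 k) x y‖ ≤ ‖x‖ * ‖y‖ * ‖β‖ := by
  have h1 := (BanSp.form (β.1 k)).le_opNorm₂ x y
  have h2 : ‖β.1 k‖ ≤ ‖β.1‖ := lp.norm_apply_le_norm ENNReal.top_ne_zero β.1 k
  rw [BanSp.norm_form] at h1
  calc ‖BanSp.form (β.1 k) x y‖ ≤ ‖β.1 k‖ * ‖x‖ * ‖y‖ := h1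
    _ ≤ ‖β.1‖ * ‖x‖ * ‖y‖ := by gcongr
    _ = ‖x‖ * ‖y‖ * ‖β‖ := by rw [Submodule.coe_norm]; ring

/-- Evaluation of forms at a pair of vectors. -/
def BanSp.evalForm₀ (W : Kᵒᵖ ⥤ BanSp.{u} 𝕜) (D : K ⥤ BanSp.{u} 𝕜) (k : K)
    (x : W.obj (op k)) (y : D.obj k) : BanSp.forms W D →L[𝕜] 𝕜 :=
  LinearMap.mkContinuous
    { toFun := fun β : BanSp.forms W D => BanSp.form (β.1 k) x y
      map_add' := fun β γ => by simp [BanSp.form_add]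
      map_smul' := fun r β => by simp [BanSp.form_smul] } (‖x‖ * ‖y‖)
    (BanSp.form_bound W D k x y)

/-- The dual of the space of forms. -/
def BanSp.formsDual (W : Kᵒᵖ ⥤ BanSp.{u} 𝕜) (D : K ⥤ BanSp.{u} 𝕜) : BanSp.{u} 𝕜 :=
  ⟨BanSp.forms W D →L[𝕜] 𝕜⟩

/-- Evaluation of forms at a pair of vectors. -/
def BanSp.evalForm (W : Kᵒᵖ ⥤ BanSp.{u} 𝕜) (D : K ⥤ BanSp.{u} 𝕜) (k : K)
    (x : W.obj (op k)) (y : D.obj k) : BanSp.formsDual W D := BanSp.evalForm₀ W D k x y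

/-- An element of the dual of the space of forms as a functional. -/
def BanSp.formsDualCLM (W : Kᵒᵖ ⥤ BanSp.{u} 𝕜) (D : K ⥤ BanSp.{u} 𝕜)
    (ψ : BanSp.formsDual W D) : BanSp.forms W D →L[𝕜] 𝕜 := ψ

theorem BanSp.formsDual_ext (W : Kᵒᵖ ⥤ BanSp.{u} 𝕜) (D : K ⥤ BanSp.{u} 𝕜)
    {ψ ψ' : BanSp.formsDual W D}
    (h : ∀ β, BanSp.formsDualCLM W D ψ β = BanSp.formsDualCLM W D ψ' β) : ψ = ψ' :=
  ContinuousLinearMap.ext h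

section

variable (W : Kᵒᵖ ⥤ BanSp.{u} 𝕜) (D : K ⥤ BanSp.{u} 𝕜)

theorem BanSp.evalForm_add_left (k : K) (x x' : W.obj (op k)) (y : D.obj k) :
    BanSp.evalForm W D k (x + x') y = BanSp.evalForm W D k x y + BanSp.evalForm W D k x' y :=
  BanSp.formsDual_ext W D fun β => (BanSp.form (β.1 k)).map_add₂ x x' y

theorem BanSp.evalForm_smul_left (k : K) (r : 𝕜) (x : W.obj (op k)) (y : D.obj k) :
    BanSp.evalForm W D k (r • x) y = r • BanSp.evalForm W D k x y :=
  BanSp.formsDual_ext W D fun β => (BanSp.form (β.1 k)).map_smul₂ r x y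

theorem BanSp.evalForm_add_right (k : K) (x : W.obj (op k)) (y y' : D.obj k) :
    BanSp.evalForm W D k x (y + y') = BanSp.evalForm W D k x y + BanSp.evalForm W D k x y' :=
  BanSp.formsDual_ext W D fun β => (BanSp.form (β.1 k) x).map_add y y'

theorem BanSp.evalForm_smul_right (k : K) (r : 𝕜) (x : W.obj (op k)) (y : D.obj k) :
    BanSp.evalForm W D k x (r • y) = r • BanSp.evalForm W D k x y :=
  BanSp.formsDual_ext W D fun β => (BanSp.form (β.1 k) x).map_smul r y

theorem BanSp.norm_evalForm_le (k : K) (x : W.obj (op k)) (y : D.obj k) :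
    ‖BanSp.evalForm W D k x y‖ ≤ ‖x‖ * ‖y‖ :=
  ContinuousLinearMap.opNorm_le_bound (BanSp.evalForm₀ W D k x y) (by positivity)
    (BanSp.form_bound W D k x y)

theorem BanSp.evalForm_natural {k l : K} (f : k ⟶ l) (x : W.obj (op l)) (y : D.obj k) :
    BanSp.evalForm W D k (BanSp.toCLM (W.map f.op) x) y =
      BanSp.evalForm W D l x (BanSp.toCLM (D.map f) y) :=
  BanSp.formsDual_ext W D fun β => β.2 k l f x y

/-- The closed linear span of the evaluations: the weighted colimit of Banach spaces. -/
def BanSp.colimitSpace : Submodule 𝕜 (BanSp.formsDual W D) :=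
  (Submodule.span 𝕜 {ψ | ∃ (k : K) (x : W.obj (op k)) (y : D.obj k),
    BanSp.evalForm W D k x y = ψ}).topologicalClosure

instance : CompleteSpace (BanSp.colimitSpace W D) :=
  (Submodule.isClosed_topologicalClosure _).completeSpace_coe

theorem BanSp.evalForm_mem (k : K) (x : W.obj (op k)) (y : D.obj k) :
    BanSp.evalForm W D k x y ∈ BanSp.colimitSpace W D :=
  Submodule.le_topologicalClosure _ (Submodule.subset_span ⟨k, x, y, rfl⟩)

/-- The weighted colimit of Banach spaces, as an object. -/
def BanSp.colimitObj : BanSp.{u} 𝕜 := ⟨BanSp.colimitSpace W D⟩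

/-- The inclusion of the weighted colimit in the dual of the space of forms. -/
def BanSp.colimitIncl : BanSp.colimitObj W D →ₗᵢ[𝕜] BanSp.formsDual W D :=
  (BanSp.colimitSpace W D).subtypeₗᵢ

/-- The evaluations as elements of the weighted colimit. -/
def BanSp.colimitMk (k : K) (x : W.obj (op k)) (y : D.obj k) : BanSp.colimitObj W D :=
  (⟨BanSp.evalForm W D k x y, BanSp.evalForm_mem W D k x y⟩ : BanSp.colimitSpace W D)

theorem BanSp.colimitIncl_mk (k : K) (x : W.obj (op k)) (y : D.obj k) :
    BanSp.colimitIncl W D (BanSp.colimitMk W D k x y) = BanSp.evalForm W D k x y := rfl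

theorem BanSp.colimitObj_dense (S : Submodule 𝕜 (BanSp.colimitObj W D))
    (hS : IsClosed (S : Set (BanSp.colimitObj W D)))
    (h : ∀ k x y, BanSp.colimitMk W D k x y ∈ S) (z : BanSp.colimitObj W D) : z ∈ S := by
  have hle : BanSp.colimitSpace W D ≤ S.map (BanSp.colimitIncl W D).toLinearMap := by
    refine Submodule.topologicalClosure_minimal _ ?_ ?_
    · rw [Submodule.span_le]
      rintro _ ⟨k, x, y, rfl⟩
      exact ⟨_, h k x y, rfl⟩
    · have := (BanSp.colimitIncl W D).isometry.isClosedEmbedding.isClosedMap _ hS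
      simpa using this
  obtain ⟨z', hz', he⟩ := hle z.2
  have : z' = z := (BanSp.colimitIncl W D).injective he
  exact this ▸ hz'

/-- One vector of the weight acting as a bounded linear map into the colimit. -/
def BanSp.colimitLeg₀ (k : K) (x : W.obj (op k)) : D.obj k →L[𝕜] BanSp.colimitObj W D :=
  LinearMap.mkContinuous
    { toFun := BanSp.colimitMk W D k x
      map_add' := fun y y' => (BanSp.colimitIncl W D).injective
        (BanSp.evalForm_add_right W D k x y y')
      map_smul' := fun r y => (BanSp.colimitIncl W D).injective
        (BanSp.evalForm_smul_right W D k r x y) } ‖x‖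
    (fun y => BanSp.norm_evalForm_le W D k x y)

/-- The legs of the colimiting cocone. -/
def BanSp.colimitLeg (k : K) : W.obj (op k) →L[𝕜] (D.obj k ⟶ BanSp.colimitObj W D) :=
  LinearMap.mkContinuous
    { toFun := fun x => BanSp.ofCLM (BanSp.colimitLeg₀ W D k x)
      map_add' := fun x x' => ContinuousLinearMap.ext fun y =>
        (BanSp.colimitIncl W D).injective (BanSp.evalForm_add_left W D k x x' y)
      map_smul' := fun r x => ContinuousLinearMap.ext fun y =>
        (BanSp.colimitIncl W D).injective (BanSp.evalForm_smul_left W D k r x y) } 1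
    (fun x => by
      rw [one_mul]
      exact ContinuousLinearMap.opNorm_le_bound (BanSp.colimitLeg₀ W D k x) (norm_nonneg x)
        (fun y => BanSp.norm_evalForm_le W D k x y))

theorem BanSp.norm_colimitLeg_le (k : K) : ‖BanSp.colimitLeg W D k‖ ≤ 1 :=
  ContinuousLinearMap.opNorm_le_bound _ zero_le_one (fun x => by
    rw [one_mul]
    exact ContinuousLinearMap.opNorm_le_bound (BanSp.colimitLeg₀ W D k x) (norm_nonneg x)
      (fun y => BanSp.norm_evalForm_le W D k x y))

theorem BanSp.toCLM_colimitLeg (k : K) (x : W.obj (op k)) (y : D.obj k) :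
    BanSp.toCLM (BanSp.colimitLeg W D k x) y = BanSp.colimitMk W D k x y := rfl

/-- The colimiting weighted cocone of Banach spaces. -/
def BanSp.colimitCocone : WeightedCocone W D (BanSp.colimitObj W D) where
  leg k := BanSp.colimitLeg W D k
  natural f x := ContinuousLinearMap.ext fun y =>
    (BanSp.colimitIncl W D).injective (BanSp.evalForm_natural W D f x y)

end

/-- A functional `ψ` on `G` turns a bounded linear map `E → (F ⟶ G)` into a form on `E × F`. -/
def BanSp.pull {E F G : BanSp.{u} 𝕜} (t : E →L[𝕜] (F ⟶ G)) (ψ : StrongDual 𝕜 G) :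
    E →L[𝕜] (F →L[𝕜] 𝕜) :=
  LinearMap.mkContinuous
    { toFun := fun x => ψ.comp (BanSp.toCLM (t x))
      map_add' := fun x x' => by rw [map_add]; exact ψ.comp_add _ _
      map_smul' := fun r x => by
        rw [map_smul]
        exact ContinuousLinearMap.comp_smul ψ r (BanSp.toCLM (t x)) } (‖ψ‖ * ‖t‖)
    (fun x => by
      calc ‖ψ.comp (BanSp.toCLM (t x))‖ ≤ ‖ψ‖ * ‖BanSp.toCLM (t x)‖ := ψ.opNorm_comp_le _
        _ ≤ ‖ψ‖ * (‖t‖ * ‖x‖) := by gcongr; exact t.le_opNorm x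
        _ = ‖ψ‖ * ‖t‖ * ‖x‖ := by ring)

theorem BanSp.pull_apply {E F G : BanSp.{u} 𝕜} (t : E →L[𝕜] (F ⟶ G)) (ψ : StrongDual 𝕜 G)
    (x : E) (y : F) : BanSp.pull t ψ x y = ψ (BanSp.toCLM (t x) y) := rfl

theorem BanSp.norm_pull_le {E F G : BanSp.{u} 𝕜} (t : E →L[𝕜] (F ⟶ G)) (ψ : StrongDual 𝕜 G) :
    ‖BanSp.pull t ψ‖ ≤ ‖ψ‖ * ‖t‖ :=
  LinearMap.mkContinuous_norm_le _ (by positivity) _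

section

variable {W : Kᵒᵖ ⥤ BanSp.{u} 𝕜} {D : K ⥤ BanSp.{u} 𝕜} {b : BanSp.{u} 𝕜}

/-- A functional on the vertex of a bounded weighted cocone gives a family of forms. -/
def BanSp.pullForms₀ (t : WeightedCocone W D b) (M : ℝ) (ht : ∀ k, ‖t.leg k‖ ≤ M)
    (ψ : StrongDual 𝕜 b) : BanSp.forms W D :=
  ⟨⟨fun k => BanSp.ofCLM (F := BanSp.dual (D.obj k)) (BanSp.pull (t.leg k) ψ),
    memℓp_infty ⟨‖ψ‖ * M, by
      rintro _ ⟨k, rfl⟩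
      exact (BanSp.norm_pull_le (t.leg k) ψ).trans (by gcongr; exact ht k)⟩⟩,
    fun k l f x y => by
      change ψ (BanSp.toCLM (t.leg k _) y) = ψ (BanSp.toCLM (t.leg l x) _)
      rw [t.natural f x]
      rfl⟩

theorem BanSp.norm_pullForms₀_le (t : WeightedCocone W D b) (M : ℝ) (hM : 0 ≤ M)
    (ht : ∀ k, ‖t.leg k‖ ≤ M) (ψ : StrongDual 𝕜 b) :
    ‖BanSp.pullForms₀ t M ht ψ‖ ≤ M * ‖ψ‖ := by
  rw [Submodule.coe_norm]
  refine lp.norm_le_of_forall_le (by positivity) fun k => ?_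
  refine (BanSp.norm_pull_le (t.leg k) ψ).trans ?_
  rw [mul_comm]
  gcongr
  exact ht k

/-- The bounded linear map from functionals to families of forms. -/
def BanSp.pullForms (t : WeightedCocone W D b) (M : ℝ) (hM : 0 ≤ M)
    (ht : ∀ k, ‖t.leg k‖ ≤ M) : StrongDual 𝕜 b →L[𝕜] BanSp.forms W D :=
  LinearMap.mkContinuous
    { toFun := BanSp.pullForms₀ t M ht
      map_add' := fun _ _ => Subtype.ext (Subtype.ext (funext fun _ =>
        ContinuousLinearMap.ext fun _ => ContinuousLinearMap.ext fun _ => rfl))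
      map_smul' := fun _ _ => Subtype.ext (Subtype.ext (funext fun _ =>
        ContinuousLinearMap.ext fun _ => ContinuousLinearMap.ext fun _ => rfl)) } M
    (BanSp.norm_pullForms₀_le t M hM ht)

/-- The bidual Banach space. -/
def BanSp.bidual (b : BanSp.{u} 𝕜) : BanSp.{u} 𝕜 := ⟨StrongDual 𝕜 (StrongDual 𝕜 b)⟩

/-- The isometric inclusion in the bidual. -/
def BanSp.inclBidual (b : BanSp.{u} 𝕜) : b →ₗᵢ[𝕜] BanSp.bidual b :=
  NormedSpace.inclusionInDoubleDualLi 𝕜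

/-- The dual map, from the colimit to the bidual of the vertex. -/
def BanSp.toBidual (t : WeightedCocone W D b) (M : ℝ) (hM : 0 ≤ M)
    (ht : ∀ k, ‖t.leg k‖ ≤ M) :
    BanSp.colimitObj W D →L[𝕜] BanSp.bidual b :=
  LinearMap.mkContinuous
    { toFun := fun z => (BanSp.formsDualCLM W D (BanSp.colimitIncl W D z)).comp
        (BanSp.pullForms t M hM ht)
      map_add' := fun z z' => ContinuousLinearMap.ext fun _ => rfl
      map_smul' := fun r z => ContinuousLinearMap.ext fun _ => rfl } M
    (fun z => by
      have h1 : ‖BanSp.pullForms t M hM ht‖ ≤ M :=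
        LinearMap.mkContinuous_norm_le _ hM _
      have h2 : ‖BanSp.formsDualCLM W D (BanSp.colimitIncl W D z)‖ = ‖z‖ := rfl
      rw [← h2, mul_comm]
      refine (ContinuousLinearMap.opNorm_comp_le _ _).trans ?_
      gcongr)

theorem BanSp.toBidual_mk (t : WeightedCocone W D b) (M : ℝ) (hM : 0 ≤ M)
    (ht : ∀ k, ‖t.leg k‖ ≤ M) (k : K) (x : W.obj (op k)) (y : D.obj k) :
    BanSp.toBidual t M hM ht (BanSp.colimitMk W D k x y) =
      BanSp.inclBidual b (BanSp.toCLM (t.leg k x) y) :=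
  ContinuousLinearMap.ext fun _ => rfl

theorem BanSp.toBidual_mem (t : WeightedCocone W D b) (M : ℝ) (hM : 0 ≤ M)
    (ht : ∀ k, ‖t.leg k‖ ≤ M) (z : BanSp.colimitObj W D) :
    BanSp.toBidual t M hM ht z ∈
      LinearMap.range (BanSp.inclBidual b).toLinearMap := by
  refine BanSp.colimitObj_dense W D ((LinearMap.range
    (BanSp.inclBidual b).toLinearMap).comap
      (BanSp.toBidual t M hM ht).toLinearMap) ?_ ?_ z
  · have := (BanSp.inclBidual b).isometry.isClosedEmbedding.isClosed_range
    exact this.preimage (BanSp.toBidual t M hM ht).continuous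
  · intro k x y
    exact ⟨_, (BanSp.toBidual_mk t M hM ht k x y).symm⟩

theorem BanSp.exists_desc (t : WeightedCocone W D b) (M : ℝ) (hM : 0 ≤ M)
    (ht : ∀ k, ‖t.leg k‖ ≤ M) :
    ∃ f : BanSp.colimitObj W D →L[𝕜] b, ‖f‖ ≤ M ∧
      ∀ k x y, f (BanSp.colimitMk W D k x y) = BanSp.toCLM (t.leg k x) y := by
  let J := BanSp.inclBidual b
  choose f hf using BanSp.toBidual_mem t M hM ht
  have hJ : ∀ z, J (f z) = BanSp.toBidual t M hM ht z := hf
  have hn : ∀ z, ‖f z‖ ≤ M * ‖z‖ := fun z => by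
    rw [← J.norm_map, hJ]
    have h : ‖BanSp.toBidual t M hM ht‖ ≤ M := LinearMap.mkContinuous_norm_le _ hM _
    exact (BanSp.toBidual t M hM ht).le_of_opNorm_le h z
  refine ⟨LinearMap.mkContinuous
    { toFun := f
      map_add' := fun z z' => J.injective (by rw [map_add, hJ, hJ, hJ, map_add])
      map_smul' := fun r z => J.injective (by
        rw [RingHom.id_apply, map_smul, hJ, hJ, map_smul]) } M hn,
    LinearMap.mkContinuous_norm_le _ hM _, fun k x y => J.injective ?_⟩
  exact (hJ _).trans (BanSp.toBidual_mk t M hM ht k x y)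

end

theorem BanSp.isWeightedColimit (W : Kᵒᵖ ⥤ BanSp.{u} 𝕜) (D : K ⥤ BanSp.{u} 𝕜) :
    IsWeightedColimit (BanSp.colimitCocone W D) where
  norm_leg_le k := BanSp.norm_colimitLeg_le W D k
  hom_ext b f g h := by
    refine ContinuousLinearMap.ext fun z => ?_
    exact BanSp.colimitObj_dense W D
      (LinearMap.eqLocus (BanSp.toCLM f).toLinearMap (BanSp.toCLM g).toLinearMap)
      (isClosed_eq (BanSp.toCLM f).continuous (BanSp.toCLM g).continuous)
      (fun k x y => congrArg (fun q => BanSp.toCLM q y) (h k x)) z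
  exists_desc b t M hM ht := by
    obtain ⟨f, hf, h⟩ := BanSp.exists_desc t M hM ht
    exact ⟨BanSp.ofCLM f, hf, fun k x => ContinuousLinearMap.ext fun y => h k x y⟩

instance : IsBanachTwoSpace 𝕜 (BanSp.{u} 𝕜) where
  exists_colimit _ _ _ _ W D _ _ :=
    ⟨BanSp.colimitObj W D, BanSp.colimitCocone W D, BanSp.isWeightedColimit W D⟩

end ban

/-! ### The free Banach category on a set, tensors and coproducts -/

/-- The free Banach category on a set `X`, seen as a discrete category: `hom(x, y)` is the scalar
field if `x = y` and zero otherwise. -/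
structure FreeBan (𝕜 : Type) [RCLike 𝕜] (X : Type u) : Type u where
  pt : X

namespace FreeBan

variable {𝕜 : Type} [RCLike 𝕜] {X : Type u}

/-- The hom-spaces of the free Banach category on a set. -/
def hom (x y : FreeBan 𝕜 X) : Submodule 𝕜 (ULift.{u} 𝕜) where
  carrier := {r | x ≠ y → r = 0}
  add_mem' := fun hr hs h => by simp [hr h, hs h]
  zero_mem' := fun _ => rfl
  smul_mem' := fun c _ hr h => by simp [hr h]

theorem isClosed_hom (x y : FreeBan 𝕜 X) : IsClosed (hom x y : Set (ULift.{u} 𝕜)) := by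
  by_cases h : x = y
  · have : (hom x y : Set (ULift.{u} 𝕜)) = Set.univ :=
      Set.eq_univ_of_forall fun r h' => absurd h h'
    rw [this]
    exact isClosed_univ
  · have : (hom x y : Set (ULift.{u} 𝕜)) = {0} :=
      Set.ext fun r => ⟨fun hr => hr h, fun hr _ => hr⟩
    rw [this]
    exact isClosed_singleton

instance : Category.{u} (FreeBan 𝕜 X) where
  Hom x y := hom x y
  id x := ⟨1, fun h => absurd rfl h⟩
  comp {x y z} r s := ⟨r.1 * s.1, fun h => by
    by_cases h' : x = y
    · have h'' : y ≠ z := fun e => h (h'.trans e)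
      rw [s.2 h'', mul_zero]
    · rw [r.2 h', zero_mul]⟩
  id_comp r := Subtype.ext (one_mul r.1)
  comp_id r := Subtype.ext (mul_one r.1)
  assoc r s t := Subtype.ext (mul_assoc r.1 s.1 t.1)

/-- The scalar underlying a morphism. -/
def coeff {x y : FreeBan 𝕜 X} (f : x ⟶ y) : 𝕜 := f.1.down

instance : PreBanachCategory (FreeBan 𝕜 X) where
  normed x y := inferInstanceAs (NormedAddCommGroup (hom x y))
  complete x y := (isClosed_hom x y).completeSpace_coe
  add_comp f g h := Subtype.ext (add_mul f.1 g.1 h.1)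
  comp_add f g h := Subtype.ext (mul_add f.1 g.1 h.1)
  norm_comp_le f g := norm_mul_le f.1 g.1
  norm_id_le _ := le_of_eq (norm_one (α := ULift.{u} 𝕜))

instance : BanachCategory 𝕜 (FreeBan 𝕜 X) where
  normedSpace x y := inferInstanceAs (NormedSpace 𝕜 (hom x y))
  smul_comp r f g := Subtype.ext (smul_mul_assoc r f.1 g.1)
  comp_smul r f g := Subtype.ext (mul_smul_comm r f.1 g.1)

theorem coeff_comp {x y z : FreeBan 𝕜 X} (f : x ⟶ y) (g : y ⟶ z) :
    coeff (f ≫ g) = coeff f * coeff g := rfl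

theorem coeff_id (x : FreeBan 𝕜 X) : coeff (𝟙 x) = 1 := rfl

theorem coeff_add {x y : FreeBan 𝕜 X} (f g : x ⟶ y) : coeff (f + g) = coeff f + coeff g := rfl

theorem coeff_smul {x y : FreeBan 𝕜 X} (r : 𝕜) (f : x ⟶ y) : coeff (r • f) = r * coeff f := rfl

theorem norm_coeff {x y : FreeBan 𝕜 X} (f : x ⟶ y) : ‖coeff f‖ = ‖f‖ := rfl

theorem coeff_eq_zero {x y : FreeBan 𝕜 X} (f : x ⟶ y) (h : x ≠ y) : coeff f = 0 :=
  congrArg ULift.down (f.2 h)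

variable {A : Type v} [Category.{u} A] [PreBanachCategory A]

/-- The matrix units of a family of objects. -/
def unit (a : X → A) (x y : FreeBan 𝕜 X) : a x.pt ⟶ a y.pt :=
  open Classical in if h : x = y then eqToHom (congrArg (fun z => a z.pt) h) else 0

theorem unit_self (a : X → A) (x : FreeBan 𝕜 X) : unit a x x = 𝟙 (a x.pt) := by
  simp [unit]

theorem norm_unit_le (a : X → A) (x y : FreeBan 𝕜 X) : ‖unit a x y‖ ≤ 1 := by
  by_cases h : x = y
  · subst h
    rw [unit_self]
    exact PreBanachCategory.norm_id_le _
  · simp [unit, h]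

variable [BanachCategory 𝕜 A]

/-- The contractive functor on the free Banach category given by a family of objects. -/
def functor (𝕜 : Type) [RCLike 𝕜] [BanachCategory 𝕜 A] (a : X → A) : FreeBan 𝕜 X ⥤ A where
  obj x := a x.pt
  map {x y} f := coeff f • unit a x y
  map_id x := by rw [unit_self, coeff_id, one_smul]
  map_comp {x y z} f g := by
    by_cases h : x = y
    · subst h
      rw [unit_self, BanachCategory.smul_comp, Category.id_comp, smul_smul, coeff_comp]
    · by_cases h' : y = z
      · subst h'
        rw [unit_self, BanachCategory.comp_smul, Category.comp_id, smul_smul, coeff_comp, mul_comm]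
      · rw [coeff_comp, coeff_eq_zero f h, zero_mul, zero_smul, zero_smul, zero_comp]

theorem isContractive_functor (a : X → A) : IsContractive 𝕜 (functor 𝕜 a) where
  map_add f g := add_smul (coeff f) (coeff g) _
  map_smul r f := mul_smul r (coeff f) _
  norm_map_le {x y} f := by
    change ‖coeff f • unit a x y‖ ≤ ‖f‖
    rw [norm_smul, norm_coeff]
    exact mul_le_of_le_one_right (norm_nonneg _) (norm_unit_le a x y)

/-- The contractive functor on the dual of the free Banach category given by a family. -/
def functorOp (𝕜 : Type) [RCLike 𝕜] [BanachCategory 𝕜 A] (a : X → A) :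
    (FreeBan 𝕜 X)ᵒᵖ ⥤ A where
  obj x := a x.unop.pt
  map {x y} f := coeff f.unop • unit a x.unop y.unop
  map_id x := by rw [unit_self, unop_id, coeff_id, one_smul]
  map_comp {x y z} f g := by
    by_cases h : x.unop = y.unop
    · obtain rfl := Opposite.unop_injective h
      rw [unit_self, BanachCategory.smul_comp, Category.id_comp, smul_smul, unop_comp,
        coeff_comp, mul_comm]
    · by_cases h' : y.unop = z.unop
      · obtain rfl := Opposite.unop_injective h'
        rw [unit_self, BanachCategory.comp_smul, Category.comp_id, smul_smul, unop_comp,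
          coeff_comp]
      · rw [unop_comp, coeff_comp, coeff_eq_zero f.unop (Ne.symm h), mul_zero, zero_smul,
          zero_smul, zero_comp]

theorem isContractiveOp_functorOp (a : X → A) : IsContractiveOp 𝕜 (functorOp 𝕜 a) where
  map_add f g := add_smul (coeff f) (coeff g) _
  map_smul r f := mul_smul r (coeff f) _
  norm_map_le {x y} f := by
    change ‖coeff f • unit a y x‖ ≤ ‖f‖
    rw [norm_smul, norm_coeff]
    exact mul_le_of_le_one_right (norm_nonneg _) (norm_unit_le a y x)

/-- A family of bounded linear maps is a weighted cocone on the free Banach category. -/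
def cocone {E : X → BanSp.{u} 𝕜} {a : X → A} {c : A} (t : ∀ x, E x →L[𝕜] (a x ⟶ c)) :
    WeightedCocone (functorOp 𝕜 E) (functor 𝕜 a) c where
  leg x := t x.pt
  natural {x y} f e := by
    change t x.pt (BanSp.toCLM (coeff f • unit E y x) e) = (coeff f • unit a x y) ≫ t y.pt e
    by_cases h : x = y
    · subst h
      rw [unit_self, unit_self, BanachCategory.smul_comp, Category.id_comp]
      exact (t x.pt).map_smul (coeff f) e
    · rw [coeff_eq_zero f h, zero_smul, zero_smul, zero_comp]
      exact (t x.pt).map_zero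

end FreeBan

section tensor

variable {𝕜 : Type} [RCLike 𝕜] {A : Type v} [Category.{u} A] [PreBanachCategory A]
    [BanachCategory 𝕜 A]

/-- A Banach 2-space has all sums of families of tensors `E x ⊗ a x`. -/
theorem exists_weightedSum [IsBanachTwoSpace 𝕜 A] {X : Type u} (E : X → BanSp.{u} 𝕜)
    (a : X → A) : ∃ (c : A) (s : ∀ x, E x →L[𝕜] (a x ⟶ c)), (∀ x, ‖s x‖ ≤ 1) ∧
      (∀ (b : A) (t : ∀ x, E x →L[𝕜] (a x ⟶ b)) (M : ℝ), 0 ≤ M → (∀ x, ‖t x‖ ≤ M) →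
        ∃ f : c ⟶ b, ‖f‖ ≤ M ∧ ∀ x e, s x e ≫ f = t x e) ∧
      (∀ (b : A) (f g : c ⟶ b), (∀ x e, s x e ≫ f = s x e ≫ g) → f = g) := by
  obtain ⟨c, s, hs⟩ := IsBanachTwoSpace.exists_colimit (𝕜 := 𝕜) (FreeBan 𝕜 X)
    (FreeBan.functorOp 𝕜 E) (FreeBan.functor 𝕜 a) (FreeBan.isContractiveOp_functorOp E)
    (FreeBan.isContractive_functor a)
  refine ⟨c, fun x => s.leg ⟨x⟩, fun x => hs.norm_leg_le ⟨x⟩, fun b t M hM ht => ?_,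
    fun b f g h => hs.hom_ext b f g fun k e => h k.pt e⟩
  obtain ⟨f, hf, h⟩ := hs.exists_desc b (FreeBan.cocone t) M hM (fun k => ht k.pt)
  exact ⟨f, hf, fun x e => h ⟨x⟩ e⟩

/-- The bounded linear map `η : E → A(a, c)` exhibits `c` as the tensor `E ⊗ a`: composition with
`η` is an isometric isomorphism from `A(c, b)` onto the space of bounded linear maps
`E → A(a, b)`, for every `b`. -/
structure IsTensor {E : BanSp.{u} 𝕜} {a c : A} (η : E →L[𝕜] (a ⟶ c)) : Prop where
  norm_le : ‖η‖ ≤ 1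
  exists_desc : ∀ (b : A) (t : E →L[𝕜] (a ⟶ b)), ∃ f : c ⟶ b, ‖f‖ ≤ ‖t‖ ∧ ∀ e, η e ≫ f = t e
  hom_ext : ∀ (b : A) (f g : c ⟶ b), (∀ e, η e ≫ f = η e ≫ g) → f = g

/-- The family `ι x : a x ⟶ c` exhibits `c` as the (enriched) coproduct of the `a x`: composition
with `ι` is an isometric isomorphism from `A(c, b)` onto the space of bounded families of
morphisms `a x ⟶ b` with the supremum norm, for every `b`. -/
structure IsCoproduct {X : Type w} {a : X → A} {c : A} (ι : ∀ x, a x ⟶ c) : Prop where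
  norm_le : ∀ x, ‖ι x‖ ≤ 1
  exists_desc : ∀ (b : A) (t : ∀ x, a x ⟶ b) (M : ℝ), 0 ≤ M → (∀ x, ‖t x‖ ≤ M) →
    ∃ f : c ⟶ b, ‖f‖ ≤ M ∧ ∀ x, ι x ≫ f = t x
  hom_ext : ∀ (b : A) (f g : c ⟶ b), (∀ x, ι x ≫ f = ι x ≫ g) → f = g

variable [IsBanachTwoSpace 𝕜 A]

theorem exists_isTensor (E : BanSp.{u} 𝕜) (a : A) :
    ∃ (c : A) (η : E →L[𝕜] (a ⟶ c)), IsTensor η := by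
  obtain ⟨c, s, h1, h2, h3⟩ := exists_weightedSum (fun _ : PUnit.{u + 1} => E) (fun _ => a)
  refine ⟨c, s ⟨⟩, h1 ⟨⟩, fun b t => ?_, fun b f g h => h3 b f g fun _ => h⟩
  obtain ⟨f, hf, h⟩ := h2 b (fun _ => t) ‖t‖ (norm_nonneg t) (fun _ => le_rfl)
  exact ⟨f, hf, h ⟨⟩⟩

theorem exists_isCoproduct (𝕜 : Type) [RCLike 𝕜] [BanachCategory 𝕜 A] [IsBanachTwoSpace 𝕜 A]
    {X : Type u} (a : X → A) : ∃ (c : A) (ι : ∀ x, a x ⟶ c), IsCoproduct ι := by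
  obtain ⟨c, s, h1, h2, h3⟩ := exists_weightedSum (fun _ : X => (⟨ULift.{u} 𝕜⟩ : BanSp.{u} 𝕜)) a
  have hs : ∀ x (r : ULift.{u} 𝕜), s x r = r.down • s x (1 : ULift.{u} 𝕜) := fun x r => by
    have : r = r.down • (1 : ULift.{u} 𝕜) := by ext; simp
    conv_lhs => rw [this]
    exact (s x).map_smul r.down (1 : ULift.{u} 𝕜)
  refine ⟨c, fun x => s x (1 : ULift.{u} 𝕜), fun x => ?_, fun b t M hM ht => ?_,
    fun b f g h => h3 b f g fun x r => ?_⟩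
  · have := (s x).le_of_opNorm_le (h1 x) (1 : ULift.{u} 𝕜)
    have h : ‖(1 : ULift.{u} 𝕜)‖ = 1 := norm_one
    exact this.trans_eq (by rw [one_mul]; exact h)
  · let T : ∀ x, ULift.{u} 𝕜 →L[𝕜] (a x ⟶ b) := fun x => LinearMap.mkContinuous
      { toFun := fun r => r.down • t x
        map_add' := fun r r' => add_smul _ _ _
        map_smul' := fun r r' => mul_smul _ _ _ } M
      (fun r => by
        change ‖r.down • t x‖ ≤ M * ‖r.down‖
        rw [norm_smul, mul_comm]
        gcongr
        exact ht x)
    obtain ⟨f, hf, h⟩ := h2 b T M hM (fun x => LinearMap.mkContinuous_norm_le _ hM _)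
    exact ⟨f, hf, fun x => (h x (1 : ULift.{u} 𝕜)).trans (one_smul 𝕜 (t x))⟩
  · rw [hs, BanachCategory.smul_comp, BanachCategory.smul_comp, h]

/-- The tensor `E ⊗ a` of an object of a Banach 2-space with a Banach space. -/
def tensor (E : BanSp.{u} 𝕜) (a : A) : A := (exists_isTensor E a).choose

/-- The universal bounded linear map `E → A(a, E ⊗ a)`. -/
def tensorMk (E : BanSp.{u} 𝕜) (a : A) : E →L[𝕜] (a ⟶ tensor E a) :=
  (exists_isTensor E a).choose_spec.choose

theorem isTensor_tensorMk (E : BanSp.{u} 𝕜) (a : A) : IsTensor (tensorMk E a) :=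
  (exists_isTensor E a).choose_spec.choose_spec

/-- The morphism `E ⊗ a ⟶ b` induced by a bounded linear map `E → A(a, b)`. -/
def tensorDesc {E : BanSp.{u} 𝕜} {a b : A} (t : E →L[𝕜] (a ⟶ b)) : tensor E a ⟶ b :=
  ((isTensor_tensorMk E a).exists_desc b t).choose

theorem norm_tensorDesc_le {E : BanSp.{u} 𝕜} {a b : A} (t : E →L[𝕜] (a ⟶ b)) :
    ‖tensorDesc t‖ ≤ ‖t‖ :=
  ((isTensor_tensorMk E a).exists_desc b t).choose_spec.1

theorem tensorMk_desc {E : BanSp.{u} 𝕜} {a b : A} (t : E →L[𝕜] (a ⟶ b)) (e : E) :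
    tensorMk E a e ≫ tensorDesc t = t e :=
  ((isTensor_tensorMk E a).exists_desc b t).choose_spec.2 e

theorem tensor_hom_ext {E : BanSp.{u} 𝕜} {a b : A} {f g : tensor E a ⟶ b}
    (h : ∀ e, tensorMk E a e ≫ f = tensorMk E a e ≫ g) : f = g :=
  (isTensor_tensorMk E a).hom_ext b f g h

/-- The action of tensors on morphisms. -/
def tensorMap {E F : BanSp.{u} 𝕜} {a b : A} (T : E ⟶ F) (f : a ⟶ b) : tensor E a ⟶ tensor F b :=
  tensorDesc ((precomp 𝕜 f (tensor F b)).comp ((tensorMk F b).comp (BanSp.toCLM T)))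

theorem tensorMk_map {E F : BanSp.{u} 𝕜} {a b : A} (T : E ⟶ F) (f : a ⟶ b) (e : E) :
    tensorMk E a e ≫ tensorMap T f = f ≫ tensorMk F b (BanSp.toCLM T e) :=
  tensorMk_desc _ e

theorem tensorMap_id (E : BanSp.{u} 𝕜) (a : A) : tensorMap (𝟙 E) (𝟙 a) = 𝟙 (tensor E a) :=
  tensor_hom_ext fun e => by
    rw [tensorMk_map, Category.id_comp, Category.comp_id]
    rfl

theorem tensorMap_comp {E F G : BanSp.{u} 𝕜} {a b c : A} (S : E ⟶ F) (T : F ⟶ G) (f : a ⟶ b)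
    (g : b ⟶ c) : tensorMap (S ≫ T) (f ≫ g) = tensorMap S f ≫ tensorMap T g :=
  tensor_hom_ext fun e => by
    rw [tensorMk_map, ← Category.assoc, tensorMk_map, Category.assoc, Category.assoc, tensorMk_map]
    rfl

theorem norm_tensorMap_le {E F : BanSp.{u} 𝕜} {a b : A} (T : E ⟶ F) (f : a ⟶ b) :
    ‖tensorMap T f‖ ≤ ‖T‖ * ‖f‖ := by
  refine (norm_tensorDesc_le _).trans ?_
  refine (ContinuousLinearMap.opNorm_comp_le _ _).trans ?_
  rw [mul_comm]
  refine mul_le_mul ?_ (norm_precomp_le f _) (norm_nonneg _) (norm_nonneg _)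
  refine (ContinuousLinearMap.opNorm_comp_le _ _).trans ?_
  exact mul_le_of_le_one_left (norm_nonneg _) (isTensor_tensorMk F b).norm_le

/-- The tensor bifunctor `Ban ⊗ A → A`, `(E, a) ↦ E ⊗ a`. -/
def tensorFunctor (𝕜 : Type) [RCLike 𝕜] (A : Type v) [Category.{u} A] [PreBanachCategory A]
    [BanachCategory 𝕜 A] [IsBanachTwoSpace 𝕜 A] : BanSp.{u} 𝕜 ⥤ A ⥤ A where
  obj E :=
    { obj := fun a => tensor E a
      map := fun f => tensorMap (𝟙 E) f
      map_id := fun a => tensorMap_id E a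
      map_comp := fun f g => by rw [← tensorMap_comp, Category.id_comp] }
  map {E F} T :=
    { app := fun a => tensorMap T (𝟙 a)
      naturality := fun a b f => by
        change tensorMap (𝟙 E) f ≫ tensorMap T (𝟙 b) = tensorMap T (𝟙 a) ≫ tensorMap (𝟙 F) f
        simp only [← tensorMap_comp, Category.id_comp, Category.comp_id] }
  map_id E := NatTrans.ext (funext fun a => tensorMap_id E a)
  map_comp S T := NatTrans.ext (funext fun a => by
    change tensorMap (S ≫ T) (𝟙 a) = tensorMap S (𝟙 a) ≫ tensorMap T (𝟙 a)
    rw [← tensorMap_comp, Category.id_comp])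

variable (𝕜)

/-- The coproduct of a family of objects of a Banach 2-space. -/
def coprod {X : Type u} (a : X → A) : A := (exists_isCoproduct 𝕜 a).choose

/-- The coproduct injections. -/
def coprodInj {X : Type u} (a : X → A) (x : X) : a x ⟶ coprod 𝕜 a :=
  (exists_isCoproduct 𝕜 a).choose_spec.choose x

theorem isCoproduct_coprodInj {X : Type u} (a : X → A) : IsCoproduct (coprodInj 𝕜 a) :=
  (exists_isCoproduct 𝕜 a).choose_spec.choose_spec

variable {𝕜}

theorem coprod_hom_ext {X : Type u} {a : X → A} {b : A} {f g : coprod 𝕜 a ⟶ b}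
    (h : ∀ x, coprodInj 𝕜 a x ≫ f = coprodInj 𝕜 a x ≫ g) : f = g :=
  (isCoproduct_coprodInj 𝕜 a).hom_ext b f g h

variable (𝕜)

theorem exists_coprodDesc {X : Type u} {a : X → A} {b : A} (t : ∀ x, a x ⟶ b)
    (ht : BddAbove (Set.range fun x => ‖t x‖)) :
    ∃ f : coprod 𝕜 a ⟶ b, ∀ x, coprodInj 𝕜 a x ≫ f = t x := by
  obtain ⟨M, hM⟩ := ht
  obtain ⟨f, -, h⟩ := (isCoproduct_coprodInj 𝕜 a).exists_desc b t (max M 0) (le_max_right _ _)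
    (fun x => (hM ⟨x, rfl⟩).trans (le_max_left _ _))
  exact ⟨f, h⟩

/-- The morphism out of a coproduct induced by a bounded family of morphisms. -/
def coprodDesc {X : Type u} {a : X → A} {b : A} (t : ∀ x, a x ⟶ b)
    (ht : BddAbove (Set.range fun x => ‖t x‖)) : coprod 𝕜 a ⟶ b :=
  (exists_coprodDesc 𝕜 t ht).choose

theorem coprodInj_desc {X : Type u} {a : X → A} {b : A} (t : ∀ x, a x ⟶ b)
    (ht : BddAbove (Set.range fun x => ‖t x‖)) (x : X) :
    coprodInj 𝕜 a x ≫ coprodDesc 𝕜 t ht = t x :=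
  (exists_coprodDesc 𝕜 t ht).choose_spec x

end tensor

/-! ### Functor categories and `ℓ(X, A)` -/

/-- Contractive functors from an ordinary category `J` (identified with the free Banach category
that it generates) to a Banach category `A`: the functors to the category of contractions
of `A`. -/
structure BanFun (𝕜 : Type) [RCLike 𝕜] (J : Type u) [Category.{w} J] (A : Type v)
    [Category.{u} A] [PreBanachCategory A] [BanachCategory 𝕜 A] where
  functor : J ⥤ A
  norm_map_le : ∀ {i j : J} (f : i ⟶ j), ‖functor.map f‖ ≤ 1

namespace BanFun

variable {𝕜 : Type} [RCLike 𝕜] {J : Type u} [Category.{w} J] {A : Type v}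
    [Category.{u} A] [PreBanachCategory A] [BanachCategory 𝕜 A]

/-- The Banach space of uniformly bounded natural transformations, with the supremum norm. -/
def hom (F G : BanFun 𝕜 J A) :
    Submodule 𝕜 (lp (fun j : J => F.functor.obj j ⟶ G.functor.obj j) ∞) where
  carrier := {α | ∀ (i j : J) (f : i ⟶ j), F.functor.map f ≫ α j = α i ≫ G.functor.map f}
  add_mem' := by
    intro α β hα hβ i j f
    simp [PreBanachCategory.add_comp, PreBanachCategory.comp_add, hα i j f, hβ i j f]
  zero_mem' := by
    intro i j f
    simp [zero_comp, comp_zero]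
  smul_mem' := by
    intro r α hα i j f
    simp [BanachCategory.smul_comp, BanachCategory.comp_smul, hα i j f]

theorem isClosed_hom (F G : BanFun 𝕜 J A) :
    IsClosed (hom F G : Set (lp (fun j : J => F.functor.obj j ⟶ G.functor.obj j) ∞)) := by
  have hev : ∀ j : J, Continuous
      fun α : lp (fun j : J => F.functor.obj j ⟶ G.functor.obj j) ∞ => α j := fun j => by
    refine (LipschitzWith.of_dist_le_mul (K := 1) fun α β => ?_).continuous
    rw [dist_eq_norm, dist_eq_norm, NNReal.coe_one, one_mul]
    exact lp.norm_apply_le_norm ENNReal.top_ne_zero (α - β) j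
  have : (hom F G : Set (lp (fun j : J => F.functor.obj j ⟶ G.functor.obj j) ∞)) =
      ⋂ (i : J) (j : J) (f : i ⟶ j),
        {α | F.functor.map f ≫ α j = α i ≫ G.functor.map f} := by
    ext α
    simp only [Set.mem_iInter]
    rfl
  rw [this]
  refine isClosed_iInter fun i => isClosed_iInter fun j => isClosed_iInter fun f => ?_
  exact isClosed_eq ((precomp 𝕜 (F.functor.map f) _).continuous.comp (hev j))
    ((postcomp 𝕜 _ (G.functor.map f)).continuous.comp (hev i))

/-- A uniformly bounded natural family as a morphism. -/
def mkHom {F G : BanFun 𝕜 J A} (α : ∀ j, F.functor.obj j ⟶ G.functor.obj j)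
    (hα : BddAbove (Set.range fun j => ‖α j‖))
    (nat : ∀ (i j : J) (f : i ⟶ j), F.functor.map f ≫ α j = α i ≫ G.functor.map f) : hom F G :=
  ⟨⟨α, memℓp_infty hα⟩, nat⟩

theorem bddAbove_comp {F G H : BanFun 𝕜 J A} (α : hom F G) (β : hom G H) :
    ‖α‖ * ‖β‖ ∈ upperBounds (Set.range fun j => ‖α.1 j ≫ β.1 j‖) := by
  rintro _ ⟨j, rfl⟩
  refine (PreBanachCategory.norm_comp_le _ _).trans ?_
  exact mul_le_mul (lp.norm_apply_le_norm ENNReal.top_ne_zero α.1 j)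
    (lp.norm_apply_le_norm ENNReal.top_ne_zero β.1 j) (norm_nonneg _) (norm_nonneg _)

theorem norm_mkHom_comp_le {F G H : BanFun 𝕜 J A} (α : hom F G) (β : hom G H)
    (nat : ∀ (i j : J) (f : i ⟶ j),
      F.functor.map f ≫ (α.1 j ≫ β.1 j) = (α.1 i ≫ β.1 i) ≫ H.functor.map f) :
    ‖mkHom (fun j => α.1 j ≫ β.1 j) ⟨_, bddAbove_comp α β⟩ nat‖ ≤ ‖α‖ * ‖β‖ :=
  lp.norm_le_of_forall_le (mul_nonneg (norm_nonneg α) (norm_nonneg β))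
    fun j => bddAbove_comp α β ⟨j, rfl⟩

instance : Category.{u} (BanFun 𝕜 J A) where
  Hom F G := hom F G
  id F := mkHom (fun j => 𝟙 (F.functor.obj j))
    ⟨1, by rintro _ ⟨j, rfl⟩; exact PreBanachCategory.norm_id_le _⟩
    (fun i j f => by rw [Category.comp_id, Category.id_comp])
  comp α β := mkHom (fun j => α.1 j ≫ β.1 j) ⟨_, bddAbove_comp α β⟩
    (fun i j f => by rw [← Category.assoc, α.2 i j f, Category.assoc, β.2 i j f, Category.assoc])
  id_comp α := Subtype.ext (Subtype.ext (funext fun j => Category.id_comp (α.1 j)))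
  comp_id α := Subtype.ext (Subtype.ext (funext fun j => Category.comp_id (α.1 j)))
  assoc α β γ := Subtype.ext (Subtype.ext (funext fun j =>
    Category.assoc (α.1 j) (β.1 j) (γ.1 j)))

/-- The component of a morphism at an object. -/
def app {F G : BanFun 𝕜 J A} (α : F ⟶ G) (j : J) : F.functor.obj j ⟶ G.functor.obj j := α.1 j

/-- A uniformly bounded natural family as a morphism. -/
def homMk {F G : BanFun 𝕜 J A} (α : ∀ j, F.functor.obj j ⟶ G.functor.obj j)
    (hα : BddAbove (Set.range fun j => ‖α j‖))
    (nat : ∀ (i j : J) (f : i ⟶ j), F.functor.map f ≫ α j = α i ≫ G.functor.map f) : F ⟶ G :=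
  mkHom α hα nat

@[simp] theorem app_homMk {F G : BanFun 𝕜 J A} (α : ∀ j, F.functor.obj j ⟶ G.functor.obj j)
    (hα : BddAbove (Set.range fun j => ‖α j‖))
    (nat : ∀ (i j : J) (f : i ⟶ j), F.functor.map f ≫ α j = α i ≫ G.functor.map f) (j : J) :
    app (homMk α hα nat) j = α j := rfl

theorem hom_ext {F G : BanFun 𝕜 J A} {α β : F ⟶ G} (h : ∀ j, app α j = app β j) : α = β :=
  Subtype.ext (Subtype.ext (funext h))

theorem naturality {F G : BanFun 𝕜 J A} (α : F ⟶ G) {i j : J} (f : i ⟶ j) :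
    F.functor.map f ≫ app α j = app α i ≫ G.functor.map f := α.2 i j f

@[simp] theorem app_id (F : BanFun 𝕜 J A) (j : J) : app (𝟙 F) j = 𝟙 _ := rfl

@[simp] theorem app_comp {F G H : BanFun 𝕜 J A} (α : F ⟶ G) (β : G ⟶ H) (j : J) :
    app (α ≫ β) j = app α j ≫ app β j := rfl

instance : PreBanachCategory (BanFun 𝕜 J A) where
  normed F G := inferInstanceAs (NormedAddCommGroup (hom F G))
  complete F G := (isClosed_hom F G).completeSpace_coe
  add_comp f g h := hom_ext fun j => PreBanachCategory.add_comp (app f j) (app g j) (app h j)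
  comp_add f g h := hom_ext fun j => PreBanachCategory.comp_add (app f j) (app g j) (app h j)
  norm_comp_le f g := norm_mkHom_comp_le f g _
  norm_id_le _ := lp.norm_le_of_forall_le zero_le_one fun _ => PreBanachCategory.norm_id_le _

instance : BanachCategory 𝕜 (BanFun 𝕜 J A) where
  normedSpace F G := inferInstanceAs (NormedSpace 𝕜 (hom F G))
  smul_comp r f g := hom_ext fun j => BanachCategory.smul_comp r (app f j) (app g j)
  comp_smul r f g := hom_ext fun j => BanachCategory.comp_smul r (app f j) (app g j)

theorem norm_app_le {F G : BanFun 𝕜 J A} (α : F ⟶ G) (j : J) : ‖app α j‖ ≤ ‖α‖ :=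
  lp.norm_apply_le_norm ENNReal.top_ne_zero α.1 j

theorem norm_le {F G : BanFun 𝕜 J A} (α : F ⟶ G) {M : ℝ} (hM : 0 ≤ M)
    (h : ∀ j, ‖app α j‖ ≤ M) : ‖α‖ ≤ M :=
  lp.norm_le_of_forall_le hM h

theorem bddAbove_app {F G : BanFun 𝕜 J A} (α : F ⟶ G) :
    BddAbove (Set.range fun j => ‖app α j‖) :=
  ⟨‖α‖, by rintro _ ⟨j, rfl⟩; exact norm_app_le α j⟩

end BanFun

/-- `ℓ(X, A)`: the Banach category of contractive functors from the discrete category `X`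
to `A`, and uniformly bounded natural transformations. -/
abbrev Ell (𝕜 : Type) [RCLike 𝕜] (X : Type u) (A : Type v) [Category.{u} A]
    [PreBanachCategory A] [BanachCategory 𝕜 A] := BanFun 𝕜 (Discrete X) A

namespace Ell

variable {𝕜 : Type} [RCLike 𝕜] {X : Type u} {A : Type v₁} [Category.{u} A]
    [PreBanachCategory A] [BanachCategory 𝕜 A]

/-- The fiber of `ξ` at `x`. -/
abbrev fiber (ξ : Ell 𝕜 X A) (x : X) : A := ξ.functor.obj ⟨x⟩

/-- The component of a morphism at `x`. -/
abbrev fiberMap {ξ ζ : Ell 𝕜 X A} (α : ξ ⟶ ζ) (x : X) : fiber ξ x ⟶ fiber ζ x := BanFun.app α ⟨x⟩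

/-- The functor on the discrete category `X` with given fibers. -/
def ofFamily (a : X → A) : Ell 𝕜 X A where
  functor := Discrete.functor a
  norm_map_le {i j} f := by
    obtain ⟨i⟩ := i
    obtain ⟨j⟩ := j
    obtain rfl : i = j := Discrete.eq_of_hom f
    have : f = 𝟙 _ := Subsingleton.elim _ _
    rw [this, CategoryTheory.Functor.map_id]
    exact PreBanachCategory.norm_id_le _

@[simp] theorem fiber_ofFamily (a : X → A) (x : X) : fiber (ofFamily (𝕜 := 𝕜) a) x = a x := rfl

/-- A bounded family of morphisms between the fibers is a morphism. -/
def ofBounded {ξ ζ : Ell 𝕜 X A} (α : ∀ x, fiber ξ x ⟶ fiber ζ x)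
    (hα : BddAbove (Set.range fun x => ‖α x‖)) : ξ ⟶ ζ :=
  BanFun.homMk (fun j => α j.as)
    (by
      obtain ⟨M, hM⟩ := hα
      exact ⟨M, by rintro _ ⟨⟨x⟩, rfl⟩; exact hM ⟨x, rfl⟩⟩)
    (fun i j f => by
      obtain ⟨i⟩ := i
      obtain ⟨j⟩ := j
      obtain rfl : i = j := Discrete.eq_of_hom f
      have : f = 𝟙 _ := Subsingleton.elim _ _
      rw [this, CategoryTheory.Functor.map_id, CategoryTheory.Functor.map_id, Category.comp_id,
        Category.id_comp])

@[simp] theorem fiberMap_ofBounded {ξ ζ : Ell 𝕜 X A} (α : ∀ x, fiber ξ x ⟶ fiber ζ x)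
    (hα : BddAbove (Set.range fun x => ‖α x‖)) (x : X) : fiberMap (ofBounded α hα) x = α x := rfl

theorem hom_ext {ξ ζ : Ell 𝕜 X A} {α β : ξ ⟶ ζ} (h : ∀ x, fiberMap α x = fiberMap β x) : α = β :=
  BanFun.hom_ext fun j => h j.as

theorem bddAbove_fiberMap {ξ ζ : Ell 𝕜 X A} (α : ξ ⟶ ζ) : BddAbove (Set.range fun x => ‖fiberMap α x‖) :=
  ⟨‖α‖, by rintro _ ⟨x, rfl⟩; exact BanFun.norm_app_le α ⟨x⟩⟩

section

variable [IsBanachTwoSpace 𝕜 A]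

theorem bddAbove_tensorMap {ξ ζ : Ell 𝕜 X (BanSp.{u} 𝕜)} (T : ξ ⟶ ζ) {a b : A} (f : a ⟶ b) :
    BddAbove (Set.range fun x => ‖tensorMap (fiberMap T x) f‖) :=
  ⟨‖T‖ * ‖f‖, by
    rintro _ ⟨x, rfl⟩
    refine (norm_tensorMap_le _ _).trans ?_
    gcongr
    exact BanFun.norm_app_le T ⟨x⟩⟩

/-- The bifunctor `ℓ(X) ⊗ A → ℓ(X, A)`, `(ξ, a) ↦ (x ↦ ξ_x ⊗ a)`. -/
def tensorBifunctor (𝕜 : Type) [RCLike 𝕜] (X : Type u) (A : Type v₁) [Category.{u} A]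
    [PreBanachCategory A] [BanachCategory 𝕜 A] [IsBanachTwoSpace 𝕜 A] :
    Ell 𝕜 X (BanSp.{u} 𝕜) ⥤ A ⥤ Ell 𝕜 X A where
  obj ξ :=
    { obj := fun a => ofFamily fun x => tensor (fiber ξ x) a
      map := fun f => ofBounded (fun x => tensorMap (𝟙 (fiber ξ x)) f)
        (bddAbove_tensorMap (𝟙 ξ) f)
      map_id := fun a => hom_ext fun x => tensorMap_id _ _
      map_comp := fun f g => hom_ext fun x => by
        have := tensorMap_comp (𝟙 (fiber ξ x)) (𝟙 (fiber ξ x)) f g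
        rwa [Category.id_comp] at this }
  map {ξ ζ} T :=
    { app := fun a => ofBounded (fun x => tensorMap (fiberMap T x) (𝟙 a)) (bddAbove_tensorMap T (𝟙 a))
      naturality := fun a b f => hom_ext fun x => by
        change tensorMap (𝟙 (fiber ξ x)) f ≫ tensorMap (fiberMap T x) (𝟙 b) =
          tensorMap (fiberMap T x) (𝟙 a) ≫ tensorMap (𝟙 (fiber ζ x)) f
        rw [← tensorMap_comp, ← tensorMap_comp, Category.id_comp, Category.comp_id,
          Category.id_comp, Category.comp_id] }
  map_id ξ := NatTrans.ext (funext fun a => hom_ext fun x => tensorMap_id _ _)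
  map_comp {ξ ζ ρ} S T := NatTrans.ext (funext fun a => hom_ext fun x => by
    change tensorMap (fiberMap S x ≫ fiberMap T x) (𝟙 a) =
      tensorMap (fiberMap S x) (𝟙 a) ≫ tensorMap (fiberMap T x) (𝟙 a)
    rw [← tensorMap_comp, Category.id_comp])

/-- The universal maps `ξ_x → A(a, ξ_x ⊗ a)`. -/
def tensorBifunctorMk (ξ : Ell 𝕜 X (BanSp.{u} 𝕜)) (a : A) (x : X) :
    (fiber ξ x).carrier →L[𝕜] (a ⟶ fiber (((tensorBifunctor 𝕜 X A).obj ξ).obj a) x) :=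
  tensorMk (fiber ξ x) a

end

/-- Composition with a contractive functor `T : A → B`, as a functor `ℓ(X, A) → ℓ(X, B)`. -/
def mapFunctor (X : Type u) {B : Type v₂} [Category.{u} B] [PreBanachCategory B]
    [BanachCategory 𝕜 B] (T : A ⥤ B) (hT : IsContractive 𝕜 T) : Ell 𝕜 X A ⥤ Ell 𝕜 X B where
  obj ξ :=
    { functor := ξ.functor ⋙ T
      norm_map_le := fun f => (hT.norm_map_le _).trans (ξ.norm_map_le f) }
  map {ξ ζ} α := ofBounded (fun x => T.map (fiberMap α x))
    ⟨‖α‖, by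
      rintro _ ⟨x, rfl⟩
      exact (hT.norm_map_le _).trans (BanFun.norm_app_le α ⟨x⟩)⟩
  map_id ξ := hom_ext fun x => T.map_id _
  map_comp α β := hom_ext fun x => T.map_comp _ _

end Ell

/-! ### Induced functors, cosheaves and integrals -/

section integral

variable {𝕜 : Type} [RCLike 𝕜] {X : Type u} {A : Type v₁} [Category.{u} A]
    [PreBanachCategory A] [BanachCategory 𝕜 A] [IsBanachTwoSpace 𝕜 A]

theorem norm_coprodInj_le {Y : Type u} (a : Y → A) (y : Y) : ‖coprodInj 𝕜 a y‖ ≤ 1 :=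
  (isCoproduct_coprodInj 𝕜 a).norm_le y

theorem bddAbove_comp_coprodInj {Y : Type u} {a b : Y → A} (f : ∀ y, a y ⟶ b y)
    (hf : BddAbove (Set.range fun y => ‖f y‖)) :
    BddAbove (Set.range fun y => ‖f y ≫ coprodInj 𝕜 b y‖) := by
  obtain ⟨M, hM⟩ := hf
  refine ⟨M, ?_⟩
  rintro _ ⟨y, rfl⟩
  refine (PreBanachCategory.norm_comp_le _ _).trans ?_
  exact (mul_le_of_le_one_right (norm_nonneg _) (norm_coprodInj_le b y)).trans (hM ⟨y, rfl⟩)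

variable (𝕜) in
/-- The action of coproducts on bounded families of morphisms. -/
def coprodMap {Y : Type u} {a b : Y → A} (f : ∀ y, a y ⟶ b y)
    (hf : BddAbove (Set.range fun y => ‖f y‖)) : coprod 𝕜 a ⟶ coprod 𝕜 b :=
  coprodDesc 𝕜 (fun y => f y ≫ coprodInj 𝕜 b y) (bddAbove_comp_coprodInj f hf)

theorem coprodInj_map {Y : Type u} {a b : Y → A} (f : ∀ y, a y ⟶ b y)
    (hf : BddAbove (Set.range fun y => ‖f y‖)) (y : Y) :
    coprodInj 𝕜 a y ≫ coprodMap 𝕜 f hf = f y ≫ coprodInj 𝕜 b y :=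
  coprodInj_desc 𝕜 _ _ y

theorem norm_coprodMap_le {Y : Type u} {a b : Y → A} (f : ∀ y, a y ⟶ b y)
    (hf : BddAbove (Set.range fun y => ‖f y‖)) {M : ℝ} (hM : 0 ≤ M) (h : ∀ y, ‖f y‖ ≤ M) :
    ‖coprodMap 𝕜 f hf‖ ≤ M := by
  obtain ⟨g, hg, hg'⟩ := (isCoproduct_coprodInj 𝕜 a).exists_desc _
    (fun y => f y ≫ coprodInj 𝕜 b y) M hM (fun y =>
      (PreBanachCategory.norm_comp_le _ _).trans
        ((mul_le_of_le_one_right (norm_nonneg _) (norm_coprodInj_le b y)).trans (h y)))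
  have : coprodMap 𝕜 f hf = g := coprod_hom_ext fun y => by rw [coprodInj_map, hg']
  rwa [this]

theorem coprodMap_eq_id {Y : Type u} {a : Y → A} (f : ∀ y, a y ⟶ a y)
    (hf : BddAbove (Set.range fun y => ‖f y‖)) (h : ∀ y, f y = 𝟙 (a y)) :
    coprodMap 𝕜 f hf = 𝟙 (coprod 𝕜 a) :=
  coprod_hom_ext fun y => by rw [coprodInj_map, h, Category.id_comp, Category.comp_id]

theorem coprodMap_eq_comp {Y : Type u} {a b c : Y → A} (f : ∀ y, a y ⟶ b y)
    (hf : BddAbove (Set.range fun y => ‖f y‖)) (g : ∀ y, b y ⟶ c y)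
    (hg : BddAbove (Set.range fun y => ‖g y‖)) (k : ∀ y, a y ⟶ c y)
    (hk : BddAbove (Set.range fun y => ‖k y‖)) (h : ∀ y, k y = f y ≫ g y) :
    coprodMap 𝕜 k hk = coprodMap 𝕜 f hf ≫ coprodMap 𝕜 g hg :=
  coprod_hom_ext fun y => by
    rw [coprodInj_map, ← Category.assoc, coprodInj_map, Category.assoc, coprodInj_map, h,
      Category.assoc]

theorem bddAbove_push {Y : Type u} (p : X → Y) {ξ ζ : Ell 𝕜 X A} (α : ξ ⟶ ζ) (y : Y) :
    BddAbove (Set.range fun x : {x // p x = y} => ‖Ell.fiberMap α x.1‖) :=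
  ⟨‖α‖, by rintro _ ⟨x, rfl⟩; exact BanFun.norm_app_le α ⟨x.1⟩⟩

/-- The functor `p_! : ℓ(X, A) → ℓ(Y, A)` induced by a map `p : X → Y`:
`(p_! ξ)_y` is the coproduct of the `ξ_x` with `p x = y`. -/
def Ell.pushFunctor (𝕜 : Type) [RCLike 𝕜] (A : Type v₁) [Category.{u} A]
    [PreBanachCategory A] [BanachCategory 𝕜 A] [IsBanachTwoSpace 𝕜 A]
    {X Y : Type u} (p : X → Y) : Ell 𝕜 X A ⥤ Ell 𝕜 Y A where
  obj ξ := Ell.ofFamily fun y => coprod 𝕜 fun x : {x // p x = y} => Ell.fiber ξ x.1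
  map {ξ ζ} α := Ell.ofBounded
    (fun y => coprodMap 𝕜 (fun x : {x // p x = y} => Ell.fiberMap α x.1) (bddAbove_push p α y))
    ⟨‖α‖, by
      rintro _ ⟨y, rfl⟩
      exact norm_coprodMap_le _ _ (norm_nonneg _) fun x => BanFun.norm_app_le α ⟨x.1⟩⟩
  map_id ξ := Ell.hom_ext fun y => coprodMap_eq_id _ (bddAbove_push p (𝟙 ξ) y) fun _ => rfl
  map_comp α β := Ell.hom_ext fun y => coprodMap_eq_comp _ (bddAbove_push p α y) _
    (bddAbove_push p β y) _ (bddAbove_push p (α ≫ β) y) fun _ => rfl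

/-- The injection of `ξ_x` in `(p_! ξ)_(p x)`. -/
def Ell.pushInj {Y : Type u} (p : X → Y) (ξ : Ell 𝕜 X A) (x : X) :
    Ell.fiber ξ x ⟶ Ell.fiber ((Ell.pushFunctor 𝕜 A p).obj ξ) (p x) :=
  coprodInj 𝕜 (fun x' : {x' // p x' = p x} => Ell.fiber ξ x'.1) ⟨x, rfl⟩

/-- A Banach-space valued cosheaf on the Boolean algebra of subsets of `X`: a contractive functor
that is `σ`-additive, that is, for every countable partition `𝓔` of a subset `E`, the maps
`μ F → μ E`, `F ∈ 𝓔`, form a coproduct. -/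
structure Cosheaf (𝕜 : Type) [RCLike 𝕜] (X : Type u) where
  functor : Set X ⥤ BanSp.{u} 𝕜
  norm_map_le : ∀ {E F : Set X} (f : E ⟶ F), ‖functor.map f‖ ≤ 1
  sigma_additive : ∀ (𝓔 : Set (Set X)) (E : Set X), 𝓔.Countable → 𝓔.PairwiseDisjoint id →
    ∀ hE : ⋃₀ 𝓔 = E, IsCoproduct fun F : 𝓔 =>
      functor.map (homOfLE ((Set.subset_sUnion_of_mem F.2).trans hE.le) : F.1 ⟶ E)

/-- The value of a cosheaf on the atom `{x}`. -/
def Cosheaf.atom (μ : Cosheaf 𝕜 X) (x : X) : BanSp.{u} 𝕜 := μ.functor.obj {x}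

theorem bddAbove_integral (μ : Cosheaf 𝕜 X) {ξ ζ : Ell 𝕜 X A} (α : ξ ⟶ ζ) :
    BddAbove (Set.range fun x => ‖tensorMap (𝟙 (μ.atom x)) (Ell.fiberMap α x)‖) :=
  ⟨‖α‖, by
    rintro _ ⟨x, rfl⟩
    refine (norm_tensorMap_le _ _).trans ?_
    exact (mul_le_of_le_one_left (norm_nonneg _) (PreBanachCategory.norm_id_le _)).trans
      (BanFun.norm_app_le α ⟨x⟩)⟩

/-- The vector integral functor `ℓ(X, A) → A` of a cosheaf: `∫ ξ dμ` is the coproduct of the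
`μ {x} ⊗ ξ_x`. -/
def integral (A : Type v₁) [Category.{u} A] [PreBanachCategory A] [BanachCategory 𝕜 A]
    [IsBanachTwoSpace 𝕜 A] (μ : Cosheaf 𝕜 X) : Ell 𝕜 X A ⥤ A where
  obj ξ := coprod 𝕜 fun x => tensor (μ.atom x) (Ell.fiber ξ x)
  map α := coprodMap 𝕜 (fun x => tensorMap (𝟙 (μ.atom x)) (Ell.fiberMap α x))
    (bddAbove_integral μ α)
  map_id ξ := coprodMap_eq_id _ _ fun _ => tensorMap_id _ _
  map_comp α β := coprodMap_eq_comp _ _ _ _ _ _ fun x => by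
    have h := tensorMap_comp (𝟙 (μ.atom x)) (𝟙 (μ.atom x)) (Ell.fiberMap α x) (Ell.fiberMap β x)
    rwa [Category.id_comp] at h

/-- The canonical map `ξ_x ⟶ ∫ ξ dμ` given by a vector of `μ {x}`. -/
def integralMk (μ : Cosheaf 𝕜 X) (ξ : Ell 𝕜 X A) (x : X) (m : (μ.atom x).carrier) :
    Ell.fiber ξ x ⟶ (integral A μ).obj ξ :=
  tensorMk (μ.atom x) (Ell.fiber ξ x) m ≫
    coprodInj 𝕜 (fun x => tensor (μ.atom x) (Ell.fiber ξ x)) x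

end integral

end BanachTwo

end

open BanachTwo

noncomputable section

namespace BanachTwo

/-! ### Weighted sums and their preservation by cocontinuous functors -/

section weightedSum

variable {𝕜 : Type} [RCLike 𝕜] {A : Type v₁} [Category.{u} A]
    [PreBanachCategory A] [BanachCategory 𝕜 A] {B : Type v₂} [Category.{u} B]
    [PreBanachCategory B] [BanachCategory 𝕜 B] {C : Type v₃} [Category.{u} C]
    [PreBanachCategory C] [BanachCategory 𝕜 C]

/-! Write δ_x for the object of ℓ(X) that is the scalars at x and zero elsewhere. Two decompositions
carry the theorem. Every ξ in ℓ(X) is the weighted sum Σ_x ξ_x ⊗ δ_x of point masses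
(`Ell.isWeightedSum_pointMassIncl`), and every ζ in ℓ(X, A) is the coproduct Σ_x δ_x ⊗ ζ_x of its
parts concentrated at single points (`Ell.isCoproduct_singleIncl`).

They leave no choice for the factorization of a bicocontinuous φ: it has to be T ζ = Σ_x φ(δ_x,
ζ_x). This works because φ(δ_x, -) preserves tensors and φ(-, a) preserves weighted sums, so that
T(ξ ⊗ a) = Σ_x φ(δ_x, ξ_x ⊗ a) and φ(ξ, a) are both the sum Σ_x ξ_x ⊗ φ(δ_x, a)
(`Ell.exists_factor`). In the same way a transformation given on the objects ξ ⊗ a is determined on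
S ζ = Σ_x S(δ_x ⊗ ζ_x) by its values at the δ_x ⊗ ζ_x, and these values extend it with the same
bound (`Ell.existsUnique_extension`). Uniqueness of factorizations up to a unique isometric
isomorphism is a formal consequence (`existsUnique_isIsometricIso_of_extension`).

The functors in question are cocontinuous for three reasons: weighted colimits in ℓ(X, A) are
computed in the fibers (`Ell.isWeightedColimit_of_eval`, `Ell.isCocontinuous_eval`), the tensor E ⊗
a is cocontinuous in each variable, and a coproduct of cocontinuous functors is cocontinuous
(`isCocontinuous_sumFunctor`).

All the canonical isomorphisms come from one principle. If two functors have values that are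
weighted sums Σ_x E_x ⊗ c_x of the same families, the universal properties give mutually inverse
contractions, unique among maps compatible with the structure maps. They are natural as soon as both
functors move the structure maps in the same way (`existsUnique_isIsometricIso₂_of_isWeightedSum`
and its variants). What remains in each case is to recognize both sides as weighted sums, using that
cocontinuous functors preserve these (`IsWeightedSum.map`). -/

theorem IsContractive.map_zero {T : A ⥤ B} (hT : IsContractive 𝕜 T) (a b : A) :
    T.map (0 : a ⟶ b) = 0 :=
  (hT.mapCLM a b).map_zero

theorem IsContractive.norm_mapCLM_le {T : A ⥤ B} (hT : IsContractive 𝕜 T) (a b : A) :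
    ‖hT.mapCLM a b‖ ≤ 1 :=
  LinearMap.mkContinuous_norm_le _ zero_le_one _

theorem IsContractive.comp {S : A ⥤ B} {T : B ⥤ C} (hS : IsContractive 𝕜 S)
    (hT : IsContractive 𝕜 T) : IsContractive 𝕜 (S ⋙ T) where
  map_add f g := by simp [hS.map_add, hT.map_add]
  map_smul r f := by simp [hS.map_smul, hT.map_smul]
  norm_map_le f := (hT.norm_map_le _).trans (hS.norm_map_le f)

theorem IsCocontinuous.comp {S : A ⥤ B} {T : B ⥤ C} (hS : IsCocontinuous 𝕜 S)
    (hT : IsCocontinuous 𝕜 T) : IsCocontinuous 𝕜 (S ⋙ T) where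
  contractive := hS.contractive.comp hT.contractive
  preserves K _ _ _ W D hW hD c s hs :=
    hT.preserves K W (D ⋙ S) hW (hD.comp hS.contractive) _ _ (hS.preserves K W D hW hD c s hs)

theorem norm_comp_le_of_le_one_right {a b c : A} (f : a ⟶ b) {g : b ⟶ c} (hg : ‖g‖ ≤ 1) :
    ‖f ≫ g‖ ≤ ‖f‖ :=
  (PreBanachCategory.norm_comp_le f g).trans (mul_le_of_le_one_right (norm_nonneg f) hg)

theorem norm_comp_le_of_le_one {a b c : A} {f : a ⟶ b} (hf : ‖f‖ ≤ 1) (g : b ⟶ c) :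
    ‖f ≫ g‖ ≤ ‖g‖ :=
  (PreBanachCategory.norm_comp_le f g).trans (mul_le_of_le_one_left (norm_nonneg g) hf)

theorem norm_precomp_comp_le {E : BanSp.{u} 𝕜} {a b c : A} {f : a ⟶ b} (hf : ‖f‖ ≤ 1)
    (t : E →L[𝕜] (b ⟶ c)) : ‖(precomp 𝕜 f c).comp t‖ ≤ ‖t‖ :=
  (ContinuousLinearMap.opNorm_comp_le _ _).trans
    (mul_le_of_le_one_left (norm_nonneg t) ((norm_precomp_le f c).trans hf))

theorem norm_postcomp_comp_le {E : BanSp.{u} 𝕜} {a b c : A} (t : E →L[𝕜] (a ⟶ b)) {g : b ⟶ c}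
    (hg : ‖g‖ ≤ 1) : ‖(postcomp 𝕜 a g).comp t‖ ≤ ‖t‖ :=
  (ContinuousLinearMap.opNorm_comp_le _ _).trans
    (mul_le_of_le_one_left (norm_nonneg t)
      ((LinearMap.mkContinuous_norm_le _ (norm_nonneg g) _).trans hg))

/-- The family `s x : E x → A(a x, c)` exhibits `c` as the sum of the tensors `E x ⊗ a x`. -/
structure IsWeightedSum {X : Type u} {E : X → BanSp.{u} 𝕜} {a : X → A} {c : A}
    (s : ∀ x, E x →L[𝕜] (a x ⟶ c)) : Prop where
  norm_le : ∀ x, ‖s x‖ ≤ 1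
  exists_desc : ∀ (b : A) (t : ∀ x, E x →L[𝕜] (a x ⟶ b)) (M : ℝ), 0 ≤ M → (∀ x, ‖t x‖ ≤ M) →
    ∃ f : c ⟶ b, ‖f‖ ≤ M ∧ ∀ x e, s x e ≫ f = t x e
  hom_ext : ∀ (b : A) (f g : c ⟶ b), (∀ x e, s x e ≫ f = s x e ≫ g) → f = g

theorem FreeBan.eq_coeff_smul_id {X : Type u} {x : FreeBan 𝕜 X} (f : x ⟶ x) :
    f = FreeBan.coeff f • 𝟙 x :=
  Subtype.ext (ULift.ext _ _ (mul_one _).symm)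

theorem FreeBan.eq_zero_of_ne {X : Type u} {x y : FreeBan 𝕜 X} (f : x ⟶ y) (h : x ≠ y) : f = 0 :=
  Subtype.ext (f.2 h)

/-- A family of bounded linear maps is a weighted cocone under any contractive functor on the
free Banach category. -/
def FreeBan.coconeOf {X : Type u} {E : X → BanSp.{u} 𝕜} {D : FreeBan 𝕜 X ⥤ A}
    (hD : IsContractive 𝕜 D) {c : A} (t : ∀ x : X, E x →L[𝕜] (D.obj ⟨x⟩ ⟶ c)) :
    WeightedCocone (FreeBan.functorOp 𝕜 E) D c where
  leg x := t x.pt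
  natural {x y} f e := by
    change t x.pt (BanSp.toCLM (FreeBan.coeff f • FreeBan.unit E y x) e) = D.map f ≫ t y.pt e
    by_cases h : x = y
    · subst h
      conv_rhs => rw [FreeBan.eq_coeff_smul_id f]
      rw [FreeBan.unit_self, hD.map_smul, D.map_id, BanachCategory.smul_comp, Category.id_comp]
      exact (t x.pt).map_smul (FreeBan.coeff f) e
    · rw [FreeBan.coeff_eq_zero f h, zero_smul, FreeBan.eq_zero_of_ne f h, hD.map_zero, zero_comp]
      exact (t x.pt).map_zero

/-- Over the free Banach category on X the naturality of a weighted cocone says nothing more than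
linearity of its legs: off the diagonal the hom-spaces vanish, on the diagonal they are scalars. So
cocones are just families, and a weighted sum is a genuine weighted colimit, to which cocontinuity
applies. -/
theorem IsWeightedSum.isWeightedColimit {X : Type u} {E : X → BanSp.{u} 𝕜} {a : X → A} {c : A}
    {s : ∀ x, E x →L[𝕜] (a x ⟶ c)} (hs : IsWeightedSum s) :
    IsWeightedColimit (FreeBan.cocone s) where
  norm_leg_le k := hs.norm_le k.pt
  exists_desc b t M hM ht := by
    obtain ⟨f, hf, h⟩ := hs.exists_desc b (fun x => t.leg ⟨x⟩) M hM fun x => ht ⟨x⟩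
    exact ⟨f, hf, fun k e => h k.pt e⟩
  hom_ext b f g h := hs.hom_ext b f g fun x e => h ⟨x⟩ e

/-- Cocontinuous functors preserve weighted sums. -/
theorem IsWeightedSum.map {X : Type u} {E : X → BanSp.{u} 𝕜} {a : X → A} {c : A}
    {s : ∀ x, E x →L[𝕜] (a x ⟶ c)} (hs : IsWeightedSum s) {T : A ⥤ B} (hT : IsCocontinuous 𝕜 T) :
    IsWeightedSum fun x => (hT.contractive.mapCLM (a x) c).comp (s x) := by
  -- The image cocone lies under the composite of the diagram with `T`, which is not literally the
  -- functor built from the family `T.obj (a x)`. Families are therefore turned into cocones by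
  -- `FreeBan.coconeOf`, which accepts any contractive diagram.
  have hD := (FreeBan.isContractive_functor (𝕜 := 𝕜) a).comp hT.contractive
  have h := hT.preserves _ _ _ (FreeBan.isContractiveOp_functorOp E)
    (FreeBan.isContractive_functor a) _ _ hs.isWeightedColimit
  refine ⟨fun x => h.norm_leg_le ⟨x⟩, fun b t M hM ht => ?_,
    fun b f g hfg => h.hom_ext b f g fun k e => hfg k.pt e⟩
  obtain ⟨f, hf, h'⟩ := h.exists_desc b (FreeBan.coconeOf hD t) M hM fun k => ht k.pt
  exact ⟨f, hf, fun x e => h' ⟨x⟩ e⟩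

/-- The comparison between two weighted sums of the same family. -/
theorem IsWeightedSum.exists_comparison {X : Type u} {E : X → BanSp.{u} 𝕜} {a : X → A} {c c' : A}
    {s : ∀ x, E x →L[𝕜] (a x ⟶ c)} (hs : IsWeightedSum s) {s' : ∀ x, E x →L[𝕜] (a x ⟶ c')}
    (hs' : ∀ x, ‖s' x‖ ≤ 1) : ∃ f : c ⟶ c', ‖f‖ ≤ 1 ∧ ∀ x e, s x e ≫ f = s' x e :=
  hs.exists_desc c' s' 1 zero_le_one hs'

theorem IsWeightedSum.comp_eq_id {X : Type u} {E : X → BanSp.{u} 𝕜} {a : X → A} {c c' : A}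
    {s : ∀ x, E x →L[𝕜] (a x ⟶ c)} (hs : IsWeightedSum s) {s' : ∀ x, E x →L[𝕜] (a x ⟶ c')}
    {f : c ⟶ c'} {g : c' ⟶ c} (hf : ∀ x e, s x e ≫ f = s' x e) (hg : ∀ x e, s' x e ≫ g = s x e) :
    f ≫ g = 𝟙 c :=
  hs.hom_ext _ _ _ fun x e => by rw [← Category.assoc, hf, hg, Category.comp_id]

/-- A tensor is a weighted sum over a one-point set, so whatever holds for weighted sums,
preservation by cocontinuous functors included, specializes to tensors. -/
theorem IsTensor.isWeightedSum {E : BanSp.{u} 𝕜} {a c : A} {η : E →L[𝕜] (a ⟶ c)}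
    (h : IsTensor η) : IsWeightedSum (X := PUnit.{u + 1}) fun _ => η where
  norm_le _ := h.norm_le
  exists_desc b t M _ ht := by
    obtain ⟨f, hf, h'⟩ := h.exists_desc b (t ⟨⟩)
    exact ⟨f, hf.trans (ht ⟨⟩), fun _ => h'⟩
  hom_ext b f g hfg := h.hom_ext b f g (hfg ⟨⟩)

/-- Cocontinuous functors preserve tensors. -/
theorem IsTensor.map {E : BanSp.{u} 𝕜} {a c : A} {η : E →L[𝕜] (a ⟶ c)}
    (h : IsTensor η) {T : A ⥤ B} (hT : IsCocontinuous 𝕜 T) :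
    IsTensor ((hT.contractive.mapCLM a c).comp η) where
  norm_le := (h.isWeightedSum.map hT).norm_le ⟨⟩
  exists_desc b t := by
    obtain ⟨f, hf, h'⟩ := (h.isWeightedSum.map hT).exists_desc b (fun _ => t) ‖t‖ (norm_nonneg t)
      fun _ => le_rfl
    exact ⟨f, hf, h' ⟨⟩⟩
  hom_ext b f g hfg := (h.isWeightedSum.map hT).hom_ext b f g fun _ => hfg

/-- A coproduct of tensors is a weighted sum. -/
theorem IsCoproduct.isWeightedSum {X : Type u} {E : X → BanSp.{u} 𝕜} {a c' : X → A} {c : A}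
    {ι : ∀ x, c' x ⟶ c} (hι : IsCoproduct ι) {η : ∀ x, E x →L[𝕜] (a x ⟶ c' x)}
    (hη : ∀ x, IsTensor (η x)) : IsWeightedSum fun x => (postcomp 𝕜 (a x) (ι x)).comp (η x) where
  norm_le x := (norm_postcomp_comp_le (η x) (hι.norm_le x)).trans (hη x).norm_le
  exists_desc b t M hM ht := by
    choose g hg h using fun x => (hη x).exists_desc b (t x)
    obtain ⟨f, hf, hf'⟩ := hι.exists_desc b g M hM fun x => (hg x).trans (ht x)
    exact ⟨f, hf, fun x e => by simp [hf', h]⟩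
  hom_ext b f g hfg := hι.hom_ext b f g fun x => (hη x).hom_ext b _ _ fun e => by
    simpa using hfg x e

variable (𝕜) in
/-- The action of the scalars on a morphism. -/
def scalarCLM {a b : A} (f : a ⟶ b) :
    (⟨ULift.{u} 𝕜⟩ : BanSp.{u} 𝕜) →L[𝕜] (a ⟶ b) :=
  LinearMap.mkContinuous
    { toFun := fun r : ULift.{u} 𝕜 => r.down • f
      map_add' := fun _ _ => add_smul _ _ _
      map_smul' := fun _ _ => mul_smul _ _ _ } ‖f‖
    (fun r => by
      change ‖r.down • f‖ ≤ ‖f‖ * ‖r.down‖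
      rw [norm_smul, mul_comm])

theorem scalarCLM_apply {a b : A} (f : a ⟶ b) (r : ULift.{u} 𝕜) :
    scalarCLM 𝕜 f r = r.down • f := rfl

theorem scalarCLM_one {a b : A} (f : a ⟶ b) : scalarCLM 𝕜 f (1 : ULift.{u} 𝕜) = f :=
  one_smul 𝕜 f

theorem norm_scalarCLM_le {a b : A} (f : a ⟶ b) : ‖scalarCLM 𝕜 f‖ ≤ ‖f‖ :=
  LinearMap.mkContinuous_norm_le _ (norm_nonneg f) _

/-- The scalars are the unit for tensors: a bounded linear map out of them is determined by its
value at 1, which has norm at most that of the map. This makes a plain coproduct a weighted sum with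
scalar weights. The lift only places the scalars in the right universe. -/
theorem isTensor_scalarCLM_id (a : A) : IsTensor (scalarCLM 𝕜 (𝟙 a)) where
  norm_le := (norm_scalarCLM_le _).trans (PreBanachCategory.norm_id_le a)
  exists_desc b t := by
    refine ⟨t (1 : ULift.{u} 𝕜), ?_, fun r => ?_⟩
    · refine (t.le_opNorm _).trans_eq ?_
      have h : ‖(1 : ULift.{u} 𝕜)‖ = 1 := norm_one
      exact (congrArg _ h).trans (mul_one _)
    · rw [scalarCLM_apply, BanachCategory.smul_comp, Category.id_comp]
      refine (t.map_smul (ULift.down r) (1 : ULift.{u} 𝕜)).symm.trans (congrArg t ?_)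
      exact ULift.ext _ _ (mul_one _)
  hom_ext b f g h := by
    have := h (1 : ULift.{u} 𝕜)
    rwa [scalarCLM_one, Category.id_comp, Category.id_comp] at this

/-- Cocontinuous functors preserve coproducts. -/
theorem IsCoproduct.map {X : Type u} {a : X → A} {c : A} {ι : ∀ x, a x ⟶ c}
    (h : IsCoproduct ι) {T : A ⥤ B} (hT : IsCocontinuous 𝕜 T) :
    IsCoproduct fun x => T.map (ι x) := by
  have hs := (h.isWeightedSum fun x => isTensor_scalarCLM_id (𝕜 := 𝕜) (a x)).map hT
  refine ⟨fun x => (hT.contractive.norm_map_le _).trans (h.norm_le x), fun b t M hM ht => ?_,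
    fun b f g hfg => hs.hom_ext b f g fun x r => ?_⟩
  · obtain ⟨f, hf, h'⟩ := hs.exists_desc b (fun x => scalarCLM 𝕜 (t x)) M hM
      fun x => (norm_scalarCLM_le _).trans (ht x)
    refine ⟨f, hf, fun x => ?_⟩
    -- The descent is known on all scalar multiples of the injections; the scalar 1 recovers the
    -- injections themselves.
    have h₁ : T.map (scalarCLM 𝕜 (𝟙 (a x)) (1 : ULift.{u} 𝕜) ≫ ι x) ≫ f = t x :=
      (h' x (1 : ULift.{u} 𝕜)).trans (scalarCLM_one (t x))
    rwa [scalarCLM_one, Category.id_comp] at h₁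
  · simp [hfg]

end weightedSum

/-! ### Weighted colimits in `ℓ(X, A)` -/

section pointwise

variable {𝕜 : Type} [RCLike 𝕜] {A : Type v₁} [Category.{u} A]
    [PreBanachCategory A] [BanachCategory 𝕜 A] {X : Type u}

/-- Transport of the universal property along an isometric isomorphism of vertices. It serves to
compare an arbitrary colimit in ℓ(X, A) with the one built in the fibers. -/
theorem IsWeightedColimit.of_iso {K : Type u} [Category.{u} K] {W : Kᵒᵖ ⥤ BanSp.{u} 𝕜}
    {D : K ⥤ A} {c c' : A} {s : WeightedCocone W D c} (hs : IsWeightedColimit s)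
    {s' : WeightedCocone W D c'} (f : c ⟶ c') (g : c' ⟶ c) (hf : ‖f‖ ≤ 1) (hg : ‖g‖ ≤ 1)
    (hfg : f ≫ g = 𝟙 c) (hgf : g ≫ f = 𝟙 c') (h : ∀ k x, s.leg k x ≫ f = s'.leg k x) :
    IsWeightedColimit s' where
  norm_leg_le k := ContinuousLinearMap.opNorm_le_bound _ zero_le_one fun x => by
    rw [← h, one_mul]
    exact (norm_comp_le_of_le_one_right _ hf).trans
      (((s.leg k).le_of_opNorm_le (hs.norm_leg_le k) x).trans_eq (one_mul _))
  exists_desc b t M hM ht := by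
    obtain ⟨d, hd, hd'⟩ := hs.exists_desc b t M hM ht
    refine ⟨g ≫ d, (norm_comp_le_of_le_one hg d).trans hd, fun k x => ?_⟩
    rw [← h, Category.assoc, ← Category.assoc f, hfg, Category.id_comp, hd']
  hom_ext b d d' hdd := by
    have : f ≫ d = f ≫ d' := hs.hom_ext _ _ _ fun k x => by
      rw [← Category.assoc, ← Category.assoc, h, hdd]
    calc d = g ≫ f ≫ d := by rw [← Category.assoc, hgf, Category.id_comp]
      _ = g ≫ f ≫ d' := by rw [this]
      _ = d' := by rw [← Category.assoc, hgf, Category.id_comp]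

namespace Ell

variable (𝕜 A) in
/-- Evaluation at a point, as a functor `ℓ(X, A) → A`. -/
def eval (x : X) : Ell 𝕜 X A ⥤ A where
  obj ξ := fiber ξ x
  map α := fiberMap α x

theorem isContractive_eval (x : X) : IsContractive 𝕜 (eval 𝕜 A x) where
  map_add _ _ := rfl
  map_smul _ _ := rfl
  norm_map_le α := BanFun.norm_app_le α ⟨x⟩

theorem norm_le {ξ ζ : Ell 𝕜 X A} (α : ξ ⟶ ζ) {M : ℝ} (hM : 0 ≤ M)
    (h : ∀ x, ‖fiberMap α x‖ ≤ M) : ‖α‖ ≤ M :=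
  BanFun.norm_le α hM fun j => h j.as

theorem exists_hom {ξ ζ : Ell 𝕜 X A} (α : ∀ x, fiber ξ x ⟶ fiber ζ x) {M : ℝ} (hM : 0 ≤ M)
    (h : ∀ x, ‖α x‖ ≤ M) : ∃ β : ξ ⟶ ζ, ‖β‖ ≤ M ∧ ∀ x, fiberMap β x = α x :=
  ⟨ofBounded α ⟨M, by rintro _ ⟨x, rfl⟩; exact h x⟩, norm_le _ hM h, fun _ => rfl⟩

variable {K : Type u} [Category.{u} K] {W : Kᵒᵖ ⥤ BanSp.{u} 𝕜} {D : K ⥤ Ell 𝕜 X A}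

/-- Morphisms of ℓ(X, A) are bounded families with the supremum norm, subject to no further
condition. A cocone bounded by M has fibers bounded by the same M, so the factorizations found fiber
by fiber form a morphism of norm at most M. -/
theorem isWeightedColimit_of_eval {c : Ell 𝕜 X A} (s : WeightedCocone W D c)
    (h : ∀ x, IsWeightedColimit (s.map (eval 𝕜 A x) (isContractive_eval x))) :
    IsWeightedColimit s where
  norm_leg_le k := ContinuousLinearMap.opNorm_le_bound _ zero_le_one fun e => by
    refine norm_le _ (by positivity) fun x => ?_
    exact ContinuousLinearMap.le_of_opNorm_le _ ((h x).norm_leg_le k) e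
  exists_desc b t M hM ht := by
    choose f hf hf' using fun x => (h x).exists_desc _ (t.map (eval 𝕜 A x) (isContractive_eval x))
      M hM fun k => ((ContinuousLinearMap.opNorm_comp_le _ _).trans
        (mul_le_of_le_one_left (norm_nonneg _)
          ((isContractive_eval x).norm_mapCLM_le _ _))).trans (ht k)
    obtain ⟨g, hg, hg'⟩ := exists_hom f hM hf
    refine ⟨g, hg, fun k e => hom_ext fun x => ?_⟩
    exact (congrArg (fiberMap (s.leg k e) x ≫ ·) (hg' x)).trans (hf' x k e)
  hom_ext b f g hfg := hom_ext fun x => (h x).hom_ext _ _ _ fun k e =>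
    congrArg (fun α => fiberMap α x) (hfg k e)

/-- Weighted colimits in the fibers assemble to a weighted cocone. -/
def coconeOfEval {c : X → A}
    (s : ∀ x, WeightedCocone W (D ⋙ eval 𝕜 A x) (c x)) (hs : ∀ x k, ‖(s x).leg k‖ ≤ 1) :
    WeightedCocone W D (ofFamily c) where
  leg k := LinearMap.mkContinuous
    { toFun := fun e => ofBounded (fun x => (s x).leg k e)
        ⟨‖e‖, by
          rintro _ ⟨x, rfl⟩
          exact (((s x).leg k).le_of_opNorm_le (hs x k) e).trans_eq (one_mul _)⟩
      map_add' := fun e e' => hom_ext fun x => ((s x).leg k).map_add e e'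
      map_smul' := fun r e => hom_ext fun x => ((s x).leg k).map_smul r e } 1
    fun e => norm_le _ (by positivity) fun x => ((s x).leg k).le_of_opNorm_le (hs x k) e
  natural f e := hom_ext fun x => (s x).natural f e

theorem isWeightedColimit_coconeOfEval {c : X → A}
    {s : ∀ x, WeightedCocone W (D ⋙ eval 𝕜 A x) (c x)} (h : ∀ x, IsWeightedColimit (s x)) :
    IsWeightedColimit (coconeOfEval s fun x => (h x).norm_leg_le) :=
  isWeightedColimit_of_eval _ h

instance [IsBanachTwoSpace 𝕜 A] : IsBanachTwoSpace 𝕜 (Ell 𝕜 X A) where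
  exists_colimit K _ _ _ W D hW hD := by
    choose c s hs using fun x => IsBanachTwoSpace.exists_colimit K W (D ⋙ eval 𝕜 A x) hW
      (hD.comp (isContractive_eval x))
    exact ⟨_, _, isWeightedColimit_coconeOfEval hs⟩

/-- A given colimit is isometrically isomorphic to the one assembled from colimits in the fibers,
which exist since A has all of them. Evaluating this isomorphism at x transports the universal
property to the fiber at x. -/
theorem isCocontinuous_eval [IsBanachTwoSpace 𝕜 A] (x : X) : IsCocontinuous 𝕜 (eval 𝕜 A x) where
  contractive := isContractive_eval x
  preserves K _ _ _ W D hW hD c s hs := by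
    choose c' s' hs' using fun x => IsBanachTwoSpace.exists_colimit K W (D ⋙ eval 𝕜 A x) hW
      (hD.comp (isContractive_eval x))
    have h := isWeightedColimit_coconeOfEval hs'
    obtain ⟨g, hg, hg'⟩ := hs.exists_desc _ _ 1 zero_le_one h.norm_leg_le
    obtain ⟨f, hf, hf'⟩ := h.exists_desc _ _ 1 zero_le_one hs.norm_leg_le
    have hgf : g ≫ f = 𝟙 c := hs.hom_ext _ _ _ fun k e => by
      rw [← Category.assoc, hg', hf', Category.comp_id]
    have hfg : f ≫ g = 𝟙 _ := h.hom_ext _ _ _ fun k e => by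
      rw [← Category.assoc, hf', hg', Category.comp_id]
    refine (hs' x).of_iso (fiberMap f x) (fiberMap g x) ((BanFun.norm_app_le f ⟨x⟩).trans hf)
      ((BanFun.norm_app_le g ⟨x⟩).trans hg) (congrArg (fun α => fiberMap α x) hfg)
      (congrArg (fun α => fiberMap α x) hgf) fun k e => ?_
    exact congrArg (fun α => fiberMap α x) (hf' k e)

/-- A functor to `ℓ(X, A)` is cocontinuous if its components are. -/
theorem isCocontinuous_of_eval {P : Type v₂} [Category.{u} P] [PreBanachCategory P]
    [BanachCategory 𝕜 P] {F : P ⥤ Ell 𝕜 X A} (h : ∀ x, IsCocontinuous 𝕜 (F ⋙ eval 𝕜 A x)) :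
    IsCocontinuous 𝕜 F where
  contractive :=
    { map_add := fun f g => hom_ext fun x => (h x).contractive.map_add f g
      map_smul := fun r f => hom_ext fun x => (h x).contractive.map_smul r f
      norm_map_le := fun f =>
        norm_le _ (norm_nonneg f) fun x => (h x).contractive.norm_map_le f }
  preserves K _ _ _ W D hW hD c s hs :=
    isWeightedColimit_of_eval _ fun x => (h x).preserves K W D hW hD c s hs

theorem isCocontinuous_mapFunctor [IsBanachTwoSpace 𝕜 A] {B : Type v₂} [Category.{u} B]
    [PreBanachCategory B] [BanachCategory 𝕜 B] {T : A ⥤ B} (hT : IsCocontinuous 𝕜 T) :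
    IsCocontinuous 𝕜 (mapFunctor X T hT.contractive) :=
  isCocontinuous_of_eval fun x => (isCocontinuous_eval x).comp hT

end Ell

end pointwise

/-! ### Tensors and sums are cocontinuous -/

section tensor

variable {𝕜 : Type} [RCLike 𝕜] {A : Type v₁} [Category.{u} A]
    [PreBanachCategory A] [BanachCategory 𝕜 A]

/-- The Banach space of morphisms. -/
abbrev homSpace (𝕜 : Type) [RCLike 𝕜] [BanachCategory 𝕜 A] (a b : A) : BanSp.{u} 𝕜 := ⟨a ⟶ b⟩

theorem IsTensor.norm_apply_le {E : BanSp.{u} 𝕜} {a c : A} {η : E →L[𝕜] (a ⟶ c)}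
    (h : IsTensor η) (e : E) : ‖η e‖ ≤ ‖e‖ :=
  (η.le_of_opNorm_le h.norm_le e).trans_eq (one_mul _)

/-- A bounded linear map given by values in a hom-space that is determined by universality. -/
theorem exists_clm_of_unique {E : BanSp.{u} 𝕜} {a b : A} (R : E → (a ⟶ b) → Prop) {M : ℝ}
    (hM : 0 ≤ M) (hR : ∀ e, ∃ f, R e f ∧ ‖f‖ ≤ M * ‖e‖)
    (uniq : ∀ e f g, R e f → R e g → f = g)
    (add : ∀ e e' f f', R e f → R e' f' → R (e + e') (f + f'))
    (smul : ∀ (r : 𝕜) e f, R e f → R (r • e) (r • f)) :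
    ∃ T : E →L[𝕜] (a ⟶ b), ‖T‖ ≤ M ∧ ∀ e, R e (T e) := by
  choose f hf hfM using hR
  exact ⟨LinearMap.mkContinuous
    { toFun := f
      map_add' := fun e e' => uniq _ _ _ (hf _) (add _ _ _ _ (hf e) (hf e'))
      map_smul' := fun r e => uniq _ _ _ (hf _) (smul r _ _ (hf e)) } M hfM,
    LinearMap.mkContinuous_norm_le _ hM _, hf⟩

variable [IsBanachTwoSpace 𝕜 A]

theorem norm_tensorMk_apply_le (E : BanSp.{u} 𝕜) (a : A) (e : E) : ‖tensorMk E a e‖ ≤ ‖e‖ :=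
  (isTensor_tensorMk E a).norm_apply_le e

theorem tensorMk_map_assoc {E F : BanSp.{u} 𝕜} {a b c : A} (T : E ⟶ F) (f : a ⟶ b) (e : E)
    (g : tensor F b ⟶ c) :
    tensorMk E a e ≫ tensorMap T f ≫ g = f ≫ tensorMk F b (BanSp.toCLM T e) ≫ g := by
  rw [← Category.assoc, tensorMk_map, Category.assoc]

theorem tensorMk_map_id_left (E : BanSp.{u} 𝕜) {a b : A} (f : a ⟶ b) (e : E) :
    tensorMk E a e ≫ tensorMap (𝟙 E) f = f ≫ tensorMk E b e :=
  tensorMk_map (𝟙 E) f e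

theorem tensorMk_map_id_right {E F : BanSp.{u} 𝕜} (T : E ⟶ F) (a : A) (e : E) :
    tensorMk E a e ≫ tensorMap T (𝟙 a) = tensorMk F a (BanSp.toCLM T e) := by
  rw [tensorMk_map, Category.id_comp]

theorem isContractive_tensorFunctor_obj (E : BanSp.{u} 𝕜) :
    IsContractive 𝕜 ((tensorFunctor 𝕜 A).obj E) where
  map_add {a b} f g := tensor_hom_ext fun e => by
    change tensorMk E a e ≫ tensorMap (𝟙 E) (f + g) =
      tensorMk E a e ≫ (tensorMap (𝟙 E) f + tensorMap (𝟙 E) g)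
    simp only [PreBanachCategory.comp_add, tensorMk_map, PreBanachCategory.add_comp]
  map_smul {a b} r f := tensor_hom_ext fun e => by
    change tensorMk E a e ≫ tensorMap (𝟙 E) (r • f) = tensorMk E a e ≫ (r • tensorMap (𝟙 E) f)
    simp only [BanachCategory.comp_smul, tensorMk_map, BanachCategory.smul_comp]
  norm_map_le f := (norm_tensorMap_le (𝟙 E) f).trans
    (mul_le_of_le_one_left (norm_nonneg f) (PreBanachCategory.norm_id_le E))

theorem isContractive_tensorFunctor_flip_obj (a : A) :
    IsContractive 𝕜 ((tensorFunctor 𝕜 A).flip.obj a) where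
  map_add {E F} S T := tensor_hom_ext fun e => by
    change tensorMk E a e ≫ tensorMap (S + T) (𝟙 a) =
      tensorMk E a e ≫ (tensorMap S (𝟙 a) + tensorMap T (𝟙 a))
    simp only [PreBanachCategory.comp_add, tensorMk_map_id_right]
    exact (tensorMk F a).map_add _ _
  map_smul {E F} r T := tensor_hom_ext fun e => by
    change tensorMk E a e ≫ tensorMap (r • T) (𝟙 a) = tensorMk E a e ≫ (r • tensorMap T (𝟙 a))
    simp only [BanachCategory.comp_smul, tensorMk_map_id_right]
    exact (tensorMk F a).map_smul _ _
  norm_map_le T := (norm_tensorMap_le T (𝟙 a)).trans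
    (mul_le_of_le_one_right (norm_nonneg T) (PreBanachCategory.norm_id_le a))

/-! ### The universal property of a tensor with a weighted colimit in either variable. -/

section desc

variable {K : Type u} [Category.{u} K] {W : Kᵒᵖ ⥤ BanSp.{u} 𝕜} {b : A}

/-- For each vector e of E, restricting the given maps on E ⊗ D k along e gives a cocone under D,
bounded by M ‖e‖, hence a morphism T e from c to b. Uniqueness of factorizations makes T linear, and
T : E → A(c, b) is by definition of the tensor a morphism from E ⊗ c to b. -/
theorem exists_tensorDesc_of_colimit_right {D : K ⥤ A} {c : A} (E : BanSp.{u} 𝕜)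
    {s : WeightedCocone W D c} (hs : IsWeightedColimit s)
    (t : ∀ k, W.obj (op k) →L[𝕜] (tensor E (D.obj k) ⟶ b))
    (nat : ∀ {k l : K} (f : k ⟶ l) (w : W.obj (op l)),
      t k (BanSp.toCLM (W.map f.op) w) = tensorMap (𝟙 E) (D.map f) ≫ t l w)
    {M : ℝ} (hM : 0 ≤ M) (ht : ∀ k, ‖t k‖ ≤ M) :
    ∃ f : tensor E c ⟶ b, ‖f‖ ≤ M ∧ ∀ k w, tensorMap (𝟙 E) (s.leg k w) ≫ f = t k w := by
  obtain ⟨T, hT, hT'⟩ := exists_clm_of_unique (𝕜 := 𝕜) (E := E) (a := c) (b := b)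
    (fun e f => ∀ k w, s.leg k w ≫ f = tensorMk E (D.obj k) e ≫ t k w) hM
    (fun e => by
      let te : WeightedCocone W D b :=
        { leg := fun k => (precomp 𝕜 (tensorMk E (D.obj k) e) b).comp (t k)
          natural := fun {k l} f w => by
            change tensorMk E (D.obj k) e ≫ t k _ = D.map f ≫ tensorMk E (D.obj l) e ≫ t l w
            rw [nat f w, tensorMk_map_assoc]
            rfl }
      obtain ⟨f, hf, hf'⟩ := hs.exists_desc b te (M * ‖e‖) (by positivity) fun k => by
        refine (ContinuousLinearMap.opNorm_comp_le _ _).trans ?_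
        rw [mul_comm]
        exact mul_le_mul (ht k)
          ((norm_precomp_le _ _).trans (norm_tensorMk_apply_le E (D.obj k) e))
          (norm_nonneg _) hM
      exact ⟨f, hf', hf⟩)
    (fun e f g hf hg => hs.hom_ext _ _ _ fun k w => (hf k w).trans (hg k w).symm)
    (fun e e' f f' hf hf' k w => by
      rw [PreBanachCategory.comp_add, hf, hf', map_add, PreBanachCategory.add_comp])
    (fun r e f hf k w => by
      rw [BanachCategory.comp_smul, hf, map_smul, BanachCategory.smul_comp])
  refine ⟨tensorDesc T, (norm_tensorDesc_le T).trans hT, fun k w => tensor_hom_ext fun e => ?_⟩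
  rw [tensorMk_map_assoc]
  exact (congrArg (s.leg k w ≫ ·) (tensorMk_desc T e)).trans (hT' e k w)

theorem tensor_hom_ext_of_colimit_right {D : K ⥤ A} {c : A} (E : BanSp.{u} 𝕜)
    {s : WeightedCocone W D c} (hs : IsWeightedColimit s) {f g : tensor E c ⟶ b}
    (h : ∀ k w, tensorMap (𝟙 E) (s.leg k w) ≫ f = tensorMap (𝟙 E) (s.leg k w) ≫ g) : f = g :=
  tensor_hom_ext fun e => hs.hom_ext _ _ _ fun k w => by
    have h' := congrArg (tensorMk E (D.obj k) e ≫ ·) (h k w)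
    simp only [tensorMk_map_assoc] at h'
    exact h'

variable (𝕜) in
/-- A morphism out of `E ⊗ a` as a bounded linear map from `E` to a hom-space. -/
def tensorCurry (E : BanSp.{u} 𝕜) (a b : A) :
    (tensor E a ⟶ b) →L[𝕜] (E ⟶ homSpace 𝕜 a b) :=
  LinearMap.mkContinuous
    { toFun := fun f => BanSp.ofCLM (F := homSpace 𝕜 a b) ((postcomp 𝕜 a f).comp (tensorMk E a))
      map_add' := fun f g => ContinuousLinearMap.ext fun d =>
        PreBanachCategory.comp_add (tensorMk E a d) f g
      map_smul' := fun r f => ContinuousLinearMap.ext fun d =>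
        BanachCategory.comp_smul r (tensorMk E a d) f } 1
    fun f => by
      refine (ContinuousLinearMap.opNorm_le_bound ((postcomp 𝕜 a f).comp
        (tensorMk E a)) (norm_nonneg f) fun d => ?_).trans_eq (one_mul _).symm
      refine (PreBanachCategory.norm_comp_le _ f).trans ?_
      rw [mul_comm]
      gcongr
      exact norm_tensorMk_apply_le _ _ _

theorem norm_tensorCurry_le (E : BanSp.{u} 𝕜) (a b : A) : ‖tensorCurry 𝕜 E a b‖ ≤ 1 :=
  LinearMap.mkContinuous_norm_le _ zero_le_one _

/-- Morphisms from D k ⊗ a to b are bounded linear maps D k → A(a, b), so the given maps amount to a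
cocone of Banach spaces with vertex A(a, b). It factors through the colimit c, and the factorization
is uncurried again. -/
theorem exists_tensorDesc_of_colimit_left {D : K ⥤ BanSp.{u} 𝕜} {c : BanSp.{u} 𝕜} (a : A)
    {s : WeightedCocone W D c} (hs : IsWeightedColimit s)
    (t : ∀ k, W.obj (op k) →L[𝕜] (tensor (D.obj k) a ⟶ b))
    (nat : ∀ {k l : K} (f : k ⟶ l) (w : W.obj (op l)),
      t k (BanSp.toCLM (W.map f.op) w) = tensorMap (D.map f) (𝟙 a) ≫ t l w)
    {M : ℝ} (hM : 0 ≤ M) (ht : ∀ k, ‖t k‖ ≤ M) :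
    ∃ f : tensor c a ⟶ b, ‖f‖ ≤ M ∧ ∀ k w, tensorMap (s.leg k w) (𝟙 a) ≫ f = t k w := by
  let t' : WeightedCocone W D (homSpace 𝕜 a b) :=
    { leg := fun k => (tensorCurry 𝕜 (D.obj k) a b).comp (t k)
      natural := fun {k l} f w => ContinuousLinearMap.ext fun d => by
        change tensorMk (D.obj k) a d ≫ t k _ =
          tensorMk (D.obj l) a (BanSp.toCLM (D.map f) d) ≫ t l w
        rw [nat f w, tensorMk_map_assoc, Category.id_comp] }
  obtain ⟨f, hf, hf'⟩ := hs.exists_desc _ t' M hM fun k =>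
    (ContinuousLinearMap.opNorm_comp_le _ _).trans
      ((mul_le_of_le_one_left (norm_nonneg _) (norm_tensorCurry_le _ a b)).trans (ht k))
  refine ⟨tensorDesc (BanSp.toCLM f), (norm_tensorDesc_le (BanSp.toCLM f)).trans hf,
    fun k w => tensor_hom_ext fun d => ?_⟩
  rw [tensorMk_map_assoc, Category.id_comp]
  exact (tensorMk_desc (BanSp.toCLM f) _).trans (congrArg (fun q => BanSp.toCLM q d) (hf' k w))

theorem tensor_hom_ext_of_colimit_left {D : K ⥤ BanSp.{u} 𝕜} {c : BanSp.{u} 𝕜} (a : A)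
    {s : WeightedCocone W D c} (hs : IsWeightedColimit s) {f g : tensor c a ⟶ b}
    (h : ∀ k w, tensorMap (s.leg k w) (𝟙 a) ≫ f = tensorMap (s.leg k w) (𝟙 a) ≫ g) : f = g := by
  have hF : tensorCurry 𝕜 c a b f = tensorCurry 𝕜 c a b g :=
    hs.hom_ext _ _ _ fun k w => ContinuousLinearMap.ext fun d => by
      have h' := congrArg (tensorMk (D.obj k) a d ≫ ·) (h k w)
      simp only [tensorMk_map_assoc, Category.id_comp] at h'
      exact h'
  exact tensor_hom_ext fun e => congrArg (fun q => BanSp.toCLM q e) hF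

end desc

/-- `E ⊗ -` is cocontinuous. -/
theorem isCocontinuous_tensorFunctor_obj (E : BanSp.{u} 𝕜) :
    IsCocontinuous 𝕜 ((tensorFunctor 𝕜 A).obj E) where
  contractive := isContractive_tensorFunctor_obj E
  preserves _ _ _ _ _ _ _ _ _ _ hs :=
    { norm_leg_le := fun k => (ContinuousLinearMap.opNorm_comp_le _ _).trans (mul_le_one₀
        ((isContractive_tensorFunctor_obj E).norm_mapCLM_le _ _) (norm_nonneg _)
        (hs.norm_leg_le k))
      exists_desc := fun _ t _ hM ht =>
        exists_tensorDesc_of_colimit_right E hs t.leg t.natural hM ht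
      hom_ext := fun _ _ _ hfg => tensor_hom_ext_of_colimit_right E hs hfg }

/-- `- ⊗ a` is cocontinuous. -/
theorem isCocontinuous_tensorFunctor_flip_obj (a : A) :
    IsCocontinuous 𝕜 ((tensorFunctor 𝕜 A).flip.obj a) where
  contractive := isContractive_tensorFunctor_flip_obj a
  preserves _ _ _ _ _ _ _ _ _ _ hs :=
    { norm_leg_le := fun k => (ContinuousLinearMap.opNorm_comp_le _ _).trans (mul_le_one₀
        ((isContractive_tensorFunctor_flip_obj a).norm_mapCLM_le _ _) (norm_nonneg _)
        (hs.norm_leg_le k))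
      exists_desc := fun _ t _ hM ht =>
        exists_tensorDesc_of_colimit_left a hs t.leg t.natural hM ht
      hom_ext := fun _ _ _ hfg => tensor_hom_ext_of_colimit_left a hs hfg }

end tensor

/-! ### Coproducts of cocontinuous functors; cocontinuity of `p_!`, of the integral and of the
bifunctor `ξ ⊗ a`. -/

section sum

variable {𝕜 : Type} [RCLike 𝕜] {P : Type v₂} [Category.{u} P]
    [PreBanachCategory P] [BanachCategory 𝕜 P] {A : Type v₁} [Category.{u} A]
    [PreBanachCategory A] [BanachCategory 𝕜 A] [IsBanachTwoSpace 𝕜 A] {X : Type u}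

theorem coprodInj_map_assoc {a b : X → A} (f : ∀ y, a y ⟶ b y)
    (hf : BddAbove (Set.range fun y => ‖f y‖)) (y : X) {c : A} (g : coprod 𝕜 b ⟶ c) :
    coprodInj 𝕜 a y ≫ coprodMap 𝕜 f hf ≫ g = f y ≫ coprodInj 𝕜 b y ≫ g := by
  rw [← Category.assoc, coprodInj_map, Category.assoc]

/-- The sum is a separate family `k`, compared with `f` and `g` pointwise, so that the lemma applies
to the image of a sum of morphisms under a family of additive functors. -/
theorem coprodMap_eq_add {a b : X → A} {f g k : ∀ y, a y ⟶ b y}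
    (hf : BddAbove (Set.range fun y => ‖f y‖)) (hg : BddAbove (Set.range fun y => ‖g y‖))
    (hk : BddAbove (Set.range fun y => ‖k y‖)) (h : ∀ y, k y = f y + g y) :
    coprodMap 𝕜 k hk = coprodMap 𝕜 f hf + coprodMap 𝕜 g hg :=
  coprod_hom_ext fun y => by
    simp only [coprodInj_map, PreBanachCategory.comp_add, h, PreBanachCategory.add_comp]

theorem coprodMap_eq_smul {a b : X → A} {f k : ∀ y, a y ⟶ b y} (r : 𝕜)
    (hf : BddAbove (Set.range fun y => ‖f y‖)) (hk : BddAbove (Set.range fun y => ‖k y‖))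
    (h : ∀ y, k y = r • f y) : coprodMap 𝕜 k hk = r • coprodMap 𝕜 f hf :=
  coprod_hom_ext fun y => by
    simp only [coprodInj_map, BanachCategory.comp_smul, h, BanachCategory.smul_comp]

omit [IsBanachTwoSpace 𝕜 A] in
theorem bddAbove_map {T : X → P ⥤ A} (hT : ∀ x, IsContractive 𝕜 (T x)) {p q : P} (f : p ⟶ q) :
    BddAbove (Set.range fun x => ‖(T x).map f‖) :=
  ⟨‖f‖, by rintro _ ⟨x, rfl⟩; exact (hT x).norm_map_le f⟩

/-- The coproduct of a family of contractive functors. -/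
def sumFunctor (T : X → P ⥤ A) (hT : ∀ x, IsContractive 𝕜 (T x)) : P ⥤ A where
  obj p := coprod 𝕜 fun x => (T x).obj p
  map f := coprodMap 𝕜 (fun x => (T x).map f) (bddAbove_map hT f)
  map_id p := coprodMap_eq_id _ _ fun x => (T x).map_id p
  map_comp f g := coprodMap_eq_comp _ _ _ _ _ _ fun x => (T x).map_comp f g

theorem coprodInj_sumFunctor_map_assoc {T : X → P ⥤ A} (hT : ∀ x, IsContractive 𝕜 (T x)) {p q : P}
    (f : p ⟶ q) (x : X) {c : A} (g : (sumFunctor T hT).obj q ⟶ c) :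
    coprodInj 𝕜 (fun x => (T x).obj p) x ≫ (sumFunctor T hT).map f ≫ g =
      (T x).map f ≫ coprodInj 𝕜 (fun x => (T x).obj q) x ≫ g :=
  coprodInj_map_assoc _ (bddAbove_map hT f) x g

/-- A coproduct of cocontinuous functors is cocontinuous. -/
theorem isCocontinuous_sumFunctor {T : X → P ⥤ A} (hT : ∀ x, IsCocontinuous 𝕜 (T x)) :
    IsCocontinuous 𝕜 (sumFunctor T fun x => (hT x).contractive) := by
  have hc := fun x => (hT x).contractive
  have hs : IsContractive 𝕜 (sumFunctor T fun x => (hT x).contractive) :=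
    { map_add := fun f g => coprodMap_eq_add (bddAbove_map hc f) (bddAbove_map hc g)
        (bddAbove_map hc (f + g)) fun x => (hT x).contractive.map_add f g
      map_smul := fun r f => coprodMap_eq_smul r (bddAbove_map hc f)
        (bddAbove_map hc (r • f)) fun x => (hT x).contractive.map_smul r f
      norm_map_le := fun f => norm_coprodMap_le _ (bddAbove_map hc f) (norm_nonneg f) fun x =>
        (hT x).contractive.norm_map_le f }
  refine ⟨hs, fun K _ _ _ W D hW hD c s h => ⟨fun k => ?_, fun b t M hM ht => ?_,
    fun b f g hfg => ?_⟩⟩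
  · exact (ContinuousLinearMap.opNorm_comp_le _ _).trans (mul_le_one₀
      (hs.norm_mapCLM_le _ _) (norm_nonneg _) (h.norm_leg_le k))
  · let inj (x : X) (p : P) := coprodInj 𝕜 (fun x => (T x).obj p) x
    -- Restricted to the summand at x, the cocone t becomes a cocone under the composite of D with
    -- `T x`, with the same bound since the injections are contractions. It factors through the
    -- value of `T x` at c, and these factorizations are collected by the coproduct.
    let tx (x : X) : WeightedCocone W (D ⋙ T x) b :=
      { leg := fun k => (precomp 𝕜 (inj x (D.obj k)) b).comp (t.leg k)
        natural := fun {k l} f w => by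
          change inj x (D.obj k) ≫ t.leg k _ = (T x).map (D.map f) ≫ inj x (D.obj l) ≫ t.leg l w
          rw [t.natural f w]
          exact coprodInj_sumFunctor_map_assoc hc _ x _ }
    choose f hf hf' using fun x => ((hT x).preserves K W D hW hD c s h).exists_desc b (tx x) M hM
      fun k => (norm_precomp_comp_le (norm_coprodInj_le _ x) (t.leg k)).trans (ht k)
    obtain ⟨g, hg, hg'⟩ := (isCoproduct_coprodInj 𝕜 _).exists_desc b f M hM hf
    refine ⟨g, hg, fun k w => coprod_hom_ext (𝕜 := 𝕜) fun x => ?_⟩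
    refine (coprodInj_sumFunctor_map_assoc hc (s.leg k w) x g).trans ?_
    exact (congrArg ((T x).map (s.leg k w) ≫ ·) (hg' x)).trans (hf' x k w)
  · refine coprod_hom_ext (𝕜 := 𝕜) fun x => ((hT x).preserves K W D hW hD c s h).hom_ext _ _ _
      fun k w => ?_
    have h' := congrArg (coprodInj 𝕜 (fun x => (T x).obj (D.obj k)) x ≫ ·) (hfg k w)
    exact (coprodInj_sumFunctor_map_assoc hc (s.leg k w) x f).symm.trans
      (h'.trans (coprodInj_sumFunctor_map_assoc hc (s.leg k w) x g))

/-- In the fiber at y the functor is, by definition, the coproduct of the evaluations at the points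
over y. -/
theorem Ell.isCocontinuous_pushFunctor {Y : Type u} (p : X → Y) :
    IsCocontinuous 𝕜 (Ell.pushFunctor 𝕜 A p) :=
  Ell.isCocontinuous_of_eval fun y =>
    isCocontinuous_sumFunctor fun x : {x // p x = y} => Ell.isCocontinuous_eval x.1

theorem isCocontinuous_integral (μ : Cosheaf.{u} 𝕜 X) : IsCocontinuous 𝕜 (integral A μ) :=
  isCocontinuous_sumFunctor fun x =>
    (Ell.isCocontinuous_eval x).comp (isCocontinuous_tensorFunctor_obj (μ.atom x))

theorem Ell.isBicocontinuous_tensorBifunctor :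
    IsBicocontinuous 𝕜 (Ell.tensorBifunctor 𝕜 X A) where
  right ξ := Ell.isCocontinuous_of_eval fun x => isCocontinuous_tensorFunctor_obj (Ell.fiber ξ x)
  left a := Ell.isCocontinuous_of_eval fun x =>
    (Ell.isCocontinuous_eval x).comp (isCocontinuous_tensorFunctor_flip_obj a)

end sum

/-! ### Point masses and the universal property of the bitensor product -/

namespace Ell

variable {𝕜 : Type} [RCLike 𝕜] {X : Type u} {A : Type v₁} [Category.{u} A]
    [PreBanachCategory A] [BanachCategory 𝕜 A]

variable (𝕜) in
/-- The point mass at `x`, an object of `ℓ(X)`: the scalars at `x`, and zero elsewhere. -/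
def pointMass (x : X) : Ell 𝕜 X (BanSp.{u} 𝕜) :=
  -- Taking hom-spaces of the free Banach category as fibers keeps the case distinction x = y out of
  -- the types: no transport along an equality of points is needed.
  ofFamily fun y => ⟨(⟨x⟩ : FreeBan 𝕜 X) ⟶ ⟨y⟩⟩

/-- The unit vector of the point mass at `x`. -/
def pointMassOne (x : X) : (fiber (pointMass 𝕜 x) x).carrier := 𝟙 (⟨x⟩ : FreeBan 𝕜 X)

theorem norm_pointMassOne_le (x : X) : ‖pointMassOne (𝕜 := 𝕜) x‖ ≤ 1 :=
  PreBanachCategory.norm_id_le (⟨x⟩ : FreeBan 𝕜 X)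

/-- The vectors of the point mass at `x` act as scalars. -/
theorem exists_eq_smul_pointMassOne (x : X) (r : (fiber (pointMass 𝕜 x) x).carrier) :
    ∃ k : 𝕜, r = k • pointMassOne x :=
  ⟨_, FreeBan.eq_coeff_smul_id r⟩

theorem pointMass_eq_zero {x y : X} (h : x ≠ y) (r : (fiber (pointMass 𝕜 x) y).carrier) : r = 0 :=
  FreeBan.eq_zero_of_ne _ fun e => h (congrArg FreeBan.pt e)

/-- The scalar matrix units from the fiber at `x` to the fiber at `y`. -/
def matrixUnit (ξ : Ell 𝕜 X A) (x y : X) :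
    (fiber (pointMass 𝕜 x) y).carrier →L[𝕜] (fiber ξ x ⟶ fiber ξ y) :=
  -- The functor induced by the family of fibers covers both cases at once: multiples of the
  -- identity when x = y, and zero otherwise.
  (FreeBan.isContractive_functor (𝕜 := 𝕜) (fiber ξ)).mapCLM ⟨x⟩ ⟨y⟩

theorem norm_matrixUnit_le (ξ : Ell 𝕜 X A) (x y : X) : ‖matrixUnit ξ x y‖ ≤ 1 :=
  IsContractive.norm_mapCLM_le _ _ _

theorem matrixUnit_one (ξ : Ell 𝕜 X A) (x : X) :
    matrixUnit ξ x x (pointMassOne x) = 𝟙 (fiber ξ x) :=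
  (FreeBan.functor 𝕜 (fiber ξ)).map_id ⟨x⟩

/-- The vectors of `ξ_x` as morphisms from the point mass at `x` to `ξ`. -/
theorem exists_pointMassIncl (ξ : Ell 𝕜 X (BanSp.{u} 𝕜)) (x : X) :
    ∃ s : (fiber ξ x).carrier →L[𝕜] (pointMass 𝕜 x ⟶ ξ), ‖s‖ ≤ 1 ∧
      ∀ e y r, BanSp.toCLM (fiberMap (s e) y) r = BanSp.toCLM (matrixUnit ξ x y r) e := by
  have hb (y : X) (r : (fiber (pointMass 𝕜 x) y).carrier) (e : (fiber ξ x).carrier) :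
      ‖BanSp.toCLM (matrixUnit ξ x y r) e‖ ≤ ‖e‖ * ‖r‖ := by
    refine ((BanSp.toCLM (matrixUnit ξ x y r)).le_opNorm e).trans ?_
    rw [mul_comm]
    gcongr
    exact ((matrixUnit ξ x y).le_of_opNorm_le (norm_matrixUnit_le ξ x y) r).trans_eq (one_mul _)
  -- The morphism attached to a vector e sends a scalar r at x to r e and vanishes in all other
  -- fibers.
  let f (e : (fiber ξ x).carrier) (y : X) :
      (fiber (pointMass 𝕜 x) y).carrier →L[𝕜] (fiber ξ y).carrier :=
    LinearMap.mkContinuous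
      { toFun := fun r => BanSp.toCLM (matrixUnit ξ x y r) e
        map_add' := fun r r' => by rw [map_add]; rfl
        map_smul' := fun k r => by rw [map_smul]; rfl } ‖e‖ fun r => hb y r e
  have hf (e : (fiber ξ x).carrier) (y : X) : ‖f e y‖ ≤ ‖e‖ :=
    LinearMap.mkContinuous_norm_le _ (norm_nonneg e) _
  let F (e : (fiber ξ x).carrier) : pointMass 𝕜 x ⟶ ξ :=
    ofBounded (fun y => BanSp.ofCLM (f e y)) ⟨‖e‖, by rintro _ ⟨y, rfl⟩; exact hf e y⟩
  refine ⟨LinearMap.mkContinuous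
    { toFun := F
      map_add' := fun e e' => hom_ext fun y => ContinuousLinearMap.ext fun r =>
        (BanSp.toCLM (matrixUnit ξ x y r)).map_add e e'
      map_smul' := fun k e => hom_ext fun y => ContinuousLinearMap.ext fun r =>
        (BanSp.toCLM (matrixUnit ξ x y r)).map_smul k e } 1 fun e => ?_,
    LinearMap.mkContinuous_norm_le _ zero_le_one _, fun e y r => rfl⟩
  rw [one_mul]
  exact norm_le _ (norm_nonneg e) (hf e)

/-- The vectors of `ξ_x` as morphisms from the point mass at `x` to `ξ`. -/
def pointMassIncl (ξ : Ell 𝕜 X (BanSp.{u} 𝕜)) (x : X) :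
    (fiber ξ x).carrier →L[𝕜] (pointMass 𝕜 x ⟶ ξ) :=
  (exists_pointMassIncl ξ x).choose

theorem pointMassIncl_apply (ξ : Ell 𝕜 X (BanSp.{u} 𝕜)) (x : X) (e : (fiber ξ x).carrier) (y : X)
    (r : (fiber (pointMass 𝕜 x) y).carrier) :
    BanSp.toCLM (fiberMap (pointMassIncl ξ x e) y) r = BanSp.toCLM (matrixUnit ξ x y r) e :=
  (exists_pointMassIncl ξ x).choose_spec.2 e y r

theorem pointMassIncl_one (ξ : Ell 𝕜 X (BanSp.{u} 𝕜)) (x : X) (e : (fiber ξ x).carrier) :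
    BanSp.toCLM (fiberMap (pointMassIncl ξ x e) x) (pointMassOne x) = e := by
  rw [pointMassIncl_apply, matrixUnit_one]
  rfl

/-- Morphisms out of the point mass at `x` are determined by the image of the unit vector. -/
theorem pointMass_hom_ext {x : X} {ζ : Ell 𝕜 X (BanSp.{u} 𝕜)} {f g : pointMass 𝕜 x ⟶ ζ}
    (h : BanSp.toCLM (fiberMap f x) (pointMassOne x) =
      BanSp.toCLM (fiberMap g x) (pointMassOne x)) : f = g := by
  refine hom_ext fun y => ContinuousLinearMap.ext fun r => ?_
  change BanSp.toCLM (fiberMap f y) r = BanSp.toCLM (fiberMap g y) r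
  by_cases hxy : x = y
  · subst hxy
    obtain ⟨k, rfl⟩ := exists_eq_smul_pointMassOne x r
    rw [map_smul, map_smul, h]
  · rw [pointMass_eq_zero hxy r, map_zero, map_zero]

/-- Point masses represent evaluation, as in the Yoneda lemma: vectors of ξ_x are the morphisms from
δ_x to ξ, and α acts on them by composition. Both sides take the unit vector to the image of e under
α_x. -/
theorem pointMassIncl_comp {ξ ζ : Ell 𝕜 X (BanSp.{u} 𝕜)} (α : ξ ⟶ ζ) (x : X)
    (e : (fiber ξ x).carrier) :
    pointMassIncl ξ x e ≫ α = pointMassIncl ζ x (BanSp.toCLM (fiberMap α x) e) := by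
  refine pointMass_hom_ext ?_
  rw [pointMassIncl_one]
  exact congrArg (BanSp.toCLM (fiberMap α x)) (pointMassIncl_one ξ x e)

/-- Every object `ξ` of `ℓ(X)` is the sum of the point masses weighted by the `ξ_x`. -/
theorem isWeightedSum_pointMassIncl (ξ : Ell 𝕜 X (BanSp.{u} 𝕜)) :
    IsWeightedSum (pointMassIncl ξ) where
  norm_le x := (exists_pointMassIncl ξ x).choose_spec.1
  exists_desc ζ t M hM ht := by
    -- The factorization is forced: in the fiber at y it sends a vector e to the value of `t y e` at
    -- the unit vector of δ_y. This is bounded by M ‖e‖ because the unit vector has norm at most 1.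
    have hb (y : X) (e : (fiber ξ y).carrier) :
        ‖BanSp.toCLM (fiberMap (t y e) y) (pointMassOne y)‖ ≤ M * ‖e‖ := by
      refine ((BanSp.toCLM (fiberMap (t y e) y)).le_opNorm _).trans ?_
      refine (mul_le_of_le_one_right (norm_nonneg _) (norm_pointMassOne_le y)).trans ?_
      exact (BanFun.norm_app_le (t y e) ⟨y⟩).trans ((t y).le_of_opNorm_le (ht y) e)
    let f (y : X) : (fiber ξ y).carrier →L[𝕜] (fiber ζ y).carrier :=
      LinearMap.mkContinuous
        { toFun := fun e => BanSp.toCLM (fiberMap (t y e) y) (pointMassOne y)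
          map_add' := fun e e' => by rw [map_add]; rfl
          map_smul' := fun k e => by rw [map_smul]; rfl } M (hb y)
    obtain ⟨g, hg, hg'⟩ := exists_hom (ξ := ξ) (ζ := ζ) (fun y => BanSp.ofCLM (f y)) hM
      fun y => LinearMap.mkContinuous_norm_le _ hM _
    refine ⟨g, hg, fun x e => ?_⟩
    rw [pointMassIncl_comp]
    refine pointMass_hom_ext ?_
    rw [pointMassIncl_one, hg']
    rfl
  hom_ext ζ f g hfg := hom_ext fun x => ContinuousLinearMap.ext fun e => by
    have h := hfg x e
    rw [pointMassIncl_comp, pointMassIncl_comp] at h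
    have h' := congrArg (fun α => BanSp.toCLM (fiberMap α x) (pointMassOne x)) h
    simp only [pointMassIncl_one] at h'
    exact h'

variable [IsBanachTwoSpace 𝕜 A]

/-- The object `x ⊗ a` of `ℓ(X, A)` concentrated at `x`. -/
abbrev single (x : X) (a : A) : Ell 𝕜 X A := ((tensorBifunctor 𝕜 X A).obj (pointMass 𝕜 x)).obj a

/-- The inclusion in `ξ` of its part concentrated at `x`. -/
def singleIncl (ξ : Ell 𝕜 X A) (x : X) : single x (fiber ξ x) ⟶ ξ :=
  ofBounded (fun y => tensorDesc (matrixUnit ξ x y))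
    ⟨1, by rintro _ ⟨y, rfl⟩; exact (norm_tensorDesc_le _).trans (norm_matrixUnit_le ξ x y)⟩

theorem tensorBifunctorMk_singleIncl (ξ : Ell 𝕜 X A) (x y : X)
    (r : (fiber (pointMass 𝕜 x) y).carrier) :
    tensorBifunctorMk (pointMass 𝕜 x) (fiber ξ x) y r ≫ fiberMap (singleIncl ξ x) y =
      matrixUnit ξ x y r :=
  tensorMk_desc _ r

theorem norm_singleIncl_le (ξ : Ell 𝕜 X A) (x : X) : ‖singleIncl ξ x‖ ≤ 1 :=
  norm_le _ zero_le_one fun y => (norm_tensorDesc_le _).trans (norm_matrixUnit_le ξ x y)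

/-- The part of a morphism out of an object concentrated at `x`. -/
def singlePart {x : X} {a : A} {ζ : Ell 𝕜 X A} (f : single x a ⟶ ζ) : a ⟶ fiber ζ x :=
  tensorBifunctorMk (pointMass 𝕜 x) a x (pointMassOne x) ≫ fiberMap f x

theorem norm_singlePart_le {x : X} {a : A} {ζ : Ell 𝕜 X A} (f : single (𝕜 := 𝕜) x a ⟶ ζ) :
    ‖singlePart f‖ ≤ ‖f‖ :=
  (norm_comp_le_of_le_one ((norm_tensorMk_apply_le _ a _).trans (norm_pointMassOne_le x)) _).trans
    (BanFun.norm_app_le f ⟨x⟩)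

/-- Away from x the fibers are tensors with the zero space, so nothing is to be checked there; at x
every vector of the point mass is a multiple of its unit vector. -/
theorem single_hom_ext {x : X} {a : A} {ζ : Ell 𝕜 X A} {f g : single x a ⟶ ζ}
    (h : singlePart f = singlePart g) : f = g := by
  refine hom_ext fun y => (isTensor_tensorMk (fiber (pointMass 𝕜 x) y) a).hom_ext _ _ _
    fun (r : (fiber (pointMass 𝕜 x) y).carrier) => ?_
  change tensorBifunctorMk (pointMass 𝕜 x) a y r ≫ fiberMap f y =
    tensorBifunctorMk (pointMass 𝕜 x) a y r ≫ fiberMap g y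
  by_cases hxy : x = y
  · subst hxy
    obtain ⟨k, rfl⟩ := exists_eq_smul_pointMassOne x r
    rw [map_smul, BanachCategory.smul_comp, BanachCategory.smul_comp]
    exact congrArg (k • ·) h
  · rw [pointMass_eq_zero hxy r, map_zero, zero_comp, zero_comp]

/-- The part at x of the inclusion is the identity of ξ_x. Hence composing with the inclusions only
reads off the components of `f`, which is what makes them a coproduct. -/
theorem singlePart_singleIncl_comp {ξ ζ : Ell 𝕜 X A} (x : X) (f : ξ ⟶ ζ) :
    singlePart (singleIncl ξ x ≫ f) = fiberMap f x := by
  have h := tensorBifunctorMk_singleIncl ξ x x (pointMassOne x)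
  rw [matrixUnit_one] at h
  change tensorBifunctorMk _ _ x (pointMassOne x) ≫ fiberMap (singleIncl ξ x) x ≫ fiberMap f x = _
  rw [← Category.assoc]
  rw [h, Category.id_comp]

/-- Every object of `ℓ(X, A)` is the coproduct of its parts concentrated at the points. -/
theorem isCoproduct_singleIncl (ξ : Ell 𝕜 X A) : IsCoproduct (singleIncl ξ) where
  norm_le := norm_singleIncl_le ξ
  exists_desc ζ t M hM ht := by
    obtain ⟨g, hg, hg'⟩ := exists_hom (ξ := ξ) (ζ := ζ) (fun y => singlePart (t y)) hM
      fun y => (norm_singlePart_le (t y)).trans (ht y)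
    exact ⟨g, hg, fun x => single_hom_ext ((singlePart_singleIncl_comp x g).trans (hg' x))⟩
  hom_ext ζ f g hfg := hom_ext fun x => by
    rw [← singlePart_singleIncl_comp, ← singlePart_singleIncl_comp, hfg]

theorem singlePart_map_comp {x : X} {a b : A} {ζ : Ell 𝕜 X A} (f : a ⟶ b) (g : single x b ⟶ ζ) :
    singlePart (((tensorBifunctor 𝕜 X A).obj (pointMass 𝕜 x)).map f ≫ g) = f ≫ singlePart g :=
  tensorMk_map_assoc (𝟙 _) f (pointMassOne x) (fiberMap g x)

/-- Both sides start at an object concentrated at x, and both have α_x as their part at x. -/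
theorem singleIncl_naturality {ξ ζ : Ell 𝕜 X A} (α : ξ ⟶ ζ) (x : X) :
    ((tensorBifunctor 𝕜 X A).obj (pointMass 𝕜 x)).map (fiberMap α x) ≫ singleIncl ζ x =
      singleIncl ξ x ≫ α := by
  have h := singlePart_singleIncl_comp (ξ := ζ) x (𝟙 ζ)
  rw [Category.comp_id] at h
  refine single_hom_ext ?_
  rw [singlePart_map_comp, singlePart_singleIncl_comp, h]
  exact Category.comp_id _

/-- Compatibility of the two decompositions into parts concentrated at a point. -/
theorem map_tensorBifunctorMk_singleIncl (ξ : Ell 𝕜 X (BanSp.{u} 𝕜)) (a : A) (x : X)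
    (e : (fiber ξ x).carrier) :
    ((tensorBifunctor 𝕜 X A).obj (pointMass 𝕜 x)).map (tensorBifunctorMk ξ a x e) ≫
        singleIncl (((tensorBifunctor 𝕜 X A).obj ξ).obj a) x =
      ((tensorBifunctor 𝕜 X A).map (pointMassIncl ξ x e)).app a := by
  have h := singlePart_singleIncl_comp (ξ := ((tensorBifunctor 𝕜 X A).obj ξ).obj a) x (𝟙 _)
  rw [Category.comp_id] at h
  refine single_hom_ext ?_
  rw [singlePart_map_comp, h]
  -- Both parts at x are the universal map of ξ_x ⊗ a at e, since the morphism from δ_x to ξ given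
  -- by e takes the unit vector to e.
  refine (Category.comp_id _).trans ((congrArg _ (pointMassIncl_one ξ x e).symm).trans ?_)
  exact (tensorMk_map_id_right _ a (pointMassOne x)).symm

end Ell

/-! ### Comparison of functors with values in weighted sums -/

section comparison

variable {𝕜 : Type} [RCLike 𝕜] {P : Type v₁} [Category.{u} P] {Q : Type v₂} [Category.{u} Q]
    {C : Type v₃} [Category.{u} C] [PreBanachCategory C]

/-- Bifunctors are uniquely isometrically isomorphic if their values are so, by isomorphisms
that are characterized by a natural property. -/
theorem existsUnique_isIsometricIso₂ {F G : P ⥤ Q ⥤ C}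
    (R : ∀ p q, ((F.obj p).obj q ⟶ (G.obj p).obj q) → Prop)
    (R' : ∀ p q, ((G.obj p).obj q ⟶ (F.obj p).obj q) → Prop)
    (hR : ∀ p q, ∃ f, ‖f‖ ≤ 1 ∧ R p q f) (hR' : ∀ p q, ∃ g, ‖g‖ ≤ 1 ∧ R' p q g)
    (hom_inv : ∀ p q f g, R p q f → R' p q g → f ≫ g = 𝟙 _)
    (inv_hom : ∀ p q f g, R p q f → R' p q g → g ≫ f = 𝟙 _)
    (nat₁ : ∀ {p p'} (u : p ⟶ p') q f f', R p q f → R p' q f' →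
      (F.map u).app q ≫ f' = f ≫ (G.map u).app q)
    (nat₂ : ∀ p {q q'} (v : q ⟶ q') f f', R p q f → R p q' f' →
      (F.obj p).map v ≫ f' = f ≫ (G.obj p).map v) :
    ∃! σ : F ≅ G, IsIsometricIso₂ σ ∧ ∀ p q, R p q ((σ.hom.app p).app q) := by
  choose f hf hfR using hR
  choose g hg hgR using hR'
  let σ : F ≅ G := NatIso.ofComponents
    (fun p => NatIso.ofComponents
      (fun q => ⟨f p q, g p q, hom_inv _ _ _ _ (hfR p q) (hgR p q),
        inv_hom _ _ _ _ (hfR p q) (hgR p q)⟩)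
      fun v => nat₂ p v _ _ (hfR _ _) (hfR _ _))
    fun u => NatTrans.ext (funext fun q => nat₁ u q _ _ (hfR _ _) (hfR _ _))
  refine ⟨σ, ⟨fun p q => ⟨hf p q, hg p q⟩, hfR⟩, fun τ hτ => ?_⟩
  refine Iso.ext (NatTrans.ext (funext fun p => NatTrans.ext (funext fun q => ?_)))
  change (τ.hom.app p).app q = f p q
  -- Uniqueness needs no cancellation property of `R`. Any τ satisfying `R` is also inverse to g, so
  -- τ = τ ≫ g ≫ f = f.
  rw [← Category.comp_id ((τ.hom.app p).app q), ← inv_hom p q _ _ (hfR p q) (hgR p q),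
    ← Category.assoc, hom_inv p q _ _ (hτ.2 p q) (hgR p q), Category.id_comp]

variable [BanachCategory 𝕜 C]

/-- Bifunctors with values in weighted sums of the same families are uniquely isometrically
isomorphic. -/
theorem existsUnique_isIsometricIso₂_of_isWeightedSum {F G : P ⥤ Q ⥤ C} {X : Type u}
    {E : P → Q → X → BanSp.{u} 𝕜} {c : P → Q → X → C}
    (s : ∀ p q x, E p q x →L[𝕜] (c p q x ⟶ (F.obj p).obj q))
    (s' : ∀ p q x, E p q x →L[𝕜] (c p q x ⟶ (G.obj p).obj q))
    (hs : ∀ p q, IsWeightedSum (s p q)) (hs' : ∀ p q, IsWeightedSum (s' p q))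
    (nat₁ : ∀ {p p'} (u : p ⟶ p') q x e, ∃ (m : c p q x ⟶ c p' q x) (e' : E p' q x),
      s p q x e ≫ (F.map u).app q = m ≫ s p' q x e' ∧
      s' p q x e ≫ (G.map u).app q = m ≫ s' p' q x e')
    (nat₂ : ∀ p {q q'} (v : q ⟶ q') x e, ∃ (m : c p q x ⟶ c p q' x) (e' : E p q' x),
      s p q x e ≫ (F.obj p).map v = m ≫ s p q' x e' ∧
      s' p q x e ≫ (G.obj p).map v = m ≫ s' p q' x e') :
    ∃! σ : F ≅ G, IsIsometricIso₂ σ ∧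
      ∀ p q x e, s p q x e ≫ (σ.hom.app p).app q = s' p q x e :=
  existsUnique_isIsometricIso₂ (fun p q f => ∀ x e, s p q x e ≫ f = s' p q x e)
    (fun p q g => ∀ x e, s' p q x e ≫ g = s p q x e)
    (fun p q => (hs p q).exists_comparison (hs' p q).norm_le)
    (fun p q => (hs' p q).exists_comparison (hs p q).norm_le)
    (fun p q _ _ hf hg => (hs p q).comp_eq_id hf hg)
    (fun p q _ _ hf hg => (hs' p q).comp_eq_id hg hf)
    -- It suffices to test on structure maps. One pair `m`, `e'` describes how both functors move a
    -- given structure map, so the comparison commutes with the functorial actions.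
    (fun {p p'} u q f f' hf hf' => (hs p q).hom_ext _ _ _ fun x e => by
      obtain ⟨m, e', h, h'⟩ := nat₁ u q x e
      rw [← Category.assoc, ← Category.assoc, h, hf, h', Category.assoc, hf'])
    (fun p {q q'} v f f' hf hf' => (hs p q).hom_ext _ _ _ fun x e => by
      obtain ⟨m, e', h, h'⟩ := nat₂ p v x e
      rw [← Category.assoc, ← Category.assoc, h, hf, h', Category.assoc, hf'])

theorem Ell.fiberMap_comp {Y : Type u} {ξ ζ ρ : Ell 𝕜 Y C} (f : ξ ⟶ ζ) (g : ζ ⟶ ρ) (y : Y) :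
    fiberMap (f ≫ g) y = fiberMap f y ≫ fiberMap g y := rfl

/-- Bifunctors to `ℓ(Y, C)` whose fibers are weighted sums of the same families are uniquely
isometrically isomorphic. -/
theorem Ell.existsUnique_isIsometricIso₂_of_fibers {Y : Type u} {F G : P ⥤ Q ⥤ Ell 𝕜 Y C}
    {X : Y → Type u} {E : P → Q → ∀ y, X y → BanSp.{u} 𝕜} {c : P → Q → ∀ y, X y → C}
    (s : ∀ p q y x, E p q y x →L[𝕜] (c p q y x ⟶ fiber ((F.obj p).obj q) y))
    (s' : ∀ p q y x, E p q y x →L[𝕜] (c p q y x ⟶ fiber ((G.obj p).obj q) y))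
    (hs : ∀ p q y, IsWeightedSum (s p q y)) (hs' : ∀ p q y, IsWeightedSum (s' p q y))
    (nat₁ : ∀ {p p'} (u : p ⟶ p') q y x e,
      ∃ (m : c p q y x ⟶ c p' q y x) (e' : E p' q y x),
      s p q y x e ≫ fiberMap ((F.map u).app q) y = m ≫ s p' q y x e' ∧
      s' p q y x e ≫ fiberMap ((G.map u).app q) y = m ≫ s' p' q y x e')
    (nat₂ : ∀ p {q q'} (v : q ⟶ q') y x e,
      ∃ (m : c p q y x ⟶ c p q' y x) (e' : E p q' y x),
      s p q y x e ≫ fiberMap ((F.obj p).map v) y = m ≫ s p q' y x e' ∧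
      s' p q y x e ≫ fiberMap ((G.obj p).map v) y = m ≫ s' p q' y x e') :
    ∃! σ : F ≅ G, IsIsometricIso₂ σ ∧
      ∀ p q y x e, s p q y x e ≫ fiberMap ((σ.hom.app p).app q) y = s' p q y x e := by
  refine existsUnique_isIsometricIso₂
    (fun p q f => ∀ y x e, s p q y x e ≫ fiberMap f y = s' p q y x e)
    (fun p q g => ∀ y x e, s' p q y x e ≫ fiberMap g y = s p q y x e)
    (fun p q => ?_) (fun p q => ?_)
    (fun p q _ _ hf hg => hom_ext fun y => (hs p q y).comp_eq_id (hf y) (hg y))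
    (fun p q _ _ hf hg => hom_ext fun y => (hs' p q y).comp_eq_id (hg y) (hf y))
    (fun {p p'} u q f f' hf hf' => hom_ext fun y => (hs p q y).hom_ext _ _ _ fun x e => ?_)
    (fun p {q q'} v f f' hf hf' => hom_ext fun y => (hs p q y).hom_ext _ _ _ fun x e => ?_)
  · choose f hf hf' using fun y => (hs p q y).exists_comparison (hs' p q y).norm_le
    obtain ⟨g, hg, hg'⟩ := exists_hom f zero_le_one hf
    exact ⟨g, hg, fun y x e => by rw [hg', hf']⟩
  · choose f hf hf' using fun y => (hs' p q y).exists_comparison (hs p q y).norm_le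
    obtain ⟨g, hg, hg'⟩ := exists_hom f zero_le_one hf
    exact ⟨g, hg, fun y x e => by rw [hg', hf']⟩
  · obtain ⟨m, e', h, h'⟩ := nat₁ u q y x e
    rw [fiberMap_comp, fiberMap_comp, ← Category.assoc, ← Category.assoc, h, hf, h',
      Category.assoc, hf']
  · obtain ⟨m, e', h, h'⟩ := nat₂ p v y x e
    rw [fiberMap_comp, fiberMap_comp, ← Category.assoc, ← Category.assoc, h, hf, h',
      Category.assoc, hf']

/-- Functors with values in weighted sums of the same families are uniquely isometrically
isomorphic. -/
theorem existsUnique_isIsometricIso_of_isWeightedSum {F G : P ⥤ C} {X : Type u}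
    {E : P → X → BanSp.{u} 𝕜} {c : P → X → C}
    (s : ∀ p x, E p x →L[𝕜] (c p x ⟶ F.obj p)) (s' : ∀ p x, E p x →L[𝕜] (c p x ⟶ G.obj p))
    (hs : ∀ p, IsWeightedSum (s p)) (hs' : ∀ p, IsWeightedSum (s' p))
    (nat : ∀ {p p'} (u : p ⟶ p') x e, ∃ (m : c p x ⟶ c p' x) (e' : E p' x),
      s p x e ≫ F.map u = m ≫ s p' x e' ∧ s' p x e ≫ G.map u = m ≫ s' p' x e') :
    ∃! σ : F ≅ G, IsIsometricIso σ ∧ ∀ p x e, s p x e ≫ σ.hom.app p = s' p x e := by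
  choose f hf hfs using fun p => (hs p).exists_comparison (hs' p).norm_le
  choose g hg hgs using fun p => (hs' p).exists_comparison (hs p).norm_le
  let σ : F ≅ G := NatIso.ofComponents
    (fun p => ⟨f p, g p, (hs p).comp_eq_id (hfs p) (hgs p), (hs' p).comp_eq_id (hgs p) (hfs p)⟩)
    fun {p p'} u => (hs p).hom_ext _ _ _ fun x e => by
      obtain ⟨m, e', h, h'⟩ := nat u x e
      rw [← Category.assoc, ← Category.assoc, h, hfs, h', Category.assoc, hfs]
  refine ⟨σ, ⟨fun p => ⟨hf p, hg p⟩, hfs⟩, fun τ hτ => ?_⟩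
  exact Iso.ext (NatTrans.ext (funext fun p => (hs p).hom_ext _ _ _ fun x e =>
    (hτ.2 p x e).trans (hfs p x e).symm))

end comparison

/-! ### The bitensor product -/

section bitensor

variable {𝕜 : Type} [RCLike 𝕜] {X : Type u} {A : Type v₁} [Category.{u} A]
    [PreBanachCategory A] [BanachCategory 𝕜 A] [IsBanachTwoSpace 𝕜 A]
    {C : Type w} [Category.{u} C] [PreBanachCategory C] [BanachCategory 𝕜 C]

open Ell

/-- Transformations of cocontinuous functors on `ℓ(X, A)` are determined by their restrictions
to the objects `ξ ⊗ a`. -/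
theorem Ell.existsUnique_extension {S T : Ell 𝕜 X A ⥤ C} (hS : IsCocontinuous 𝕜 S)
    (hT : IsCocontinuous 𝕜 T)
    (β : ∀ ξ a, S.obj (((tensorBifunctor 𝕜 X A).obj ξ).obj a) ⟶
      T.obj (((tensorBifunctor 𝕜 X A).obj ξ).obj a))
    (nat₁ : ∀ {ξ ζ} (u : ξ ⟶ ζ) a, S.map (((tensorBifunctor 𝕜 X A).map u).app a) ≫ β ζ a =
      β ξ a ≫ T.map (((tensorBifunctor 𝕜 X A).map u).app a))
    (nat₂ : ∀ ξ {a b} (v : a ⟶ b), S.map (((tensorBifunctor 𝕜 X A).obj ξ).map v) ≫ β ξ b =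
      β ξ a ≫ T.map (((tensorBifunctor 𝕜 X A).obj ξ).map v))
    {M : ℝ} (hM : 0 ≤ M) (hβ : ∀ ξ a, ‖β ξ a‖ ≤ M) :
    ∃! θ : S ⟶ T, (∀ ξ, ‖θ.app ξ‖ ≤ M) ∧
      ∀ ξ a, θ.app (((tensorBifunctor 𝕜 X A).obj ξ).obj a) = β ξ a := by
  have hj (ξ : Ell 𝕜 X A) := (isCoproduct_singleIncl ξ).map hS
  -- On the summand at x the extension must be β at (δ_x, ξ_x) followed by `T.map` of the inclusion,
  -- a family bounded by M.
  choose f hf hf' using fun ξ : Ell 𝕜 X A => (hj ξ).exists_desc (T.obj ξ)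
    (fun x => β (pointMass 𝕜 x) (fiber ξ x) ≫ T.map (singleIncl ξ x)) M hM fun x =>
      (norm_comp_le_of_le_one_right _ ((hT.contractive.norm_map_le _).trans
        (norm_singleIncl_le ξ x))).trans (hβ _ _)
  let θ : S ⟶ T :=
    { app := f
      -- On each summand, naturality of the inclusions turns the claim into naturality of β in its
      -- second variable, at δ_x.
      naturality := fun ξ ζ α => (hj ξ).hom_ext _ _ _ fun x => by
        rw [← Category.assoc, ← S.map_comp, ← singleIncl_naturality, S.map_comp, Category.assoc,
          hf', ← Category.assoc, nat₂, Category.assoc, ← T.map_comp, singleIncl_naturality,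
          T.map_comp, ← Category.assoc, ← hf', Category.assoc] }
  refine ⟨θ, ⟨hf, fun ξ a => ?_⟩, fun θ' hθ' => NatTrans.ext (funext fun ξ =>
    (hj ξ).hom_ext _ _ _ fun x => ?_)⟩
  -- Agreement with β at ξ ⊗ a: as - ⊗ a and S preserve the decomposition of ξ into point masses, it
  -- is enough to test on the maps from S(δ_x ⊗ a) given by vectors e of ξ_x. There naturality of β
  -- in both variables applies, linked by `map_tensorBifunctorMk_singleIncl`.
  · refine (((isWeightedSum_pointMassIncl ξ).map
      (isBicocontinuous_tensorBifunctor.left a)).map hS).hom_ext _ _ _ fun x e => ?_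
    change S.map (((tensorBifunctor 𝕜 X A).map (pointMassIncl ξ x e)).app a) ≫ f _ =
      S.map (((tensorBifunctor 𝕜 X A).map (pointMassIncl ξ x e)).app a) ≫ β ξ a
    rw [nat₁, ← map_tensorBifunctorMk_singleIncl, S.map_comp, Category.assoc, hf',
      ← Category.assoc, nat₂, T.map_comp, Category.assoc]
  -- The source of each inclusion is itself of the form ξ ⊗ a, so naturality along it determines any
  -- extension.
  · rw [θ'.naturality, hθ'.2]
    exact (hf' ξ x).symm

/-- A bicocontinuous bifunctor on `ℓ(X) ⊗ A` factors through `ℓ(X, A)`. -/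
theorem Ell.exists_factor [IsBanachTwoSpace 𝕜 C] (φ : Ell 𝕜 X (BanSp.{u} 𝕜) ⥤ A ⥤ C)
    (hφ : IsBicocontinuous 𝕜 φ) : ∃ T : Ell 𝕜 X A ⥤ C, IsCocontinuous 𝕜 T ∧
      ∃ σ : bifunctorComp (tensorBifunctor 𝕜 X A) T ≅ φ, IsIsometricIso₂ σ := by
  have hT (x : X) : IsCocontinuous 𝕜 (eval 𝕜 A x ⋙ φ.obj (pointMass 𝕜 x)) :=
    (isCocontinuous_eval x).comp (hφ.right _)
  -- This is the forced formula T ζ = Σ_x φ(δ_x, ζ_x).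
  let T : Ell 𝕜 X A ⥤ C := sumFunctor _ fun x => (hT x).contractive
  let inj (ζ : Ell 𝕜 X A) (x : X) : (φ.obj (pointMass 𝕜 x)).obj (fiber ζ x) ⟶ T.obj ζ :=
    coprodInj 𝕜 (fun x => (eval 𝕜 A x ⋙ φ.obj (pointMass 𝕜 x)).obj ζ) x
  have hinj {ζ ζ' : Ell 𝕜 X A} (α : ζ ⟶ ζ') (x : X) :
      inj ζ x ≫ T.map α = (φ.obj (pointMass 𝕜 x)).map (fiberMap α x) ≫ inj ζ' x :=
    coprodInj_map _ (bddAbove_map (fun x => (hT x).contractive) α) x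
  have hη (ξ : Ell 𝕜 X (BanSp.{u} 𝕜)) (a : A) (x : X) : IsTensor
      ((((hφ.right (pointMass 𝕜 x)).contractive.mapCLM _ _).comp (tensorBifunctorMk ξ a x))) :=
    IsTensor.map (isTensor_tensorMk (fiber ξ x) a) (hφ.right (pointMass 𝕜 x))
  refine ⟨T, isCocontinuous_sumFunctor hT, ?_⟩
  -- Since φ(δ_x, -) preserves the tensor ξ_x ⊗ a, the value T(ξ ⊗ a) is the sum of the φ(δ_x, a)
  -- weighted by the ξ_x. By cocontinuity of φ(-, a), so is φ(ξ, a).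
  have hs (ξ a) := IsCoproduct.isWeightedSum (c := T.obj (((tensorBifunctor 𝕜 X A).obj ξ).obj a))
    (ι := inj _) (isCoproduct_coprodInj 𝕜 _) (hη ξ a)
  obtain ⟨σ, hσ, -⟩ := existsUnique_isIsometricIso₂_of_isWeightedSum
    (F := bifunctorComp (tensorBifunctor 𝕜 X A) T) (G := φ) _ _ hs
    (fun ξ a => (isWeightedSum_pointMassIncl ξ).map (hφ.left a))
    (fun {ξ ζ} u a x e => ⟨𝟙 _, BanSp.toCLM (fiberMap u x) e, by
      change ((φ.obj (pointMass 𝕜 x)).map (tensorBifunctorMk ξ a x e) ≫ inj _ x) ≫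
        T.map (((tensorBifunctor 𝕜 X A).map u).app a) = 𝟙 _ ≫ (φ.obj (pointMass 𝕜 x)).map
          (tensorBifunctorMk ζ a x (BanSp.toCLM (fiberMap u x) e)) ≫ inj _ x
      rw [Category.id_comp, Category.assoc, hinj, ← Category.assoc, ← Functor.map_comp]
      exact congrArg (fun m => (φ.obj (pointMass 𝕜 x)).map m ≫ inj _ x)
        (tensorMk_map_id_right (fiberMap u x) a e), by
      change (φ.map (pointMassIncl ξ x e)).app a ≫ (φ.map u).app a =
        𝟙 _ ≫ (φ.map (pointMassIncl ζ x (BanSp.toCLM (fiberMap u x) e))).app a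
      rw [Category.id_comp, ← NatTrans.comp_app, ← φ.map_comp, pointMassIncl_comp]⟩)
    (fun ξ {a b} v x e => ⟨(φ.obj (pointMass 𝕜 x)).map v, e, by
      change ((φ.obj (pointMass 𝕜 x)).map (tensorBifunctorMk ξ a x e) ≫ inj _ x) ≫
        T.map (((tensorBifunctor 𝕜 X A).obj ξ).map v) = (φ.obj (pointMass 𝕜 x)).map v ≫
          (φ.obj (pointMass 𝕜 x)).map (tensorBifunctorMk ξ b x e) ≫ inj _ x
      rw [Category.assoc, hinj, ← Category.assoc, ← Functor.map_comp, ← Category.assoc,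
        ← Functor.map_comp]
      exact congrArg (fun m => (φ.obj (pointMass 𝕜 x)).map m ≫ inj _ x)
        (tensorMk_map_id_left (fiber ξ x) v e),
      ((φ.map (pointMassIncl ξ x e)).naturality v).symm⟩)
  exact ⟨σ, hσ.1⟩

end bitensor

/-! ### Uniqueness of factorizations and the universal property. -/

section universal

variable {𝕜 : Type} [RCLike 𝕜] {X : Type u} {A : Type v₁} [Category.{u} A]
    [PreBanachCategory A] [BanachCategory 𝕜 A] [IsBanachTwoSpace 𝕜 A]

theorem Ell.existsUnique_extend_transformation {C : Type w} [Category.{u} C]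
    [PreBanachCategory C] [BanachCategory 𝕜 C] {S T : Ell 𝕜 X A ⥤ C} (hS : IsCocontinuous 𝕜 S)
    (hT : IsCocontinuous 𝕜 T)
    (β : bifunctorComp (tensorBifunctor 𝕜 X A) S ⟶ bifunctorComp (tensorBifunctor 𝕜 X A) T)
    {M : ℝ} (hM : 0 ≤ M) (hβ : ∀ ξ a, ‖(β.app ξ).app a‖ ≤ M) :
    ∃! θ : S ⟶ T, (∀ ξ, ‖θ.app ξ‖ ≤ M) ∧
      ∀ ξ a, θ.app (((tensorBifunctor 𝕜 X A).obj ξ).obj a) = (β.app ξ).app a :=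
  existsUnique_extension hS hT (fun ξ a => (β.app ξ).app a)
    (fun u a => congrArg (fun γ => γ.app a) (β.naturality u))
    (fun ξ _ _ v => (β.app ξ).naturality v) hM hβ

section

variable {B : Type v₂} [Category.{u} B] {P : Type v₃} [Category.{u} P] {C : Type w}
    [Category.{u} C] [PreBanachCategory C]

/-- If contractive transformations extend uniquely along `i`, then so do isometric
isomorphisms. -/
theorem existsUnique_isIsometricIso_of_extension {D : Type v₁} [Category.{u} D]
    {i : D ⥤ B ⥤ P} {S T : P ⥤ C}
    (ext : ∀ U V : P ⥤ C, (U = S ∨ U = T) → (V = S ∨ V = T) →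
      ∀ β : bifunctorComp i U ⟶ bifunctorComp i V, (∀ a b, ‖(β.app a).app b‖ ≤ 1) →
      ∃! θ : U ⟶ V, (∀ p, ‖θ.app p‖ ≤ 1) ∧
        ∀ a b, θ.app ((i.obj a).obj b) = (β.app a).app b)
    {φ : D ⥤ B ⥤ C} (σ : bifunctorComp i S ≅ φ) (τ : bifunctorComp i T ≅ φ)
    (hσ : IsIsometricIso₂ σ) (hτ : IsIsometricIso₂ τ) :
    ∃! θ : S ≅ T, IsIsometricIso θ ∧
      ∀ a b, θ.hom.app ((i.obj a).obj b) ≫ (τ.hom.app a).app b = (σ.hom.app a).app b := by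
  -- The isomorphism and its inverse extend σ followed by the inverse of τ, and τ followed by the
  -- inverse of σ.
  obtain ⟨f, ⟨hf, hf'⟩, hfu⟩ := ext S T (.inl rfl) (.inr rfl) (σ.hom ≫ τ.inv) fun a b =>
    (norm_comp_le_of_le_one_right _ (hτ a b).2).trans (hσ a b).1
  obtain ⟨g, ⟨hg, hg'⟩, -⟩ := ext T S (.inr rfl) (.inl rfl) (τ.hom ≫ σ.inv) fun a b =>
    (norm_comp_le_of_le_one_right _ (hσ a b).2).trans (hτ a b).1
  -- Uniqueness of extensions from a functor to itself: a contractive endomorphism restricting to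
  -- the identity along `i` is the identity. Applied to both composites, it shows that `f` and `g`
  -- are inverse.
  have hid {U : P ⥤ C} (hU : U = S ∨ U = T) {k : U ⟶ U} (hk : ∀ p, ‖k.app p‖ ≤ 1)
      (hk' : ∀ a b, k.app ((i.obj a).obj b) = 𝟙 _) : k = 𝟙 U :=
    (ext U U hU hU (𝟙 _) fun a b => PreBanachCategory.norm_id_le _).unique ⟨hk, hk'⟩
      ⟨fun p => PreBanachCategory.norm_id_le _, fun a b => rfl⟩
  have hσc (a b) : (σ.hom.app a).app b ≫ (σ.inv.app a).app b = 𝟙 _ := by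
    rw [← NatTrans.comp_app, ← NatTrans.comp_app, σ.hom_inv_id]
    rfl
  have hσi (a b) : (σ.inv.app a).app b ≫ (σ.hom.app a).app b = 𝟙 _ := by
    rw [← NatTrans.comp_app, ← NatTrans.comp_app, σ.inv_hom_id]
    rfl
  have hτc (a b) : (τ.hom.app a).app b ≫ (τ.inv.app a).app b = 𝟙 _ := by
    rw [← NatTrans.comp_app, ← NatTrans.comp_app, τ.hom_inv_id]
    rfl
  have hτi (a b) : (τ.inv.app a).app b ≫ (τ.hom.app a).app b = 𝟙 _ := by
    rw [← NatTrans.comp_app, ← NatTrans.comp_app, τ.inv_hom_id]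
    rfl
  have hfg : f ≫ g = 𝟙 S := hid (.inl rfl)
    (fun p => (norm_comp_le_of_le_one_right _ (hg p)).trans (hf p)) fun a b => by
      rw [NatTrans.comp_app, hf', hg']
      change ((σ.hom.app a).app b ≫ (τ.inv.app a).app b) ≫
        (τ.hom.app a).app b ≫ (σ.inv.app a).app b = _
      rw [Category.assoc, ← Category.assoc ((τ.inv.app a).app b), hτi, Category.id_comp, hσc]
      rfl
  have hgf : g ≫ f = 𝟙 T := hid (.inr rfl)
    (fun p => (norm_comp_le_of_le_one_right _ (hf p)).trans (hg p)) fun a b => by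
      rw [NatTrans.comp_app, hf', hg']
      change ((τ.hom.app a).app b ≫ (σ.inv.app a).app b) ≫
        (σ.hom.app a).app b ≫ (τ.inv.app a).app b = _
      rw [Category.assoc, ← Category.assoc ((σ.inv.app a).app b), hσi, Category.id_comp, hτc]
      rfl
  refine ⟨⟨f, g, hfg, hgf⟩, ⟨fun p => ⟨hf p, hg p⟩, fun a b => ?_⟩, fun θ hθ => Iso.ext
    (hfu _ ⟨fun p => (hθ.1 p).1, fun a b => ?_⟩)⟩
  · change f.app _ ≫ _ = _
    rw [hf']
    change ((σ.hom.app a).app b ≫ (τ.inv.app a).app b) ≫ (τ.hom.app a).app b = _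
    rw [Category.assoc, hτi, Category.comp_id]
  -- Compatibility with σ and τ says exactly that θ restricts to σ followed by the inverse of τ, so
  -- uniqueness of the extension `f` applies.
  · change _ = (σ.hom.app a).app b ≫ (τ.inv.app a).app b
    rw [← hθ.2 a b, Category.assoc]
    exact ((congrArg (θ.hom.app _ ≫ ·) (hτc a b)).trans (Category.comp_id _)).symm

end

/-- `ℓ(X, A)` is the bitensor product of `ℓ(X)` and `A`. -/
theorem Ell.isBitensor_tensorBifunctor :
    IsBitensor.{u, w} 𝕜 (Ell.tensorBifunctor 𝕜 X A) where
  cocomplete := inferInstance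
  bicocontinuous := isBicocontinuous_tensorBifunctor
  exists_factor _ _ _ _ _ φ hφ := exists_factor φ hφ
  unique_factor C _ _ _ _ φ _ S T hS hT σ τ hσ hτ := by
    have h (U : Ell 𝕜 X A ⥤ C) (hU : U = S ∨ U = T) : IsCocontinuous 𝕜 U := by
      rcases hU with rfl | rfl <;> assumption
    exact existsUnique_isIsometricIso_of_extension (fun U V hU hV β hβ =>
      existsUnique_extend_transformation (h U hU) (h V hV) β zero_le_one hβ) σ τ hσ hτ
  extend_transformation _ _ _ _ _ _ _ hS hT β _ hM hβ :=
    existsUnique_extend_transformation hS hT β hM hβ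

/-! ### Naturality -/

/-- Naturality of `ξ ⊗ a` in the Banach 2-space. -/
theorem Ell.existsUnique_mapFunctor_tensor {B : Type w} [Category.{u} B] [PreBanachCategory B]
    [BanachCategory 𝕜 B] [IsBanachTwoSpace 𝕜 B] {T : A ⥤ B} (hT : IsCocontinuous 𝕜 T) :
    ∃! σ : bifunctorComp (tensorBifunctor 𝕜 X A) (mapFunctor X T hT.contractive) ≅
        tensorBifunctor 𝕜 X B ⋙ (Functor.whiskeringLeft A B (Ell 𝕜 X B)).obj T,
      IsIsometricIso₂ σ ∧
      ∀ (ξ : Ell 𝕜 X (BanSp.{u} 𝕜)) (a : A) (x : X) (e : (fiber ξ x).carrier),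
        T.map (tensorBifunctorMk ξ a x e) ≫ fiberMap ((σ.hom.app ξ).app a) x =
          tensorBifunctorMk ξ (T.obj a) x e := by
  have h := existsUnique_isIsometricIso₂_of_fibers
    (F := bifunctorComp (tensorBifunctor 𝕜 X A) (mapFunctor X T hT.contractive))
    (G := tensorBifunctor 𝕜 X B ⋙ (Functor.whiskeringLeft A B (Ell 𝕜 X B)).obj T)
    -- In the fiber at x both sides are tensors of T a with ξ_x, that is, weighted sums over one
    -- point.
    (X := fun _ => PUnit) (E := fun ξ _ x _ => fiber ξ x) (c := fun _ a _ _ => T.obj a)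
    (fun ξ a x _ => (hT.contractive.mapCLM _ _).comp (tensorBifunctorMk ξ a x))
    (fun ξ a x _ => tensorBifunctorMk ξ (T.obj a) x)
    (fun ξ a x => ((isTensor_tensorMk (fiber ξ x) a).map hT).isWeightedSum)
    (fun ξ a x => (isTensor_tensorMk (fiber ξ x) (T.obj a)).isWeightedSum)
    (fun {ξ ζ} u a x _ e => ⟨𝟙 _, BanSp.toCLM (fiberMap u x) e, by
      change T.map (tensorMk (fiber ξ x) a e) ≫ T.map (tensorMap (fiberMap u x) (𝟙 a)) =
        𝟙 _ ≫ T.map (tensorMk (fiber ζ x) a (BanSp.toCLM (fiberMap u x) e))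
      rw [← T.map_comp, tensorMk_map_id_right, Category.id_comp], by
      change tensorMk (fiber ξ x) (T.obj a) e ≫ tensorMap (fiberMap u x) (𝟙 _) =
        𝟙 _ ≫ tensorMk (fiber ζ x) (T.obj a) (BanSp.toCLM (fiberMap u x) e)
      rw [tensorMk_map_id_right, Category.id_comp]⟩)
    (fun ξ {a b} v x _ e => ⟨T.map v, e, by
      change T.map (tensorMk (fiber ξ x) a e) ≫ T.map (tensorMap (𝟙 _) v) =
        T.map v ≫ T.map (tensorMk (fiber ξ x) b e)
      rw [← T.map_comp, tensorMk_map_id_left, T.map_comp],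
      tensorMk_map_id_left (fiber ξ x) (T.map v) e⟩)
  refine (existsUnique_congr fun σ => and_congr_right fun _ => ?_).mp h
  exact ⟨fun h ξ a x e => h ξ a x ⟨⟩ e, fun h ξ a x _ e => h ξ a x e⟩

/-- Naturality of `ξ ⊗ a` in the set. -/
theorem Ell.existsUnique_pushFunctor_tensor {Y : Type u} (p : X → Y) :
    ∃! σ : bifunctorComp (tensorBifunctor 𝕜 X A) (pushFunctor 𝕜 A p) ≅
        pushFunctor 𝕜 (BanSp.{u} 𝕜) p ⋙ tensorBifunctor 𝕜 Y A,
      IsIsometricIso₂ σ ∧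
      ∀ (ξ : Ell 𝕜 X (BanSp.{u} 𝕜)) (a : A) (x : X) (e : (fiber ξ x).carrier),
        tensorBifunctorMk ξ a x e ≫ pushInj p (((tensorBifunctor 𝕜 X A).obj ξ).obj a) x ≫
            fiberMap ((σ.hom.app ξ).app a) (p x) =
          tensorBifunctorMk ((pushFunctor 𝕜 (BanSp.{u} 𝕜) p).obj ξ) a (p x)
            (BanSp.toCLM (pushInj p ξ x) e) := by
  let inj (ξ : Ell 𝕜 X (BanSp.{u} 𝕜)) (y : Y) (x : {x // p x = y}) :
      fiber ξ x.1 ⟶ fiber ((pushFunctor 𝕜 (BanSp.{u} 𝕜) p).obj ξ) y :=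
    coprodInj 𝕜 (fun x : {x // p x = y} => fiber ξ x.1) x
  let injA (ζ : Ell 𝕜 X A) (y : Y) (x : {x // p x = y}) :
      fiber ζ x.1 ⟶ fiber ((pushFunctor 𝕜 A p).obj ζ) y :=
    coprodInj 𝕜 (fun x : {x // p x = y} => fiber ζ x.1) x
  have hinj {ξ ζ} (u : ξ ⟶ ζ) (y : Y) (x : {x // p x = y}) :
      inj ξ y x ≫ fiberMap ((pushFunctor 𝕜 (BanSp.{u} 𝕜) p).map u) y =
        fiberMap u x.1 ≫ inj ζ y x :=
    coprodInj_map _ (bddAbove_push p u y) x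
  have hinjA {ξ ζ} (u : ξ ⟶ ζ) (y : Y) (x : {x // p x = y}) :
      injA ξ y x ≫ fiberMap ((pushFunctor 𝕜 A p).map u) y = fiberMap u x.1 ≫ injA ζ y x :=
    coprodInj_map _ (bddAbove_push p u y) x
  have h := existsUnique_isIsometricIso₂_of_fibers
    (F := bifunctorComp (tensorBifunctor 𝕜 X A) (pushFunctor 𝕜 A p))
    (G := pushFunctor 𝕜 (BanSp.{u} 𝕜) p ⋙ tensorBifunctor 𝕜 Y A)
    -- In the fiber at y both sides are the sum, over the points x above y, of the tensors ξ_x ⊗ a;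
    -- on the right because - ⊗ a preserves the coproduct defining `p_!`.
    (X := fun y => {x // p x = y}) (E := fun ξ _ _ x => fiber ξ x.1) (c := fun _ a _ _ => a)
    (fun ξ a y x => (postcomp 𝕜 a (injA (((tensorBifunctor 𝕜 X A).obj ξ).obj a) y x)).comp
      (tensorBifunctorMk ξ a x.1))
    (fun ξ a y x => (postcomp 𝕜 a (tensorMap (inj ξ y x) (𝟙 a))).comp
      (tensorBifunctorMk ξ a x.1))
    (fun ξ a y => IsCoproduct.isWeightedSum (isCoproduct_coprodInj 𝕜 _)
      fun x : {x // p x = y} => isTensor_tensorMk (fiber ξ x.1) a)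
    (fun ξ a y => IsCoproduct.isWeightedSum ((isCoproduct_coprodInj 𝕜
      fun x : {x // p x = y} => fiber ξ x.1).map (isCocontinuous_tensorFunctor_flip_obj a))
      fun x : {x // p x = y} => isTensor_tensorMk (fiber ξ x.1) a)
    (fun {ξ ζ} u a y x e => ⟨𝟙 _, BanSp.toCLM (fiberMap u x.1) e, by
      change (tensorBifunctorMk ξ a x.1 e ≫ injA _ y x) ≫
        fiberMap ((pushFunctor 𝕜 A p).map (((tensorBifunctor 𝕜 X A).map u).app a)) y =
        𝟙 _ ≫ tensorBifunctorMk ζ a x.1 (BanSp.toCLM (fiberMap u x.1) e) ≫ injA _ y x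
      rw [Category.assoc, hinjA, ← Category.assoc, Category.id_comp]
      exact congrArg (· ≫ injA _ y x) (tensorMk_map_id_right (fiberMap u x.1) a e), by
      change (tensorMk (fiber ξ x.1) a e ≫ tensorMap (inj ξ y x) (𝟙 a)) ≫
        tensorMap (fiberMap ((pushFunctor 𝕜 (BanSp.{u} 𝕜) p).map u) y) (𝟙 a) =
        𝟙 _ ≫ tensorMk (fiber ζ x.1) a (BanSp.toCLM (fiberMap u x.1) e) ≫
          tensorMap (inj ζ y x) (𝟙 a)
      rw [Category.assoc, ← tensorMap_comp, hinj, tensorMap_comp, ← Category.assoc,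
        tensorMk_map_id_right, Category.id_comp]⟩)
    (fun ξ {a b} v y x e => ⟨v, e, by
      change (tensorBifunctorMk ξ a x.1 e ≫ injA _ y x) ≫
        fiberMap ((pushFunctor 𝕜 A p).map (((tensorBifunctor 𝕜 X A).obj ξ).map v)) y =
        v ≫ tensorBifunctorMk ξ b x.1 e ≫ injA _ y x
      rw [Category.assoc, hinjA, ← Category.assoc, ← Category.assoc]
      exact congrArg (· ≫ injA _ y x) (tensorMk_map_id_left (fiber ξ x.1) v e), by
      change (tensorMk (fiber ξ x.1) a e ≫ tensorMap (inj ξ y x) (𝟙 a)) ≫ tensorMap (𝟙 _) v =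
        v ≫ tensorMk (fiber ξ x.1) b e ≫ tensorMap (inj ξ y x) (𝟙 b)
      rw [tensorMk_map_id_right, tensorMk_map_id_right]
      exact tensorMk_map_id_left _ v _⟩)
  refine (existsUnique_congr fun σ => and_congr_right fun _ => ?_).mp h
  have key (ξ) (a : A) (x : X) (e : (fiber ξ x).carrier) :
      tensorBifunctorMk ξ a x e ≫ tensorMap (inj ξ (p x) ⟨x, rfl⟩) (𝟙 a) =
        tensorBifunctorMk ((pushFunctor 𝕜 (BanSp.{u} 𝕜) p).obj ξ) a (p x)
          (BanSp.toCLM (pushInj p ξ x) e) :=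
    tensorMk_map_id_right _ a e
  refine ⟨fun h ξ a x e => ?_, fun h ξ a y x e => ?_⟩
  · exact (Category.assoc _ _ _).symm.trans ((h ξ a (p x) ⟨x, rfl⟩ e).trans (key ξ a x e))
  -- Replacing y by p x reduces the condition over pairs of y and a point above it to the condition
  -- over points x.
  · obtain ⟨x, rfl⟩ := x
    exact (Category.assoc _ _ _).trans ((h ξ a x e).trans (key ξ a x e).symm)

/-! ### Vector integrals -/

/-- The canonical maps into the vector integral, as bounded linear maps. -/
def integralMkCLM (μ : Cosheaf.{u} 𝕜 X) (ξ : Ell 𝕜 X A) (x : X) :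
    (μ.atom x).carrier →L[𝕜] (Ell.fiber ξ x ⟶ (integral A μ).obj ξ) :=
  (postcomp 𝕜 (Ell.fiber ξ x) (coprodInj 𝕜 (fun x => tensor (μ.atom x) (Ell.fiber ξ x)) x)).comp
    (tensorMk (μ.atom x) (Ell.fiber ξ x))

theorem isWeightedSum_integralMkCLM (μ : Cosheaf.{u} 𝕜 X) (ξ : Ell 𝕜 X A) :
    IsWeightedSum (integralMkCLM μ ξ) :=
  (isCoproduct_coprodInj 𝕜 _).isWeightedSum fun x => isTensor_tensorMk (μ.atom x) (Ell.fiber ξ x)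

/-- The integral acts on the summand at x by the tensor of the identity of μ {x} with α_x, so the
vector m is left unchanged. This is the naturality input for both integral isomorphisms. -/
theorem integralMk_naturality (μ : Cosheaf.{u} 𝕜 X) {ξ ζ : Ell 𝕜 X A} (α : ξ ⟶ ζ) (x : X)
    (m : (μ.atom x).carrier) :
    integralMk μ ξ x m ≫ (integral A μ).map α = Ell.fiberMap α x ≫ integralMk μ ζ x m := by
  let inj (ζ : Ell 𝕜 X A) : tensor (μ.atom x) (Ell.fiber ζ x) ⟶ (integral A μ).obj ζ :=
    coprodInj 𝕜 (fun x => tensor (μ.atom x) (Ell.fiber ζ x)) x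
  have h : inj ξ ≫ (integral A μ).map α = tensorMap (𝟙 _) (Ell.fiberMap α x) ≫ inj ζ :=
    coprodInj_map _ (bddAbove_integral μ α) x
  change (tensorMk (μ.atom x) (Ell.fiber ξ x) m ≫ inj ξ) ≫ (integral A μ).map α =
    Ell.fiberMap α x ≫ tensorMk (μ.atom x) (Ell.fiber ζ x) m ≫ inj ζ
  rw [Category.assoc, h, ← Category.assoc, tensorMk_map_id_left, Category.assoc]

/-- Vector integrals of `ξ ⊗ a`. -/
theorem existsUnique_integral_tensor (μ : Cosheaf.{u} 𝕜 X) :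
    ∃! σ : bifunctorComp (Ell.tensorBifunctor 𝕜 X A) (integral A μ) ≅
        integral (BanSp.{u} 𝕜) μ ⋙ tensorFunctor 𝕜 A,
      IsIsometricIso₂ σ ∧
      ∀ (ξ : Ell 𝕜 X (BanSp.{u} 𝕜)) (a : A) (x : X) (m : (μ.atom x).carrier)
        (e : (Ell.fiber ξ x).carrier),
        Ell.tensorBifunctorMk ξ a x e ≫
            integralMk μ (((Ell.tensorBifunctor 𝕜 X A).obj ξ).obj a) x m ≫
            (σ.hom.app ξ).app a =
          tensorMk ((integral (BanSp.{u} 𝕜) μ).obj ξ) a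
            (BanSp.toCLM (integralMk μ ξ x m) e) := by
  have h := existsUnique_isIsometricIso₂_of_isWeightedSum
    (F := bifunctorComp (Ell.tensorBifunctor 𝕜 X A) (integral A μ))
    (G := integral (BanSp.{u} 𝕜) μ ⋙ tensorFunctor 𝕜 A)
    -- Both sides are sums of the objects ξ_x ⊗ a weighted by the μ {x}; on the right because - ⊗ a
    -- preserves the weighted sum ∫ ξ dμ of Banach spaces.
    (E := fun _ _ x => μ.atom x) (c := fun ξ a x => tensor (Ell.fiber ξ x) a)
    (fun ξ a => integralMkCLM μ (((Ell.tensorBifunctor 𝕜 X A).obj ξ).obj a))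
    (fun ξ a x => ((isContractive_tensorFunctor_flip_obj a).mapCLM _ _).comp
      (integralMkCLM μ ξ x))
    (fun ξ a => isWeightedSum_integralMkCLM μ _)
    (fun ξ a => (isWeightedSum_integralMkCLM μ ξ).map (isCocontinuous_tensorFunctor_flip_obj a))
    (fun {ξ ζ} u a x m => ⟨tensorMap (Ell.fiberMap u x) (𝟙 a), m,
      integralMk_naturality μ (((Ell.tensorBifunctor 𝕜 X A).map u).app a) x m, by
      change tensorMap (integralMk μ ξ x m) (𝟙 a) ≫
        tensorMap ((integral (BanSp.{u} 𝕜) μ).map u) (𝟙 a) =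
        tensorMap (Ell.fiberMap u x) (𝟙 a) ≫ tensorMap (integralMk μ ζ x m) (𝟙 a)
      rw [← tensorMap_comp, ← tensorMap_comp, integralMk_naturality]⟩)
    (fun ξ {a b} v x m => ⟨tensorMap (𝟙 _) v, m,
      integralMk_naturality μ (((Ell.tensorBifunctor 𝕜 X A).obj ξ).map v) x m, by
      change tensorMap (integralMk μ ξ x m) (𝟙 a) ≫ tensorMap (𝟙 _) v =
        tensorMap (𝟙 _) v ≫ tensorMap (integralMk μ ξ x m) (𝟙 b)
      simp only [← tensorMap_comp, Category.id_comp, Category.comp_id]⟩)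
  refine (existsUnique_congr fun σ => and_congr_right fun _ => ?_).mp h
  have key (ξ) (a : A) (x : X) (m : (μ.atom x).carrier) (e : (Ell.fiber ξ x).carrier) :
      Ell.tensorBifunctorMk ξ a x e ≫ tensorMap (integralMk μ ξ x m) (𝟙 a) =
        tensorMk ((integral (BanSp.{u} 𝕜) μ).obj ξ) a (BanSp.toCLM (integralMk μ ξ x m) e) :=
    tensorMk_map_id_right _ a e
  -- The comparison is stated for morphisms out of ξ_x ⊗ a. These are determined by their
  -- restrictions along the vectors e of ξ_x, which gives the condition on pairs m, e.
  refine ⟨fun h ξ a x m e => ?_, fun h ξ a x m => tensor_hom_ext (𝕜 := 𝕜) fun e => ?_⟩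
  · exact (congrArg (Ell.tensorBifunctorMk ξ a x e ≫ ·) (h ξ a x m)).trans (key ξ a x m e)
  · exact (h ξ a x m e).trans (key ξ a x m e).symm

/-- Cocontinuous functors commute with vector integrals. -/
theorem existsUnique_map_integral (μ : Cosheaf.{u} 𝕜 X) {B : Type w} [Category.{u} B]
    [PreBanachCategory B] [BanachCategory 𝕜 B] [IsBanachTwoSpace 𝕜 B] {T : A ⥤ B}
    (hT : IsCocontinuous 𝕜 T) :
    ∃! σ : integral A μ ⋙ T ≅ Ell.mapFunctor X T hT.contractive ⋙ integral B μ,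
      IsIsometricIso σ ∧
      ∀ (ξ : Ell 𝕜 X A) (x : X) (m : (μ.atom x).carrier),
        T.map (integralMk μ ξ x m) ≫ σ.hom.app ξ =
          integralMk μ ((Ell.mapFunctor X T hT.contractive).obj ξ) x m :=
  existsUnique_isIsometricIso_of_isWeightedSum
    (F := integral A μ ⋙ T) (G := Ell.mapFunctor X T hT.contractive ⋙ integral B μ)
    (E := fun _ x => μ.atom x) (c := fun ξ x => T.obj (Ell.fiber ξ x))
    (fun ξ x => (hT.contractive.mapCLM _ _).comp (integralMkCLM μ ξ x))
    (fun ξ => integralMkCLM μ ((Ell.mapFunctor X T hT.contractive).obj ξ))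
    (fun ξ => (isWeightedSum_integralMkCLM μ ξ).map hT)
    (fun ξ => isWeightedSum_integralMkCLM μ _)
    (fun {ξ ζ} u x m => ⟨T.map (Ell.fiberMap u x), m, by
      change T.map (integralMk μ ξ x m) ≫ T.map ((integral A μ).map u) =
        T.map (Ell.fiberMap u x) ≫ T.map (integralMk μ ζ x m)
      rw [← T.map_comp, integralMk_naturality, T.map_comp],
      integralMk_naturality μ ((Ell.mapFunctor X T hT.contractive).map u) x m⟩)

end universal

end BanachTwo

end


theorem mainTheorem10 (𝕜 : Type) [RCLike 𝕜] (X : Type u) (A : Type v) [Category.{u} A]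
    [PreBanachCategory A] [BanachCategory 𝕜 A] [IsBanachTwoSpace 𝕜 A] :
    -- `ℓ(X)` is a Banach 2-space and `ℓ(X, A)` is the bitensor product of `ℓ(X)` and `A`
    IsBanachTwoSpace 𝕜 (Ell 𝕜 X (BanSp.{u} 𝕜)) ∧
    IsBitensor.{u, w} 𝕜 (Ell.tensorBifunctor 𝕜 X A) ∧
    -- naturality in `A`
    (∀ (B : Type w) [Category.{u} B] [PreBanachCategory B] [BanachCategory 𝕜 B]
      [IsBanachTwoSpace 𝕜 B] (T : A ⥤ B) (hT : IsCocontinuous 𝕜 T),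
      IsCocontinuous 𝕜 (Ell.mapFunctor X T hT.contractive) ∧
      ∃! σ : bifunctorComp (Ell.tensorBifunctor 𝕜 X A) (Ell.mapFunctor X T hT.contractive) ≅
          Ell.tensorBifunctor 𝕜 X B ⋙ (Functor.whiskeringLeft A B (Ell 𝕜 X B)).obj T,
        IsIsometricIso₂ σ ∧
        ∀ (ξ : Ell 𝕜 X (BanSp.{u} 𝕜)) (a : A) (x : X) (e : (Ell.fiber ξ x).carrier),
          T.map (Ell.tensorBifunctorMk ξ a x e) ≫ Ell.fiberMap ((σ.hom.app ξ).app a) x =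
            Ell.tensorBifunctorMk ξ (T.obj a) x e) ∧
    -- naturality in `X`
    (∀ (Y : Type u) (p : X → Y),
      IsCocontinuous 𝕜 (Ell.pushFunctor 𝕜 A p) ∧
      ∃! σ : bifunctorComp (Ell.tensorBifunctor 𝕜 X A) (Ell.pushFunctor 𝕜 A p) ≅
          Ell.pushFunctor 𝕜 (BanSp.{u} 𝕜) p ⋙ Ell.tensorBifunctor 𝕜 Y A,
        IsIsometricIso₂ σ ∧
        ∀ (ξ : Ell 𝕜 X (BanSp.{u} 𝕜)) (a : A) (x : X) (e : (Ell.fiber ξ x).carrier),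
          Ell.tensorBifunctorMk ξ a x e ≫
              Ell.pushInj p (((Ell.tensorBifunctor 𝕜 X A).obj ξ).obj a) x ≫
              Ell.fiberMap ((σ.hom.app ξ).app a) (p x) =
            Ell.tensorBifunctorMk ((Ell.pushFunctor 𝕜 (BanSp.{u} 𝕜) p).obj ξ) a (p x)
              (BanSp.toCLM (Ell.pushInj p ξ x) e)) ∧
    -- vector integrals: the functor `∫ dμ` on `ℓ(X, A)` is induced by the bicocontinuous
    -- bifunctor `(ξ, a) ↦ (∫ ξ dμ) ⊗ a`, and cocontinuous functors commute with integrals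
    (∀ μ : Cosheaf.{u} 𝕜 X,
      IsCocontinuous 𝕜 (integral A μ) ∧
      (∃! σ : bifunctorComp (Ell.tensorBifunctor 𝕜 X A) (integral A μ) ≅
          integral (BanSp.{u} 𝕜) μ ⋙ tensorFunctor 𝕜 A,
        IsIsometricIso₂ σ ∧
        ∀ (ξ : Ell 𝕜 X (BanSp.{u} 𝕜)) (a : A) (x : X) (m : (μ.atom x).carrier)
          (e : (Ell.fiber ξ x).carrier),
          Ell.tensorBifunctorMk ξ a x e ≫
              integralMk μ (((Ell.tensorBifunctor 𝕜 X A).obj ξ).obj a) x m ≫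
              (σ.hom.app ξ).app a =
            tensorMk ((integral (BanSp.{u} 𝕜) μ).obj ξ) a
              (BanSp.toCLM (integralMk μ ξ x m) e)) ∧
      ∀ (B : Type w) [Category.{u} B] [PreBanachCategory B] [BanachCategory 𝕜 B]
        [IsBanachTwoSpace 𝕜 B] (T : A ⥤ B) (hT : IsCocontinuous 𝕜 T),
        ∃! σ : integral A μ ⋙ T ≅ Ell.mapFunctor X T hT.contractive ⋙ integral B μ,
          IsIsometricIso σ ∧
          ∀ (ξ : Ell 𝕜 X A) (x : X) (m : (μ.atom x).carrier),
            T.map (integralMk μ ξ x m) ≫ σ.hom.app ξ =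
              integralMk μ ((Ell.mapFunctor X T hT.contractive).obj ξ) x m) :=
  ⟨inferInstance, Ell.isBitensor_tensorBifunctor,
    fun _ _ _ _ _ _ hT =>
      ⟨Ell.isCocontinuous_mapFunctor hT, Ell.existsUnique_mapFunctor_tensor hT⟩,
    fun _ p => ⟨Ell.isCocontinuous_pushFunctor p, Ell.existsUnique_pushFunctor_tensor p⟩,
    fun μ => ⟨isCocontinuous_integral μ, existsUnique_integral_tensor μ,
      fun _ _ _ _ _ _ hT => existsUnique_map_integral μ hT⟩⟩
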